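/- Let $(M,\boldsymbol p)$ be a projective manifold of dimension $n\ge 2$: $M$ is a smooth manifold and $\boldsymbol p$ is a projective equivalence class of smooth torsion-free affine connections, where $\nabla'\sim\nabla$ iff $\nabla'_a v^b=\nabla_a v^b+\Upsilon_a v^b+\Upsilon_c v^c\delta_a^b$ for some smooth one-form $\Upsilon$. Write $\mathcal E(w)=((\Lambda^nTM)^2)^{w/(2n+2)}$, and $\mathcal B(w)=\mathcal B\otimes\mathcal E(w)$. Let $\mathcal T^*=J^1\mathcal E(1)$ be the cotractor bundle, $X^A$ the jet projection $\mathcal T^*\to\mathcal E(1)$, $Z_A{}^a$ the inclusion $T^*M(1)\to\mathcal T^*$, and, for $\nabla\in\boldsymbol p$, let $Y_A,W^A{}_a$ be the maps of the splitting $\mathcal T^*\cong\mathcal E(1)\oplus T^*M(1)$ determined by $\nabla$ ($X^AY_A=1$, $Z_A{}^bW^A{}_a=\delta^b_a$, $Y_AW^A{}_a=0$). With $[\nabla_a,\nabla_b]v^c=R_{ab}{}^c{}_dv^d$, $R_{bd}=R_{cb}{}^c{}_d$ and $(n-1)\mathsf P_{ab}=R_{ab}-2\mathsf P_{[ab]}$,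 the tractor connection is $\nabla_a(\sigma,\mu_b)=(\nabla_a\sigma-\mu_a,\nabla_a\mu_b+\mathsf P_{ab}\sigma)$; its curvature $\kappa$ is given by $[\nabla_a,\nabla_b]U^C=\kappa_{ab}{}^C{}_DU^D$ on $\mathcal T$, and $\nabla_a\kappa_{bc}$ is formed with the tractor connection coupled to $\nabla$. For $T^H{}_G$ write $(T\sharp L)_{A_1\cdots A_r}=-\sum_iT^H{}_{A_i}L_{A_1\cdots H\cdots A_r}$ ($H$ in position $i$). Round and square brackets denote symmetrisation and skew-symmetrisation (with weight one); indices between vertical bars are excluded from a symmetrisation. On tractor fields $V$ of weight $w$ put $\mathbb D_AV=wY_AV+Z_A{}^a\nabla_aV$. Let $\mathcal T_{(2,2)}\subset\otimes^4\mathcal T^*$ consist of the tensors $L_{DEAB}=L_{(DE)(AB)}$ with $L_{(DEA)B}=0$, and let $P_{(2,2)}=S_{(12)}\circ S_{(34)}\circ S_{[13]}\circ S_{[24]}$ (symmetrisations and skew-symmetrisations in the indicated positions). For $k_{ab}\in\Gamma(S^2T^*M(4))$ put $K_{AB}=Z_A{}^aZ_B{}^bk_{ab}$ and $\mathcal L(k)_{DEAB}=P_{(2,2)}(\mathbb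 D_D\mathbb D_EK_{AB})$. The tensor $k$ is a (weighted) Killing tensor if $\nabla_{(a}k_{bc)}=0$. Consider for $L\in\Gamma(\mathcal T_{(2,2)})$ the equation $\nabla_cL=\mathcal Q_c\sharp L$, that is, $$ \begin{aligned} \nabla_cL_{DEAB}={}& X^F\big(Z_{(A}{}^a\kappa_{|ca|}\sharp L_{B)FED}+Z_{(D}{}^a\kappa_{|ca|}\sharp L_{E)FAB}\big)\\ &+X^FW^C{}_cZ_{(A}{}^aZ_{|(D}{}^d\kappa_{|ad|}\sharp\big(L_{E)F|B)C}-L_{E)C|B)F}\big)\\ &-\tfrac1{12}\big(N_{AD|BE}+N_{AE|BD}+N_{BD|AE}+N_{BE|AD}\big)+\tfrac16\big(N_{AB|DE}+N_{DE|AB}\big)\\ &+\tfrac13\big(R_{AB|DE}+R_{DE|AB}\big), \end{aligned} $$ where (here the bar only separates two pairs of indices, and $c$ is suppressed in $N$ and $R$) $$N_{AB|DE}=X^FX^G\big(3Y_{(A}Z_{B)}{}^b\kappa_{bc}-Z_{(A}{}^aZ_{B)}{}^b\nabla_a\kappa_{bc}\big)\sharp L_{DEFG},$$ $$R_{AB|DE}=X^FX^GW^C{}_c\big(3Y_{(A}Z_{B)}{}^bZ_{(D}{}^d\kappa_{|bd|}-Z_{(A}{}^aZ_{B)}{}^bZ_{(D}{}^d\nabla_{|a}\kappa_{bd|}\big)\sharp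 L_{E)CFG}.$$ In all terms $\kappa_{ab}\sharp$ and $(\nabla_a\kappa_{bc})\sharp$ act on $L$ before contraction and symmetrisation. Then: (i) The Killing operator $k\mapsto\nabla_{(a}k_{bc)}$ and the splitting operator $\mathcal L$ on $\Gamma(S^2T^*M(4))$, the tractor connection $\nabla$ on $\mathcal T_{(2,2)}$, and the right-hand side $\mathcal Q_c\sharp L$ for every $L\in\Gamma(\mathcal T_{(2,2)})$, do not depend on the choice of $\nabla\in\boldsymbol p$. Moreover $\mathcal Q_c\sharp$ is a section of $T^*M\otimes\operatorname{End}(\mathcal T_{(2,2)})$, so that $\nabla_c-\mathcal Q_c\sharp$ is a projectively invariant linear connection on $\mathcal T_{(2,2)}$. (ii) $\mathcal L:\Gamma(S^2T^*M(4))\to\Gamma(\mathcal T_{(2,2)})$ is linear and restricts to a bijection (hence a linear isomorphism) from the weighted Killing tensors of rank $2$ onto the sections $L$ of $\mathcal T_{(2,2)}$ with $\nabla_cL=\mathcal Q_c\sharp L$, equivalently onto the parallel sections of the connection $\nabla_c-\mathcal Q_c\sharp$. -/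

import Mathlib

open scoped Manifold ContDiff

noncomputable section

namespace ProjTractor

/-! ## Manifolds, charts and coordinate expressions

`M` is a smooth manifold modelled on `ℝⁿ`.  A field on `M` is recorded by its component functions
in every chart `φ` of the atlas, subject to the transformation law of the bundle in question.
Component functions are functions on `M` that are meaningful on the domain `φ.source`;
for globally defined fields they are extended by zero outside `φ.source`,
so that two fields are equal exactly if all their components are. -/

/-- The model space `ℝⁿ`. -/
abbrev Model (n : ℕ) : Type := EuclideanSpace ℝ (Fin n)

/-- Abstract tractor indices: `none` is the slot of the density, `some a` that of the
one-form, in a cotractor `(σ, ω_a)`. -/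
abbrev TIdx (n : ℕ) : Type := Option (Fin n)

section charts

variable {n : ℕ} {M : Type*} [TopologicalSpace M] [ChartedSpace (Model n) M]

/-- The partial derivative `∂f/∂xᵃ` in the coordinates given by the chart `φ`. -/
def pd (φ : OpenPartialHomeomorph M (Model n)) (a : Fin n) (f : M → ℝ) (x : M) : ℝ :=
  fderiv ℝ (f ∘ φ.symm) (φ x) (EuclideanSpace.single a (1 : ℝ))

/-- The coordinate vector field `∂/∂xᵃ` of the chart `φ` (on `φ.source`). -/
def coordVF (φ : OpenPartialHomeomorph M (Model n)) (a : Fin n) :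
    (x : M) → TangentSpace (𝓡 n) x :=
  fun x => mfderiv 𝓘(ℝ, Model n) (𝓡 n) φ.symm (φ x) (EuclideanSpace.single a (1 : ℝ))

/-- The `c`-th component of a tangent vector in the chart `φ`. -/
def vecComp (φ : OpenPartialHomeomorph M (Model n)) (c : Fin n) (x : M)
    (v : TangentSpace (𝓡 n) x) : ℝ :=
  (show Model n from mfderiv (𝓡 n) 𝓘(ℝ, Model n) φ x v) c

/-- The Jacobian matrix `J b a = ∂yᵇ/∂xᵃ`, where `x` are the coordinates of `φ` and `y` those
of `ψ`. -/
def jac (φ ψ : OpenPartialHomeomorph M (Model n)) (x : M) : Matrix (Fin n) (Fin n) ℝ :=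
  Matrix.of fun b a => pd φ a (fun z => ψ z b) x

/-- The transition function of the density bundle `𝓔(w) = ((ΛⁿTM)²)^(w/(2n+2))`: a section with
components `s φ`, relative to the trivialisations of `𝓔(w)` induced by `∂/∂x¹ ∧ ⋯ ∧ ∂/∂xⁿ`,
satisfies `s φ = dens w φ ψ * s ψ`. -/
def dens (w : ℝ) (φ ψ : OpenPartialHomeomorph M (Model n)) (x : M) : ℝ :=
  |(jac φ ψ x).det| ^ (-w / ((n : ℝ) + 1))

/-- The transition matrix of the cotractor bundle `𝓣* = J¹𝓔(1)`.  The one-jet of a section `s` of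
`𝓔(1)` has the components `(s φ, ∂_a (s φ))` in the chart `φ`, and the matrix is obtained by
differentiating `s φ = dens 1 φ ψ * s ψ`. -/
def cotractorTrans (φ ψ : OpenPartialHomeomorph M (Model n)) (x : M) : TIdx n → TIdx n → ℝ
  | none, none => dens 1 φ ψ x
  | none, some _ => 0
  | some a, none => pd φ a (dens 1 φ ψ) x
  | some a, some b => dens 1 φ ψ x * jac φ ψ x b a

end charts

/-! ## Fields -/

section fields

variable (n : ℕ) (M : Type*) [TopologicalSpace M] [ChartedSpace (Model n) M]

/-- Components, in all charts, of covariant tensor fields of rank `r`. -/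
abbrev TensorComp (r : ℕ) : Type _ := atlas (Model n) M → (Fin r → Fin n) → M → ℝ

/-- Components, in all charts, of cotractor fields of rank `r`. -/
abbrev CotractorComp (r : ℕ) : Type _ := atlas (Model n) M → (Fin r → TIdx n) → M → ℝ

/-- Components, in all charts, of one-forms with values in rank `r` cotractors. -/
abbrev CotractorFormComp (r : ℕ) : Type _ :=
  atlas (Model n) M → Fin n → (Fin r → TIdx n) → M → ℝ

variable {n M}

/-- `k` is a smooth section of `S²T*M(w)`. -/
structure IsSymTwoTensor (w : ℝ) (k : TensorComp n M 2) : Prop where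
  symm : ∀ φ a b x, k φ ![a, b] x = k φ ![b, a] x
  smooth : ∀ φ I, ContMDiffOn (𝓡 n) 𝓘(ℝ, ℝ) ∞ (k φ I) φ.1.source
  zero_off : ∀ φ I, ∀ x ∉ φ.1.source, k φ I x = 0
  trans : ∀ φ ψ I, ∀ x ∈ φ.1.source ∩ ψ.1.source,
    k φ I x = dens w φ.1 ψ.1 x *
      ∑ J : Fin 2 → Fin n, (∏ i, jac φ.1 ψ.1 x (J i) (I i)) * k ψ J x

/-- The Young symmetries that characterise `𝕍_(2,2)`: symmetric in the first and in the second
pair of indices, and symmetrisation over the first three indices vanishes. -/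
structure HasYoung22 (l : (Fin 4 → TIdx n) → ℝ) : Prop where
  symm₁ : ∀ D E A B, l ![D, E, A, B] = l ![E, D, A, B]
  symm₂ : ∀ D E A B, l ![D, E, A, B] = l ![D, E, B, A]
  bianchi : ∀ D E A B, l ![D, E, A, B] + l ![E, A, D, B] + l ![A, D, E, B] = 0

/-- `L` is a smooth section of the tractor bundle `𝓣_(2,2)` (of weight zero). -/
structure IsT22 (L : CotractorComp n M 4) : Prop where
  young : ∀ φ x, HasYoung22 fun I => L φ I x
  smooth : ∀ φ I, ContMDiffOn (𝓡 n) 𝓘(ℝ, ℝ) ∞ (L φ I) φ.1.source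
  zero_off : ∀ φ I, ∀ x ∉ φ.1.source, L φ I x = 0
  trans : ∀ φ ψ I, ∀ x ∈ φ.1.source ∩ ψ.1.source,
    L φ I x = ∑ J : Fin 4 → TIdx n, (∏ i, cotractorTrans φ.1 ψ.1 x (I i) (J i)) * L ψ J x

/-- `S` is a smooth section of `T*M ⊗ 𝓣_(2,2)`. -/
structure IsT22Form (S : CotractorFormComp n M 4) : Prop where
  young : ∀ φ c x, HasYoung22 fun I => S φ c I x
  smooth : ∀ φ c I, ContMDiffOn (𝓡 n) 𝓘(ℝ, ℝ) ∞ (S φ c I) φ.1.source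
  zero_off : ∀ φ c I, ∀ x ∉ φ.1.source, S φ c I x = 0
  trans : ∀ φ ψ c I, ∀ x ∈ φ.1.source ∩ ψ.1.source,
    S φ c I x = ∑ d, ∑ J : Fin 4 → TIdx n,
      jac φ.1 ψ.1 x d c * (∏ i, cotractorTrans φ.1 ψ.1 x (I i) (J i)) * S ψ d J x

end fields

/-! ## Affine connections and projective structures -/

section connections

variable (n : ℕ) (M : Type*) [TopologicalSpace M] [ChartedSpace (Model n) M]
  [IsManifold (𝓡 n) ∞ M]

/-- A smooth torsion-free affine connection on `M`. -/
structure AffineConnection where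
  cov : CovariantDerivative (𝓡 n) (Model n) (TangentSpace (𝓡 n) : M → Type _)
  smooth : CovariantDerivative.ContMDiffCovariantDerivative cov ∞
  torsion_free : ∀ x, cov.torsion x = 0

variable {n M}

/-- Projective equivalence: `∇'_v X = ∇_v X + Υ(v) X + Υ(X) v` for a smooth one-form `Υ`. -/
def ProjEquiv (nab nab' : AffineConnection n M) : Prop :=
  ∃ Υ : (x : M) → TangentSpace (𝓡 n) x →L[ℝ] ℝ,
    (∀ φ ∈ atlas (Model n) M, ∀ a,
      ContMDiffOn (𝓡 n) 𝓘(ℝ, ℝ) ∞ (fun x => Υ x (coordVF φ a x)) φ.source) ∧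
    ∀ (X : (x : M) → TangentSpace (𝓡 n) x) (x : M),
      MDifferentiableAt (𝓡 n) ((𝓡 n).prod 𝓘(ℝ, Model n))
        (fun y => (⟨y, X y⟩ : Bundle.TotalSpace (Model n) (TangentSpace (𝓡 n) : M → Type _))) x →
      ∀ v : TangentSpace (𝓡 n) x,
        nab'.cov X x v = nab.cov X x v + Υ x v • X x + Υ x (X x) • v

variable (n M) in
/-- A projective structure: a projective equivalence class of torsion-free connections. -/
structure ProjectiveStructure where
  connections : Set (AffineConnection n M)
  nonempty : connections.Nonempty
  isClass : ∀ nab ∈ connections, ∀ nab', nab' ∈ connections ↔ ProjEquiv nab nab'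

end connections

/-! ## Calculus of a connection in a chart -/

section calculus

variable {n : ℕ} {M : Type*} [TopologicalSpace M] [ChartedSpace (Model n) M]
  [IsManifold (𝓡 n) ∞ M]
  (nab : AffineConnection n M) (φ : OpenPartialHomeomorph M (Model n))

/-- Christoffel symbols: `∇_a ∂_b = Γ_{ab}^c ∂_c`. -/
def Gam (a b c : Fin n) (x : M) : ℝ :=
  vecComp φ c x (nab.cov (coordVF φ b) x (coordVF φ a x))

/-- The induced connection on `𝓔(w)` is `∇_a s = ∂_a s + w γ_a s`. -/
def gam (a : Fin n) (x : M) : ℝ := (1 / ((n : ℝ) + 1)) * ∑ b, Gam nab φ a b b x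

/-- The curvature `R_{ab}^c_d`, with `[∇_a, ∇_b] v^c = R_{ab}^c_d v^d`. -/
def Riem (a b c d : Fin n) (x : M) : ℝ :=
  pd φ a (Gam nab φ b d c) x - pd φ b (Gam nab φ a d c) x
    + ∑ e, (Gam nab φ a e c x * Gam nab φ b d e x - Gam nab φ b e c x * Gam nab φ a d e x)

/-- The Ricci curvature `R_{bd} = R_{cb}^c_d`. -/
def Ric (b d : Fin n) (x : M) : ℝ := ∑ c, Riem nab φ c b c d x

/-- The projective Schouten tensor, i.e. the solution of
`(n-1) P_{ab} = R_{ab} + β_{ab}` with `β_{ab} = -2 P_{[ab]} = P_{ba} - P_{ab}`. -/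
def Schouten (a b : Fin n) (x : M) : ℝ :=
  ((n : ℝ) * Ric nab φ a b x + Ric nab φ b a x) / ((n : ℝ) ^ 2 - 1)

/-- The canonical tractor `X^A`. -/
def Xt : TIdx n → ℝ
  | none => 1
  | some _ => 0

/-- The canonical inclusion `Z_A^a`. -/
def Zt : TIdx n → Fin n → ℝ
  | none, _ => 0
  | some b, a => if b = a then 1 else 0

/-- The map `Y_A` of the splitting determined by `∇`: the jet `(σ, ω_a)` has
`∇_a σ = ω_a + γ_a σ`, which vanishes for `ω_a = - γ_a σ`. -/
def Yt : TIdx n → M → ℝ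
  | none, _ => 1
  | some a, x => - gam nab φ a x

/-- The map `W^A_a` of the splitting determined by `∇`. -/
def Wt : TIdx n → Fin n → M → ℝ
  | none, a, x => gam nab φ a x
  | some b, a, _ => if b = a then 1 else 0

/-- The cotractor connection: `∇_a (σ, μ_b) = (∇_a σ - μ_a, ∇_a μ_b + P_{ab} σ)`
in the splitting determined by `∇`. -/
def cotractorCov (a : Fin n) (V : TIdx n → M → ℝ) (A : TIdx n) (x : M) : ℝ :=
  let σ : M → ℝ := fun y => ∑ B, Xt B * V B y
  let μ : Fin n → M → ℝ := fun b y => ∑ B, Wt nab φ B b y * V B y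
  Yt nab φ A x * ((pd φ a σ x + gam nab φ a x * σ x) - μ a x)
    + ∑ b, Zt A b *
      ((pd φ a (μ b) x - ∑ c, Gam nab φ a b c x * μ c x + gam nab φ a x * μ b x)
        + Schouten nab φ a b x * σ x)

/-- Connection coefficients of the tractor connection in the chart:
`∇_a V_A = ∂_a V_A - G_{aA}^B V_B` and `∇_a U^B = ∂_a U^B + G_{aA}^B U^A`.
The argument order is `tgam a A B`. -/
def tgam (a : Fin n) (A B : TIdx n) (x : M) : ℝ :=
  - cotractorCov nab φ a (fun C _ => if C = B then 1 else 0) A x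

/-- The tractor connection, coupled with `∇` on `𝓔(w)`, on rank `r` cotractor fields of
weight `w`. -/
def tractorDeriv {r : ℕ} (w : ℝ) (a : Fin n) (V : (Fin r → TIdx n) → M → ℝ)
    (I : Fin r → TIdx n) (x : M) : ℝ :=
  pd φ a (V I) x + w * gam nab φ a x * V I x
    - ∑ i, ∑ B, tgam nab φ a (I i) B x * V (Function.update I i B) x

/-- The Thomas `D`-operator `D_A V = w Y_A V + Z_A^a ∇_a V` on fields of weight `w`; the new
index comes first. -/
def thomasD {r : ℕ} (w : ℝ) (V : (Fin r → TIdx n) → M → ℝ)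
    (I : Fin (r + 1) → TIdx n) (x : M) : ℝ :=
  w * Yt nab φ (I 0) x * V (Fin.tail I) x
    + ∑ a, Zt (I 0) a * tractorDeriv nab φ w a V (Fin.tail I) x

/-- The tractor curvature `κ_{ab}^C_D`, with `[∇_a, ∇_b] U^C = κ_{ab}^C_D U^D`. -/
def kap (a b : Fin n) (C D : TIdx n) (x : M) : ℝ :=
  pd φ a (tgam nab φ b D C) x - pd φ b (tgam nab φ a D C) x
    + ∑ E, (tgam nab φ a E C x * tgam nab φ b D E x - tgam nab φ b E C x * tgam nab φ a D E x)

/-- The derivative `∇_e κ_{ab}^C_D` for the tractor connection coupled with `∇` on `T*M`. -/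
def dkap (e a b : Fin n) (C D : TIdx n) (x : M) : ℝ :=
  pd φ e (kap nab φ a b C D) x
    - ∑ f, Gam nab φ e a f x * kap nab φ f b C D x
    - ∑ f, Gam nab φ e b f x * kap nab φ a f C D x
    + ∑ E, tgam nab φ e E C x * kap nab φ a b E D x
    - ∑ E, tgam nab φ e D E x * kap nab φ a b C E x

end calculus

/-! ## Algebra -/

section algebra

variable {n : ℕ}

/-- The action `(T♯l)_{A₁…A_r} = - ∑ᵢ T^H_{Aᵢ} l_{A₁…H…A_r}` of an endomorphism `T^H_G` on
cotractors; the argument order is `T H G`. -/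
def sharp {r : ℕ} (T : TIdx n → TIdx n → ℝ) (l : (Fin r → TIdx n) → ℝ) (I : Fin r → TIdx n) : ℝ :=
  - ∑ i, ∑ H, T H (I i) * l (Function.update I i H)

/-- Symmetrisation over the indices in the positions `i` and `j`. -/
def symAt (i j : Fin 4) (l : (Fin 4 → TIdx n) → ℝ) (I : Fin 4 → TIdx n) : ℝ :=
  (l I + l (I ∘ Equiv.swap i j)) / 2

/-- Skew-symmetrisation over the indices in the positions `i` and `j`. -/
def skewAt (i j : Fin 4) (l : (Fin 4 → TIdx n) → ℝ) (I : Fin 4 → TIdx n) : ℝ :=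
  (l I - l (I ∘ Equiv.swap i j)) / 2

/-- The Young symmetriser `P_(2,2) = S_(12) ∘ S_(34) ∘ S_[13] ∘ S_[24]`. -/
def youngP (l : (Fin 4 → TIdx n) → ℝ) : (Fin 4 → TIdx n) → ℝ :=
  symAt 0 1 (symAt 2 3 (skewAt 0 2 (skewAt 1 3 l)))

/-- `s_{(AB)}`. -/
def sym₂ (s : TIdx n → TIdx n → ℝ) (A B : TIdx n) : ℝ := (s A B + s B A) / 2

end algebra

/-! ## The Killing equation, the splitting operator and the prolonging connection -/

section main

variable {n : ℕ} {M : Type*} [TopologicalSpace M] [ChartedSpace (Model n) M]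
  [IsManifold (𝓡 n) ∞ M] (nab : AffineConnection n M)

/-- `∇_a k_{bc}` for a section `k` of `S²T*M(w)`, in a chart. -/
def covTwo (φ : OpenPartialHomeomorph M (Model n)) (w : ℝ) (k : (Fin 2 → Fin n) → M → ℝ)
    (a b c : Fin n) (x : M) : ℝ :=
  pd φ a (k ![b, c]) x + w * gam nab φ a x * k ![b, c] x
    - ∑ d, Gam nab φ a b d x * k ![d, c] x - ∑ d, Gam nab φ a c d x * k ![b, d] x

open Classical in
/-- The Killing operator `k ↦ ∇_{(a} k_{bc)}` on sections of `S²T*M(4)`. -/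
def killingOp (k : TensorComp n M 2) : TensorComp n M 3 := fun φ I x =>
  if x ∈ φ.1.source then
    (covTwo nab φ.1 4 (k φ) (I 0) (I 1) (I 2) x + covTwo nab φ.1 4 (k φ) (I 1) (I 2) (I 0) x
      + covTwo nab φ.1 4 (k φ) (I 2) (I 0) (I 1) x) / 3
  else 0

/-- `k` is a weighted Killing tensor of rank two. -/
def IsKilling (k : TensorComp n M 2) : Prop := IsSymTwoTensor 4 k ∧ killingOp nab k = 0

/-- `K_{BC} = Z_B^b Z_C^c k_{bc}`, of weight `2` if `k` has weight `4`. -/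
def Kt (k : (Fin 2 → Fin n) → M → ℝ) (I : Fin 2 → TIdx n) (x : M) : ℝ :=
  ∑ b, ∑ c, Zt (I 0) b * Zt (I 1) c * k ![b, c] x

open Classical in
/-- The splitting operator `𝓛(k)_{DEAB} = P_(2,2) (D_D D_E K_{AB})`. -/
def splitting (k : TensorComp n M 2) : CotractorComp n M 4 := fun φ I x =>
  if x ∈ φ.1.source then
    youngP (fun J => thomasD nab φ.1 1 (thomasD nab φ.1 2 (Kt (k φ))) J x) I
  else 0

/-- `(κ_{ab}♯l)_I` at the point `x`. -/
def kapSharp (φ : OpenPartialHomeomorph M (Model n)) (x : M) (l : (Fin 4 → TIdx n) → ℝ)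
    (a b : Fin n) (I : Fin 4 → TIdx n) : ℝ :=
  sharp (fun H G => kap nab φ a b H G x) l I

/-- `((∇_e κ_{ab})♯l)_I` at the point `x`. -/
def dkapSharp (φ : OpenPartialHomeomorph M (Model n)) (x : M) (l : (Fin 4 → TIdx n) → ℝ)
    (e a b : Fin n) (I : Fin 4 → TIdx n) : ℝ :=
  sharp (fun H G => dkap nab φ e a b H G x) l I

/-- `X^F X^G (3 Y_{(A} Z_{B)}^b κ_{bc} - Z_{(A}^a Z_{B)}^b ∇_a κ_{bc})♯l_{DEFG}`. -/
def termN (φ : OpenPartialHomeomorph M (Model n)) (x : M) (l : (Fin 4 → TIdx n) → ℝ)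
    (c : Fin n) (A B D E : TIdx n) : ℝ :=
  sym₂ (fun A B => ∑ F, ∑ G, Xt F * Xt G *
    (3 * ∑ b, Yt nab φ A x * Zt B b * kapSharp nab φ x l b c ![D, E, F, G]
      - ∑ a, ∑ b, Zt A a * Zt B b * dkapSharp nab φ x l a b c ![D, E, F, G])) A B

/-- `X^F X^G W^C_c (3 Y_{(A} Z_{B)}^b Z_{(D}^d κ_{|bd|}
  - Z_{(A}^a Z_{B)}^b Z_{(D}^d ∇_{|a} κ_{bd|})♯l_{E)CFG}`. -/
def termR (φ : OpenPartialHomeomorph M (Model n)) (x : M) (l : (Fin 4 → TIdx n) → ℝ)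
    (c : Fin n) (A B D E : TIdx n) : ℝ :=
  sym₂ (fun A B => sym₂ (fun D E => ∑ F, ∑ G, ∑ C, Xt F * Xt G * Wt nab φ C c x *
    (3 * ∑ b, ∑ d, Yt nab φ A x * Zt B b * Zt D d * kapSharp nab φ x l b d ![E, C, F, G]
      - ∑ a, ∑ b, ∑ d, Zt A a * Zt B b * Zt D d * dkapSharp nab φ x l a b d ![E, C, F, G]))
    D E) A B

/-- The value `(Q_c♯l)_{DEAB}` at the point `x`. -/
def Qalg (φ : OpenPartialHomeomorph M (Model n)) (x : M) (l : (Fin 4 → TIdx n) → ℝ)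
    (c : Fin n) (D E A B : TIdx n) : ℝ :=
  sym₂ (fun A B => ∑ F, ∑ a, Xt F * Zt A a * kapSharp nab φ x l c a ![B, F, E, D]) A B
    + sym₂ (fun D E => ∑ F, ∑ a, Xt F * Zt D a * kapSharp nab φ x l c a ![E, F, A, B]) D E
    + sym₂ (fun A B => sym₂ (fun D E => ∑ F, ∑ C, ∑ a, ∑ d,
        Xt F * Wt nab φ C c x * Zt A a * Zt D d *
          (kapSharp nab φ x l a d ![E, F, B, C] - kapSharp nab φ x l a d ![E, C, B, F]))
        D E) A B
    - (1 / 12) * termN nab φ x l c A D B E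
    - (1 / 12) * termN nab φ x l c A E B D
    - (1 / 12) * termN nab φ x l c B D A E
    - (1 / 12) * termN nab φ x l c B E A D
    + (1 / 6) * termN nab φ x l c A B D E
    + (1 / 6) * termN nab φ x l c D E A B
    + (1 / 3) * termR nab φ x l c A B D E
    + (1 / 3) * termR nab φ x l c D E A B

open Classical in
/-- The tractor connection `L ↦ ∇_c L` on weight zero cotractor fields of rank four. -/
def tractorConn (L : CotractorComp n M 4) : CotractorFormComp n M 4 := fun φ c I x =>
  if x ∈ φ.1.source then tractorDeriv nab φ.1 0 c (L φ) I x else 0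

open Classical in
/-- The algebraic operator `L ↦ Q_c♯L`. -/
def Qsharp (L : CotractorComp n M 4) : CotractorFormComp n M 4 := fun φ c I x =>
  if x ∈ φ.1.source then Qalg nab φ.1 x (fun J => L φ J x) c (I 0) (I 1) (I 2) (I 3) else 0

/-- The prolonging connection `∇_c - Q_c♯`. -/
def prolongConn (L : CotractorComp n M 4) : CotractorFormComp n M 4 :=
  tractorConn nab L - Qsharp nab L

end main

section notions

variable {n : ℕ} {M : Type*} [TopologicalSpace M] [ChartedSpace (Model n) M]

/-- `Q` is (the action on sections of) a section of `T*M ⊗ End(𝓣_(2,2))`. -/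
structure IsT22EndForm (Q : CotractorComp n M 4 → CotractorFormComp n M 4) : Prop where
  maps : ∀ L, IsT22 L → IsT22Form (Q L)
  add : ∀ L L', IsT22 L → IsT22 L' → Q (L + L') = Q L + Q L'
  smul : ∀ (f : M → ℝ) L, ContMDiff (𝓡 n) 𝓘(ℝ, ℝ) ∞ f → IsT22 L →
    Q (fun φ I x => f x * L φ I x) = fun φ c I x => f x * Q L φ c I x

/-- `N` is a linear connection on `𝓣_(2,2)`. -/
structure IsT22Connection (N : CotractorComp n M 4 → CotractorFormComp n M 4) : Prop where
  maps : ∀ L, IsT22 L → IsT22Form (N L)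
  add : ∀ L L', IsT22 L → IsT22 L' → N (L + L') = N L + N L'
  leibniz : ∀ (f : M → ℝ) L, ContMDiff (𝓡 n) 𝓘(ℝ, ℝ) ∞ f → IsT22 L →
    N (fun φ I x => f x * L φ I x) =
      fun φ c I x => pd φ.1 c f x * L φ I x + f x * N L φ c I x

end notions

end ProjTractor

end

/-!
The proof rests on one observation: in the frame of `𝓣*` that a chart induces, everything is
expressed by the Thomas parameters, the trace-free part `Π_{ab}^c` of the Christoffel symbols, and
by their derivatives. Indeed `tgam_some_some` and `tgam_some_none` show that the coefficients of
the tractor connection are the `Π_{ab}^c` and the Ricci expression of `Π`; these do not change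
under `∇ ↦ ∇ + Υ` (`ProjEquiv.tgam_eq`). In that frame `𝔻_A` has the components `w V` and `∂_a V`
corrected by the tractor connection coefficients (`thomasD_none`, `thomasD_some`), so that `𝔻`,
the tractor connection, its curvature, the Killing operator and the splitting operator are
projectively invariant.

That these expressions define tractor fields amounts to the gauge law of the connection
coefficients under a change of charts (`gauge_law`). Only its component that contains second
derivatives of the Jacobian is not immediate. It is obtained without computing third derivatives
of the coordinates: the possible defect of the gauge law would change the trace of the curvature,
but this trace vanishes in all charts by the normalisation of the Schouten tensor
(`gaugeDefect_eq_zero`).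

Next, the curvature is regarded as a tractor `W_{AB}^H_G` of weight `-2`, with components `κ_{ab}`
and zero otherwise. It measures the commutator of Thomas operators, `[𝔻_A, 𝔻_B] V = W_{AB}♯V`
(`thomasD_comm`), and satisfies `W_{AB}^H_G X^G = 0` and both Bianchi identities. The derivative
`∇κ` and the correction terms with `Y_A` and `W^A_a` in `Q_c♯L` combine to `𝔻_A W_{BC}`, so that
`Q_c♯L` is the restriction to form directions of a tractor expression `Q_C♯L` (`ambQ`, `Qalg_eq`)
with `X^C Q_C = 0`. Hence `Q_c♯` is an invariantly defined one-form, and its values have the Young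
symmetries by a finite computation (`hasYoung22_ambQ`).

For the bijection, put `K_{AB} = Z_A^a Z_B^b k_{ab}`. The Killing equation is equivalent to
`𝔻_{(A} K_{BC)} = 0` (`killingOp_eq_zero_iff`). If it holds, then the commutation rules express
the Young projection of `𝔻_C 𝔻_D 𝔻_E K_{AB}` by `W`, `𝔻W`, `K` and `𝔻K`, as in the classical
argument that a Killing tensor is determined by finitely many derivatives. Since `K` and `𝔻K` are
slots of `L = 𝓛(k)`, the result is `𝔻_C L = Q_C♯L` (`youngP_eq_ambQ`, `IsSymField.youngP_DDD`).
Conversely, a parallel section `L` satisfies `𝔻_C L = Q_C♯L` in all tractor directions.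
Contracting with `X` once and twice and using `𝔻_A X^B = δ_A^B` (`thomasD_contract`) one recovers
from `K_{AB} = 2/3 X^D X^E L_{DEAB}` that `𝔻_A K_{BC} = 4/3 X^E L_{EABC}`, which is the Killing
equation by the Young symmetry of `L`, and that `P_(2,2) 𝔻𝔻K = L`; this uses that the relevant
contractions of `Q_C♯L` with `X` vanish (`chartQ_none_none`, `youngP_chartQ`). The leading slot
`X^D X^E 𝓛(k)_{DEAB} = 3/2 K_{AB}` gives injectivity.
-/

noncomputable section

set_option linter.unusedSectionVars false

namespace ProjTractor

open Filter Topology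

/-! ### Partial derivatives in charts -/

section pdCalculus

variable {n : ℕ} {M : Type*} [TopologicalSpace M] [ChartedSpace (Model n) M]

variable (n) in
/-- Smoothness of a function at a point of `M`. -/
abbrev Sm (f : M → ℝ) (x : M) : Prop := ContMDiffAt (𝓡 n) 𝓘(ℝ, ℝ) ∞ f x

variable {φ ψ : OpenPartialHomeomorph M (Model n)} {f g : M → ℝ} {x : M}

theorem Sm.sum {ι : Type*} {s : Finset ι} {f : ι → M → ℝ} (h : ∀ i ∈ s, Sm n (f i) x) :
    Sm n (fun y => ∑ i ∈ s, f i y) x :=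
  ContMDiffAt.sum (I' := 𝓘(ℝ, Model n)) h

theorem Sm.prod {ι : Type*} {s : Finset ι} {f : ι → M → ℝ} (h : ∀ i ∈ s, Sm n (f i) x) :
    Sm n (fun y => ∏ i ∈ s, f i y) x := by
  exact ContMDiffAt.prod h

theorem Sm.const (c : ℝ) : Sm n (fun _ : M => c) x := contMDiffAt_const

theorem Sm.add (hf : Sm n f x) (hg : Sm n g x) : Sm n (fun y => f y + g y) x :=
  ContMDiffAt.add hf hg

theorem Sm.sub (hf : Sm n f x) (hg : Sm n g x) : Sm n (fun y => f y - g y) x :=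
  ContMDiffAt.sub hf hg

theorem Sm.neg (hf : Sm n f x) : Sm n (fun y => - f y) x :=
  ContMDiffAt.neg hf

theorem Sm.mul (hf : Sm n f x) (hg : Sm n g x) : Sm n (fun y => f y * g y) x :=
  ContMDiffAt.mul hf hg

theorem Sm.congr (hf : Sm n f x) (h : f =ᶠ[𝓝 x] g) : Sm n g x :=
  hf.congr_of_eventuallyEq h.symm

theorem pd_congr (hx : x ∈ φ.source) (h : f =ᶠ[𝓝 x] g) (a : Fin n) :
    pd φ a f x = pd φ a g x := by
  unfold pd
  have hc : Tendsto φ.symm (𝓝 (φ x)) (𝓝 x) := by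
    have := (φ.continuousAt_symm (φ.map_source hx)).tendsto
    rwa [φ.left_inv hx] at this
  have e : (f ∘ φ.symm) =ᶠ[𝓝 (φ x)] (g ∘ φ.symm) := hc.eventually h
  rw [e.fderiv_eq]

theorem pd_const (φ : OpenPartialHomeomorph M (Model n)) (a : Fin n) (c : ℝ) (x : M) :
    pd φ a (fun _ => c) x = 0 := by
  unfold pd
  have : (fun _ : M => c) ∘ φ.symm = fun _ => c := rfl
  rw [this]
  simp

variable [IsManifold (𝓡 n) ∞ M]

theorem mem_max (hφ : φ ∈ atlas (Model n) M) : φ ∈ IsManifold.maximalAtlas (𝓡 n) ∞ M :=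
  IsManifold.subset_maximalAtlas hφ

theorem Sm.contDiffAt (hφ : φ ∈ atlas (Model n) M) (hx : x ∈ φ.source) (hf : Sm n f x) :
    ContDiffAt ℝ ∞ (f ∘ φ.symm) (φ x) := by
  have h1 : ContMDiffAt (𝓡 n) 𝓘(ℝ, ℝ) ∞ f (φ.symm (φ x)) := by rwa [φ.left_inv hx]
  have h2 := contMDiffAt_symm_of_mem_maximalAtlas (mem_max hφ) (φ.map_source hx)
  exact (h1.comp (φ x) h2).contDiffAt

theorem Sm.of_contDiffAt {F : Model n → ℝ} (hφ : φ ∈ atlas (Model n) M) (hx : x ∈ φ.source)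
    (hF : ContDiffAt ℝ ∞ F (φ x)) : Sm n (fun y => F (φ y)) x := by
  have h2 := contMDiffAt_of_mem_maximalAtlas (mem_max hφ) hx
  exact ContMDiffAt.comp x (I' := 𝓘(ℝ, Model n)) hF.contMDiffAt h2

theorem Sm.differentiableAt (hφ : φ ∈ atlas (Model n) M) (hx : x ∈ φ.source) (hf : Sm n f x) :
    DifferentiableAt ℝ (f ∘ φ.symm) (φ x) :=
  (hf.contDiffAt hφ hx).differentiableAt (by simp)

theorem pd_add (hφ : φ ∈ atlas (Model n) M) (hx : x ∈ φ.source) (hf : Sm n f x) (hg : Sm n g x)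
    (a : Fin n) : pd φ a (fun y => f y + g y) x = pd φ a f x + pd φ a g x := by
  unfold pd
  have : (fun y => f y + g y) ∘ φ.symm = (f ∘ φ.symm) + (g ∘ φ.symm) := rfl
  rw [this, fderiv_add (hf.differentiableAt hφ hx) (hg.differentiableAt hφ hx)]
  rfl

theorem pd_mul (hφ : φ ∈ atlas (Model n) M) (hx : x ∈ φ.source) (hf : Sm n f x) (hg : Sm n g x)
    (a : Fin n) : pd φ a (fun y => f y * g y) x = pd φ a f x * g x + f x * pd φ a g x := by
  unfold pd
  have : (fun y => f y * g y) ∘ φ.symm = (f ∘ φ.symm) * (g ∘ φ.symm) := rfl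
  rw [this, fderiv_mul (hf.differentiableAt hφ hx) (hg.differentiableAt hφ hx)]
  simp [φ.left_inv hx]
  ring

theorem pd_const_mul (hφ : φ ∈ atlas (Model n) M) (hx : x ∈ φ.source) (c : ℝ) (hf : Sm n f x)
    (a : Fin n) : pd φ a (fun y => c * f y) x = c * pd φ a f x := by
  rw [pd_mul hφ hx (Sm.const c) hf, pd_const]
  ring

theorem pd_neg (hφ : φ ∈ atlas (Model n) M) (hx : x ∈ φ.source) (hf : Sm n f x)
    (a : Fin n) : pd φ a (fun y => - f y) x = - pd φ a f x := by
  have := pd_const_mul hφ hx (-1) hf a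
  simpa using this

theorem pd_sub (hφ : φ ∈ atlas (Model n) M) (hx : x ∈ φ.source) (hf : Sm n f x) (hg : Sm n g x)
    (a : Fin n) : pd φ a (fun y => f y - g y) x = pd φ a f x - pd φ a g x := by
  simp only [sub_eq_add_neg]
  rw [pd_add hφ hx hf hg.neg, pd_neg hφ hx hg]

theorem pd_sum {ι : Type*} {s : Finset ι} {f : ι → M → ℝ} (hφ : φ ∈ atlas (Model n) M)
    (hx : x ∈ φ.source) (hf : ∀ i ∈ s, Sm n (f i) x) (a : Fin n) :
    pd φ a (fun y => ∑ i ∈ s, f i y) x = ∑ i ∈ s, pd φ a (f i) x := by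
  classical
  induction s using Finset.induction_on with
  | empty => simpa using pd_const φ a 0 x
  | insert i s hi ih =>
    simp only [Finset.sum_insert hi]
    rw [pd_add hφ hx (hf i (by simp)) (Sm.sum fun j hj => hf j (by simp [hj])),
      ih fun j hj => hf j (by simp [hj])]

theorem pd_prod {ι : Type*} [DecidableEq ι] {s : Finset ι} {f : ι → M → ℝ}
    (hφ : φ ∈ atlas (Model n) M) (hx : x ∈ φ.source) (hf : ∀ i ∈ s, Sm n (f i) x) (a : Fin n) :
    pd φ a (fun y => ∏ i ∈ s, f i y) x = ∑ i ∈ s, (∏ j ∈ s.erase i, f j x) * pd φ a (f i) x := by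
  induction s using Finset.induction_on with
  | empty => simpa using pd_const φ a 1 x
  | insert i s hi ih =>
    simp only [Finset.prod_insert hi, Finset.sum_insert hi]
    rw [pd_mul hφ hx (hf i (by simp)) (Sm.prod fun j hj => hf j (by simp [hj])),
      ih fun j hj => hf j (by simp [hj]), Finset.erase_insert hi, Finset.mul_sum, mul_comm]
    congr 1
    refine Finset.sum_congr rfl fun j hj => ?_
    have hji : i ≠ j := fun h => hi (h ▸ hj)
    rw [Finset.erase_insert_of_ne hji, Finset.prod_insert (by simp [hi])]
    ring

theorem Sm.pd (hφ : φ ∈ atlas (Model n) M) (hx : x ∈ φ.source) (hf : Sm n f x) (a : Fin n) :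
    Sm n (pd φ a f) x := by
  have h := hf.contDiffAt hφ hx
  have h2 : ContDiffAt ℝ ∞ (fun y => fderiv ℝ (f ∘ φ.symm) y (EuclideanSpace.single a (1 : ℝ)))
      (φ x) := (h.fderiv_right (m := ∞) (by simp)).clm_apply contDiffAt_const
  exact Sm.of_contDiffAt hφ hx h2

theorem pd_comm (hφ : φ ∈ atlas (Model n) M) (hx : x ∈ φ.source) (hf : Sm n f x) (a b : Fin n) :
    ProjTractor.pd φ a (ProjTractor.pd φ b f) x = ProjTractor.pd φ b (ProjTractor.pd φ a f) x := by
  have h := hf.contDiffAt hφ hx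
  have key : ∀ c d : Fin n, ProjTractor.pd φ c (ProjTractor.pd φ d f) x =
      fderiv ℝ (fderiv ℝ (f ∘ φ.symm)) (φ x) (EuclideanSpace.single c (1 : ℝ))
        (EuclideanSpace.single d (1 : ℝ)) := by
    intro c d
    have hd : DifferentiableAt ℝ (fderiv ℝ (f ∘ φ.symm)) (φ x) :=
      (h.fderiv_right (m := ∞) (by simp)).differentiableAt (by simp)
    have e : (ProjTractor.pd φ d f ∘ φ.symm) =ᶠ[𝓝 (φ x)]
        fun y => fderiv ℝ (f ∘ φ.symm) y (EuclideanSpace.single d (1 : ℝ)) := by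
      filter_upwards [φ.open_target.mem_nhds (φ.map_source hx)] with y hy
      simp [ProjTractor.pd, φ.right_inv hy]
    unfold ProjTractor.pd at *
    rw [e.fderiv_eq, fderiv_clm_apply hd (by fun_prop)]
    simp
  rw [key, key]
  exact (h.isSymmSndFDerivAt (by
    simpa using (WithTop.coe_le_coe.2 (le_top : (2 : ℕ∞) ≤ ⊤)))).eq _ _

theorem Sm.coord (hψ : ψ ∈ atlas (Model n) M) (hx : x ∈ ψ.source) (b : Fin n) :
    Sm n (fun z => ψ z b) x :=
  Sm.of_contDiffAt (F := fun y => y b) hψ hx (by fun_prop)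

theorem pd_coord (hx : x ∈ φ.source) (a b : Fin n) :
    ProjTractor.pd φ a (fun z => φ z b) x = if b = a then 1 else 0 := by
  unfold ProjTractor.pd
  have e : ((fun z => φ z b) ∘ φ.symm) =ᶠ[𝓝 (φ x)] fun y => (EuclideanSpace.proj b : _ →L[ℝ] ℝ) y := by
    filter_upwards [φ.open_target.mem_nhds (φ.map_source hx)] with y hy
    simp [φ.right_inv hy]
  rw [e.fderiv_eq, ContinuousLinearMap.fderiv]
  simp

theorem pd_chain (hφ : φ ∈ atlas (Model n) M) (hψ : ψ ∈ atlas (Model n) M) (hx : x ∈ φ.source)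
    (hx' : x ∈ ψ.source) (hf : Sm n f x) (a : Fin n) :
    ProjTractor.pd φ a f x = ∑ d, jac φ ψ x d a * ProjTractor.pd ψ d f x := by
  have e : (f ∘ φ.symm) =ᶠ[𝓝 (φ x)] (f ∘ ψ.symm) ∘ (ψ ∘ φ.symm) := by
    have hc : Tendsto φ.symm (𝓝 (φ x)) (𝓝 x) := by
      have := (φ.continuousAt_symm (φ.map_source hx)).tendsto
      rwa [φ.left_inv hx] at this
    filter_upwards [hc.eventually (ψ.open_source.mem_nhds hx')] with y hy
    simp [ψ.left_inv hy]
  have hcoord : ∀ d, DifferentiableAt ℝ (fun y => (ψ ∘ φ.symm) y d) (φ x) := fun d =>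
    (Sm.coord hψ hx' d).differentiableAt hφ hx
  have hd : DifferentiableAt ℝ (ψ ∘ φ.symm) (φ x) := by
    rw [differentiableAt_euclidean]; exact hcoord
  have hval : (ψ ∘ φ.symm) (φ x) = ψ x := by simp [φ.left_inv hx]
  have hf' : DifferentiableAt ℝ (f ∘ ψ.symm) ((ψ ∘ φ.symm) (φ x)) := by
    rw [hval]; exact hf.differentiableAt hψ hx'
  have hpd : ∀ d, jac φ ψ x d a = (fderiv ℝ (ψ ∘ φ.symm) (φ x) (EuclideanSpace.single a 1)) d := by
    intro d
    simp only [jac, Matrix.of_apply, ProjTractor.pd]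
    have : (fun z => ψ z d) ∘ φ.symm = (EuclideanSpace.proj d : _ →L[ℝ] ℝ) ∘ (ψ ∘ φ.symm) := rfl
    rw [this, fderiv_comp _ (ContinuousLinearMap.differentiableAt _) hd,
      ContinuousLinearMap.fderiv]
    rfl
  have hv : fderiv ℝ (ψ ∘ φ.symm) (φ x) (EuclideanSpace.single a 1) =
      ∑ d, jac φ ψ x d a • EuclideanSpace.single d (1 : ℝ) := by
    ext i
    simp [hpd, Pi.single_apply]
  unfold ProjTractor.pd
  rw [e.fderiv_eq, fderiv_comp _ hf' hd, ContinuousLinearMap.comp_apply, hv, map_sum, hval]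
  simp

/-! ### Jacobian matrices and densities -/

theorem Sm.jac (hφ : φ ∈ atlas (Model n) M) (hψ : ψ ∈ atlas (Model n) M) (hx : x ∈ φ.source)
    (hx' : x ∈ ψ.source) (b a : Fin n) : Sm n (fun z => jac φ ψ z b a) x :=
  (Sm.coord hψ hx' b).pd hφ hx a

theorem pd_jac_comm (hφ : φ ∈ atlas (Model n) M) (hψ : ψ ∈ atlas (Model n) M) (hx : x ∈ φ.source)
    (hx' : x ∈ ψ.source) (b a c : Fin n) :
    ProjTractor.pd φ c (fun z => ProjTractor.jac φ ψ z b a) x =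
      ProjTractor.pd φ a (fun z => ProjTractor.jac φ ψ z b c) x :=
  pd_comm hφ hx (Sm.coord hψ hx' b) c a

theorem jac_mul_jac (hφ : φ ∈ atlas (Model n) M) (hψ : ψ ∈ atlas (Model n) M) (hx : x ∈ φ.source)
    (hx' : x ∈ ψ.source) : ProjTractor.jac ψ φ x * ProjTractor.jac φ ψ x = 1 := by
  ext b a
  rw [Matrix.mul_apply]
  have := pd_chain hφ hψ hx hx' (Sm.coord hφ hx b) a
  rw [pd_coord hx] at this
  rw [Matrix.one_apply, this]
  exact Finset.sum_congr rfl fun d _ => mul_comm _ _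

theorem det_jac_ne_zero (hφ : φ ∈ atlas (Model n) M) (hψ : ψ ∈ atlas (Model n) M)
    (hx : x ∈ φ.source) (hx' : x ∈ ψ.source) : (ProjTractor.jac φ ψ x).det ≠ 0 := by
  intro h
  have := congrArg Matrix.det (jac_mul_jac hφ hψ hx hx')
  simp [h] at this

theorem Sm.det {A : M → Matrix (Fin n) (Fin n) ℝ} (h : ∀ i j, Sm n (fun z => A z i j) x) :
    Sm n (fun z => (A z).det) x := by
  simp only [Matrix.det_apply']
  exact Sm.sum fun σ _ => (Sm.const _).mul (Sm.prod fun i _ => h _ _)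

/-- Jacobi's formula for the derivative of a determinant. -/
theorem pd_det {A : M → Matrix (Fin n) (Fin n) ℝ} (hφ : φ ∈ atlas (Model n) M)
    (hx : x ∈ φ.source) (h : ∀ i j, Sm n (fun z => A z i j) x) (a : Fin n) :
    ProjTractor.pd φ a (fun z => (A z).det) x =
      ∑ i, ∑ k, (A x).adjugate i k * ProjTractor.pd φ a (fun z => A z k i) x := by
  have h1 : ∀ i, ∑ k, (A x).adjugate i k * ProjTractor.pd φ a (fun z => A z k i) x =
      ((A x).updateCol i fun k => ProjTractor.pd φ a (fun z => A z k i) x).det := by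
    intro i
    rw [← Matrix.cramer_apply, Matrix.cramer_eq_adjugate_mulVec]
    rfl
  simp only [h1, Matrix.det_apply']
  have hp : ∀ σ : Equiv.Perm (Fin n), Sm n (fun z => ∏ i, A z (σ i) i) x := fun σ =>
    Sm.prod fun i _ => h _ _
  have hs : ∀ σ ∈ (Finset.univ : Finset (Equiv.Perm (Fin n))),
      Sm n (fun z => ((Equiv.Perm.sign σ : ℤ) : ℝ) * ∏ i, A z (σ i) i) x := fun σ _ =>
    (Sm.const _).mul (hp σ)
  rw [pd_sum hφ hx hs, Finset.sum_comm]
  refine Finset.sum_congr rfl fun σ _ => ?_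
  rw [pd_const_mul hφ hx _ (hp σ),
    pd_prod (f := fun i z => A z (σ i) i) hφ hx fun i _ => h _ _, Finset.mul_sum]
  refine Finset.sum_congr rfl fun i _ => ?_
  rw [← Finset.mul_prod_erase _ _ (Finset.mem_univ i), Matrix.updateCol_self]
  congr 1
  rw [mul_comm]
  congr 1
  refine Finset.prod_congr rfl fun j hj => ?_
  rw [Matrix.updateCol_ne (Finset.ne_of_mem_erase hj)]

theorem dens_add_of_ne (h : (ProjTractor.jac φ ψ x).det ≠ 0) (w w' : ℝ) :
    dens (w + w') φ ψ x = dens w φ ψ x * dens w' φ ψ x := by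
  unfold dens
  rw [← Real.rpow_add (abs_pos.mpr h)]
  congr 1
  ring

theorem dens_zero : dens 0 φ ψ x = 1 := by
  simp [dens]

theorem dens_add (hφ : φ ∈ atlas (Model n) M) (hψ : ψ ∈ atlas (Model n) M) (hx : x ∈ φ.source)
    (hx' : x ∈ ψ.source) (w w' : ℝ) : dens (w + w') φ ψ x = dens w φ ψ x * dens w' φ ψ x :=
  dens_add_of_ne (det_jac_ne_zero hφ hψ hx hx') w w'

theorem dens_ne_zero (hφ : φ ∈ atlas (Model n) M) (hψ : ψ ∈ atlas (Model n) M) (hx : x ∈ φ.source)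
    (hx' : x ∈ ψ.source) (w : ℝ) : dens w φ ψ x ≠ 0 :=
  (Real.rpow_pos_of_pos (abs_pos.mpr (det_jac_ne_zero hφ hψ hx hx')) _).ne'

theorem Sm.dens (hφ : φ ∈ atlas (Model n) M) (hψ : ψ ∈ atlas (Model n) M) (hx : x ∈ φ.source)
    (hx' : x ∈ ψ.source) (w : ℝ) : Sm n (ProjTractor.dens w φ ψ) x := by
  have h0 := det_jac_ne_zero hφ hψ hx hx'
  have h1 : Sm n (fun z => (ProjTractor.jac φ ψ z).det) x :=
    Sm.det fun i j => Sm.jac hφ hψ hx hx' i j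
  have h2 : ContDiffAt ℝ ∞ (fun t : ℝ => |t| ^ (-w / ((n : ℝ) + 1))) (ProjTractor.jac φ ψ x).det :=
    (contDiffAt_abs h0).rpow_const_of_ne (abs_pos.mpr h0).ne'
  exact ContMDiffAt.comp x (I' := 𝓘(ℝ, ℝ)) h2.contMDiffAt h1

theorem pd_dens (hφ : φ ∈ atlas (Model n) M) (hψ : ψ ∈ atlas (Model n) M) (hx : x ∈ φ.source)
    (hx' : x ∈ ψ.source) (w : ℝ) (a : Fin n) :
    ProjTractor.pd φ a (ProjTractor.dens w φ ψ) x = - (w / ((n : ℝ) + 1)) *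
      ProjTractor.dens w φ ψ x * ∑ b, ∑ e, ProjTractor.jac ψ φ x b e *
        ProjTractor.pd φ a (fun z => ProjTractor.jac φ ψ z e b) x := by
  have h0 := det_jac_ne_zero hφ hψ hx hx'
  have hs : ∀ i j, Sm n (fun z => ProjTractor.jac φ ψ z i j) x := fun i j =>
    Sm.jac hφ hψ hx hx' i j
  have h1 : Sm n (fun z => (ProjTractor.jac φ ψ z).det) x := Sm.det hs
  have hadj : (ProjTractor.jac φ ψ x).adjugate =
      (ProjTractor.jac φ ψ x).det • ProjTractor.jac ψ φ x := by
    have := Matrix.mul_adjugate (ProjTractor.jac φ ψ x)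
    calc (ProjTractor.jac φ ψ x).adjugate
        = (ProjTractor.jac ψ φ x * ProjTractor.jac φ ψ x) * (ProjTractor.jac φ ψ x).adjugate := by
          rw [jac_mul_jac hφ hψ hx hx', one_mul]
      _ = _ := by rw [mul_assoc, this]; simp
  set D := (ProjTractor.jac φ ψ x).det with hD
  have hdet := pd_det hφ hx hs a
  rw [hadj] at hdet
  set tr := ∑ b, ∑ e, ProjTractor.jac ψ φ x b e *
        ProjTractor.pd φ a (fun z => ProjTractor.jac φ ψ z e b) x with htr
  have hdet' : ProjTractor.pd φ a (fun z => (ProjTractor.jac φ ψ z).det) x = D * tr := by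
    rw [hdet, htr, Finset.mul_sum]
    refine Finset.sum_congr rfl fun i _ => ?_
    rw [Finset.mul_sum]
    exact Finset.sum_congr rfl fun i _ => by simp [Matrix.smul_apply, mul_assoc]
  set p := -w / ((n : ℝ) + 1) with hp
  have hder : HasDerivAt (fun t : ℝ => |t| ^ p) (|D| ^ p * (p / D)) D := by
    have e1 := (hasDerivAt_abs h0).rpow_const (p := p) (Or.inl (abs_pos.mpr h0).ne')
    convert e1 using 1
    rw [Real.rpow_sub_one (abs_pos.mpr h0).ne']
    have : (SignType.sign D : ℝ) = |D| / D := by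
      rcases lt_or_gt_of_ne h0 with h | h
      · simp [sign_neg h, abs_of_neg h, neg_div, div_self h0]
      · simp [sign_pos h, abs_of_pos h, div_self h0]
    rw [this]
    have := (abs_pos.mpr h0).ne'
    field_simp
  have hcomp : ProjTractor.pd φ a (ProjTractor.dens w φ ψ) x = |D| ^ p * (p / D) * (D * tr) := by
    rw [← hdet']
    unfold ProjTractor.pd ProjTractor.dens
    have e : (fun z => |(ProjTractor.jac φ ψ z).det| ^ (-w / ((n : ℝ) + 1))) ∘ φ.symm =
      (fun t : ℝ => |t| ^ p) ∘ ((fun z => (ProjTractor.jac φ ψ z).det) ∘ φ.symm) := rfl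
    have hder' : HasDerivAt (fun t : ℝ => |t| ^ p) (|D| ^ p * (p / D))
        (((fun z => (ProjTractor.jac φ ψ z).det) ∘ φ.symm) (φ x)) := by
      simpa [φ.left_inv hx] using hder
    have := hder'.comp_hasFDerivAt (φ x) (h1.differentiableAt hφ hx).hasFDerivAt
    rw [e, this.fderiv]
    simp [Function.comp_def]
  rw [hcomp]
  have : ProjTractor.dens w φ ψ x = |D| ^ p := rfl
  rw [this, hp]
  field_simp

end pdCalculus

/-! ### Coordinate vector fields and Christoffel symbols -/

section christoffel

variable {n : ℕ} {M : Type*} [TopologicalSpace M] [ChartedSpace (Model n) M]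

/-- A vector field, as a map to the total space of the tangent bundle. -/
abbrev toTotal (X : (x : M) → TangentSpace (𝓡 n) x) (y : M) :
    Bundle.TotalSpace (Model n) (TangentSpace (𝓡 n) : M → Type _) := ⟨y, X y⟩

/-- Smoothness of a vector field at a point. -/
abbrev SmVF [IsManifold (𝓡 n) ∞ M] (X : (x : M) → TangentSpace (𝓡 n) x) (x : M) : Prop :=
  ContMDiffAt (𝓡 n) ((𝓡 n).prod 𝓘(ℝ, Model n)) ∞ (toTotal X) x

variable [IsManifold (𝓡 n) ∞ M] {φ ψ : OpenPartialHomeomorph M (Model n)} {x : M}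

theorem atlas_mdifferentiable (hφ : φ ∈ atlas (Model n) M) :
    φ.MDifferentiable (𝓡 n) 𝓘(ℝ, Model n) := by
  have : IsManifold (𝓡 n) 1 M := IsManifold.of_le (n := ∞) (by simp)
  exact _root_.mdifferentiable_of_mem_atlas hφ

theorem mfderiv_coordVF (hφ : φ ∈ atlas (Model n) M) (hx : x ∈ φ.source) (b : Fin n) :
    mfderiv (𝓡 n) 𝓘(ℝ, Model n) φ x (coordVF φ b x) = EuclideanSpace.single b (1 : ℝ) := by
  have h := (atlas_mdifferentiable hφ).comp_symm_deriv (φ.map_source hx)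
  rw [φ.left_inv hx] at h
  exact congrArg (fun T => T (EuclideanSpace.single b (1 : ℝ))) h

theorem vecComp_coordVF (hφ : φ ∈ atlas (Model n) M) (hx : x ∈ φ.source) (b c : Fin n) :
    vecComp φ c x (coordVF φ b x) = if c = b then 1 else 0 := by
  unfold vecComp
  rw [mfderiv_coordVF hφ hx]
  simp

theorem vecComp_add (c : Fin n) (v w : TangentSpace (𝓡 n) x) :
    vecComp φ c x (v + w) = vecComp φ c x v + vecComp φ c x w := by
  unfold vecComp; rw [map_add]; rfl

theorem vecComp_smul (c : Fin n) (r : ℝ) (v : TangentSpace (𝓡 n) x) :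
    vecComp φ c x (r • v) = r * vecComp φ c x v := by
  unfold vecComp; rw [map_smul]; rfl

theorem vecComp_zero (c : Fin n) : vecComp φ c x 0 = 0 := by
  unfold vecComp; rw [map_zero]; rfl

theorem vecComp_sum {ι : Type*} (s : Finset ι) (c : Fin n) (v : ι → TangentSpace (𝓡 n) x) :
    vecComp φ c x (∑ i ∈ s, v i) = ∑ i ∈ s, vecComp φ c x (v i) := by
  classical
  induction s using Finset.induction_on with
  | empty => simp [vecComp_zero]
  | insert i s hi ih => rw [Finset.sum_insert hi, Finset.sum_insert hi, vecComp_add, ih]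

theorem sum_vecComp_smul (hφ : φ ∈ atlas (Model n) M) (hx : x ∈ φ.source)
    (v : TangentSpace (𝓡 n) x) : v = ∑ c, vecComp φ c x v • coordVF φ c x := by
  have h := (atlas_mdifferentiable hφ).symm_comp_deriv hx
  have h1 : v = mfderiv 𝓘(ℝ, Model n) (𝓡 n) φ.symm (φ x)
      (mfderiv (𝓡 n) 𝓘(ℝ, Model n) φ x v) := (congrArg (fun T => T v) h).symm
  have h2 : ∀ u : Model n, u = ∑ c, u c • EuclideanSpace.single c (1 : ℝ) := by
    intro u; ext i; simp [Pi.single_apply]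
  conv_lhs => rw [h1]
  have h3 := h2 (show Model n from mfderiv (𝓡 n) 𝓘(ℝ, Model n) φ x v)
  refine (congrArg (fun u : Model n => (show TangentSpace (𝓡 n) x from
    mfderiv 𝓘(ℝ, Model n) (𝓡 n) φ.symm (φ x) u)) h3).trans ?_
  refine (map_sum (mfderiv 𝓘(ℝ, Model n) (𝓡 n) φ.symm (φ x)) _ _).trans ?_
  refine Finset.sum_congr rfl fun c _ => ?_
  exact map_smul (mfderiv 𝓘(ℝ, Model n) (𝓡 n) φ.symm (φ x)) _ _

theorem mfderiv_apply_coordVF {f : M → ℝ} (hφ : φ ∈ atlas (Model n) M) (hx : x ∈ φ.source)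
    (hf : Sm n f x) (a : Fin n) :
    (show ℝ from mfderiv (𝓡 n) 𝓘(ℝ, ℝ) f x (coordVF φ a x)) = pd φ a f x := by
  have hs := (atlas_mdifferentiable hφ).mdifferentiableAt_symm (φ.map_source hx)
  have hf' : MDifferentiableAt (𝓡 n) 𝓘(ℝ, ℝ) f (φ.symm (φ x)) := by
    rw [φ.left_inv hx]; exact ContMDiffAt.mdifferentiableAt hf (by simp)
  have h := mfderiv_comp (φ x) hf' hs
  unfold pd
  rw [← mfderiv_eq_fderiv, h, φ.left_inv hx]
  rfl

theorem vecComp_coordVF_change (hφ : φ ∈ atlas (Model n) M) (hψ : ψ ∈ atlas (Model n) M)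
    (hx : x ∈ φ.source) (hx' : x ∈ ψ.source) (b e : Fin n) :
    vecComp ψ e x (coordVF φ b x) = jac φ ψ x e b := by
  have h1 : MDifferentiableAt (𝓡 n) 𝓘(ℝ, Model n) ψ x :=
    (atlas_mdifferentiable hψ).mdifferentiableAt hx'
  have h2 : MDifferentiableAt 𝓘(ℝ, Model n) 𝓘(ℝ, ℝ) (fun y : Model n => y e) (ψ x) := by
    apply DifferentiableAt.mdifferentiableAt
    fun_prop
  have h := mfderiv_comp x h2 h1
  have hj : jac φ ψ x e b = pd φ b ((fun y : Model n => y e) ∘ ψ) x := rfl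
  have hs : Sm n ((fun y : Model n => y e) ∘ ψ) x := Sm.coord hψ hx' e
  rw [hj, ← mfderiv_apply_coordVF hφ hx hs, h]
  have h3 : mfderiv 𝓘(ℝ, Model n) 𝓘(ℝ, ℝ) (fun y : Model n => y e) (ψ x) =
      (EuclideanSpace.proj e : Model n →L[ℝ] ℝ) := by
    rw [mfderiv_eq_fderiv]
    exact (EuclideanSpace.proj e : Model n →L[ℝ] ℝ).fderiv
  rw [h3]
  rfl

theorem coordVF_change (hφ : φ ∈ atlas (Model n) M) (hψ : ψ ∈ atlas (Model n) M)
    (hx : x ∈ φ.source) (hx' : x ∈ ψ.source) (b : Fin n) :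
    coordVF φ b x = ∑ e, jac φ ψ x e b • coordVF ψ e x := by
  rw [sum_vecComp_smul hψ hx' (coordVF φ b x)]
  simp only [vecComp_coordVF_change hφ hψ hx hx']

/-- The constant vector field on `ℝⁿ`. -/
def constVF (v : Model n) : (y : Model n) → TangentSpace 𝓘(ℝ, Model n) y := fun _ => v

theorem coordVF_eq_mpullback (hφ : φ ∈ atlas (Model n) M) (hx : x ∈ φ.source) (b : Fin n) :
    coordVF φ b x = VectorField.mpullback (𝓡 n) 𝓘(ℝ, Model n) φ
      (constVF (EuclideanSpace.single b (1 : ℝ))) x := by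
  have hd := atlas_mdifferentiable hφ
  have : (mfderiv (𝓡 n) 𝓘(ℝ, Model n) φ x).inverse =
      ((hd.mfderiv hx).symm : _ →L[ℝ] _) := by
    rw [← ContinuousLinearMap.inverse_equiv]
    rfl
  refine Eq.trans ?_ (VectorField.mpullback_apply (𝕜 := ℝ) (I := 𝓡 n) (I' := 𝓘(ℝ, Model n))
    (f := φ) (V := constVF (EuclideanSpace.single b (1 : ℝ))) (x := x)).symm
  rw [this]
  rfl

theorem isInvertible_mfderiv (hφ : φ ∈ atlas (Model n) M) (hx : x ∈ φ.source) :
    (mfderiv (𝓡 n) 𝓘(ℝ, Model n) φ x).IsInvertible :=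
  ⟨(atlas_mdifferentiable hφ).mfderiv hx, rfl⟩

theorem constVF_smooth (v : Model n) (y : Model n) :
    ContMDiffAt 𝓘(ℝ, Model n) (𝓘(ℝ, Model n).prod 𝓘(ℝ, Model n)) ∞
      (fun y => (⟨y, constVF v y⟩ : Bundle.TotalSpace (Model n)
        (TangentSpace 𝓘(ℝ, Model n) : Model n → Type _))) y := by
  have h : ∀ {E : Type} [NormedAddCommGroup E] [NormedSpace ℝ E] (v y : E),
      ContMDiffAt 𝓘(ℝ, E) (𝓘(ℝ, E).prod 𝓘(ℝ, E)) ∞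
      (fun y => (⟨y, v⟩ : Bundle.TotalSpace E (TangentSpace 𝓘(ℝ, E) : E → Type _))) y := by
    intro E _ _ v y
    exact contMDiffAt_vectorSpace_iff_contDiffAt.2 contDiffAt_const
  exact h v y

theorem mlieBracket_constVF (v w : Model n) (y : Model n) :
    VectorField.mlieBracket 𝓘(ℝ, Model n) (constVF v) (constVF w) y = 0 := by
  have h : ∀ {E : Type} [NormedAddCommGroup E] [NormedSpace ℝ E] (v w y : E),
      VectorField.mlieBracket 𝓘(ℝ, E) (fun _ => v) (fun _ => w) y = (0 : E) := by
    intro E _ _ v w y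
    refine (congrFun (VectorField.mlieBracketWithin_eq_lieBracketWithin (𝕜 := ℝ)
      (V := fun _ => v) (W := fun _ => w) (s := Set.univ)) y).trans ?_
    simp [VectorField.lieBracketWithin]
    rfl
  exact h v w y

theorem coordVF_smooth (hφ : φ ∈ atlas (Model n) M) (hx : x ∈ φ.source) (b : Fin n) :
    SmVF (coordVF φ b) x := by
  have h := ContMDiffAt.mpullback_vectorField_preimage (m := ∞) (n := ∞) (I := 𝓡 n)
    (I' := 𝓘(ℝ, Model n)) (f := φ) (x₀ := x)
    (V := constVF (EuclideanSpace.single b (1 : ℝ)))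
    (constVF_smooth _ _) (contMDiffAt_of_mem_maximalAtlas (mem_max hφ) hx)
    (isInvertible_mfderiv hφ hx) (by simp)
  refine h.congr_of_eventuallyEq ?_
  filter_upwards [φ.open_source.mem_nhds hx] with y hy
  simp only [toTotal]
  rw [coordVF_eq_mpullback hφ hy]

theorem mlieBracket_coordVF (hφ : φ ∈ atlas (Model n) M) (hx : x ∈ φ.source) (a b : Fin n) :
    VectorField.mlieBracket (𝓡 n) (coordVF φ a) (coordVF φ b) x = 0 := by
  have e : ∀ c : Fin n, coordVF φ c =ᶠ[𝓝 x] VectorField.mpullback (𝓡 n) 𝓘(ℝ, Model n) φ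
      (constVF (EuclideanSpace.single c (1 : ℝ))) := by
    intro c
    filter_upwards [φ.open_source.mem_nhds hx] with y hy
    exact coordVF_eq_mpullback hφ hy c
  rw [(e a).mlieBracket_vectorField_eq (e b)]
  have : IsManifold (𝓡 n) (minSmoothness ℝ 3) M := IsManifold.of_le (n := ∞) (by
    simpa using (WithTop.coe_le_coe.2 (le_top : (3 : ℕ∞) ≤ ⊤)))
  rw [← VectorField.mpullback_mlieBracket (n := ∞)
    ((constVF_smooth _ _).mdifferentiableAt (by simp))
    ((constVF_smooth _ _).mdifferentiableAt (by simp))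
    (contMDiffAt_of_mem_maximalAtlas (mem_max hφ) hx) (by
      simpa using (WithTop.coe_le_coe.2 (le_top : (2 : ℕ∞) ≤ ⊤)))]
  rw [VectorField.mpullback_apply, mlieBracket_constVF, map_zero]

theorem vecComp_smooth {X : (x : M) → TangentSpace (𝓡 n) x} (hφ : φ ∈ atlas (Model n) M)
    (hx : x ∈ φ.source) (hX : SmVF X x) (c : Fin n) :
    Sm n (fun y => vecComp φ c y (X y)) x := by
  have : IsManifold (𝓡 n) 1 M := IsManifold.of_le (n := ∞) (by simp)
  have h1 := (contMDiffOn_of_mem_maximalAtlas (mem_max hφ)).contMDiffOn_tangentMapWithin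
    (m := ∞) (by simp) φ.open_source.uniqueMDiffOn
  have h2 := h1.contMDiffAt (x := toTotal X x)
    ((φ.open_source.preimage (FiberBundle.continuous_proj _ _)).mem_nhds hx)
  have h3 := h2.comp x hX
  have h4 := (contMDiff_snd_tangentBundle_modelSpace (Model n) 𝓘(ℝ, Model n)).contMDiffAt.comp x h3
  have h5 : ContMDiffAt (𝓡 n) 𝓘(ℝ, ℝ) ∞ ((fun u : Model n => u c) ∘ fun y =>
      (show Model n from (tangentMapWithin (𝓡 n) 𝓘(ℝ, Model n) φ φ.source (toTotal X y)).2)) x := by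
    refine ContMDiffAt.comp x (I' := 𝓘(ℝ, Model n)) ?_ h4
    apply ContDiffAt.contMDiffAt
    fun_prop
  refine Sm.congr h5 ?_
  filter_upwards [φ.open_source.mem_nhds hx] with y hy
  exact congrArg (fun T => (show Model n from T (X y)) c)
    (mfderivWithin_of_isOpen (I := 𝓡 n) (I' := 𝓘(ℝ, Model n)) (f := φ) φ.open_source hy)

variable [T2Space M]

/-- A locally smooth vector field agrees, near the point, with a globally smooth one. -/
theorem exists_global_extension {X : (x : M) → TangentSpace (𝓡 n) x}
    {U : Set M} (hU : IsOpen U) (hx : x ∈ U) (hX : ∀ y ∈ U, SmVF X y) :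
    ∃ X' : (x : M) → TangentSpace (𝓡 n) x, (∀ y, SmVF X' y) ∧ ∀ᶠ y in 𝓝 x, X' y = X y := by
  obtain ⟨f, -, hf⟩ := (SmoothBumpFunction.nhds_basis_tsupport (I := 𝓡 n) x).mem_iff.1
    (hU.mem_nhds hx)
  refine ⟨fun y => f y • X y, fun y => ?_, ?_⟩
  · by_cases hy : y ∈ tsupport f
    · exact ContMDiffAt.smul_section (f.contMDiff y) (hX y (hf hy))
    · have h0 : SmVF (fun y => (0 : TangentSpace (𝓡 n) y)) y :=
        (Bundle.contMDiff_zeroSection ℝ (TangentSpace (𝓡 n) : M → Type _)) y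
      refine h0.congr_of_eventuallyEq ?_
      filter_upwards [(isClosed_tsupport f).isOpen_compl.mem_nhds hy] with z hz
      have : f z = 0 := image_eq_zero_of_notMem_tsupport hz
      simp [toTotal, this]
  · filter_upwards [f.eventuallyEq_one] with y hy
    simp [hy]

variable (nab : AffineConnection n M)

theorem cov_congr {X X' : (x : M) → TangentSpace (𝓡 n) x} (hX : SmVF X x)
    (h : ∀ᶠ y in 𝓝 x, X y = X' y) : nab.cov X x = nab.cov X' x := by
  have hX' : SmVF X' x := by
    refine hX.congr_of_eventuallyEq ?_
    filter_upwards [h] with y hy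
    simp [toTotal, hy]
  exact IsCovariantDerivativeOn.congr_of_eventuallyEq nab.cov.isCovariantDerivativeOnUniv
    (hX.mdifferentiableAt (by simp)) (hX'.mdifferentiableAt (by simp)) Filter.univ_mem h

theorem cov_smooth {X Y : (x : M) → TangentSpace (𝓡 n) x} {U : Set M} (hU : IsOpen U)
    (hx : x ∈ U) (hX : ∀ y ∈ U, SmVF X y) (hY : SmVF Y x) :
    SmVF (fun y => nab.cov X y (Y y)) x := by
  obtain ⟨X', h1, h2⟩ := exists_global_extension hU hx hX
  have h3 := nab.smooth.contMDiff.contMDiff (σ := X') (fun y _ => h1 y)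
  have h4 := h3.contMDiffAt (x := x) Filter.univ_mem
  have h5 : SmVF (fun y => nab.cov X' y (Y y)) x :=
    ContMDiffAt.clm_bundle_apply (b := fun y : M => y) h4 hY
  refine h5.congr_of_eventuallyEq ?_
  filter_upwards [h2.eventually_nhds] with y hy
  simp only [toTotal]
  rw [cov_congr nab (h1 y) hy]

theorem Sm.Gam (hφ : φ ∈ atlas (Model n) M) (hx : x ∈ φ.source) (a b c : Fin n) :
    Sm n (Gam nab φ a b c) x :=
  vecComp_smooth hφ hx (cov_smooth nab φ.open_source hx (fun _ hy => coordVF_smooth hφ hy b)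
    (coordVF_smooth hφ hx a)) c

theorem Gam_symm (hφ : φ ∈ atlas (Model n) M) (hx : x ∈ φ.source) (a b c : Fin n) :
    ProjTractor.Gam nab φ a b c x = ProjTractor.Gam nab φ b a c x := by
  have h := nab.cov.torsion_apply ((coordVF_smooth hφ hx a).mdifferentiableAt (by simp))
    ((coordVF_smooth hφ hx b).mdifferentiableAt (by simp))
  rw [nab.torsion_free x, mlieBracket_coordVF hφ hx] at h
  have h' : nab.cov (coordVF φ b) x (coordVF φ a x) = nab.cov (coordVF φ a) x (coordVF φ b x) := by
    have : (0 : TangentSpace (𝓡 n) x) = nab.cov (coordVF φ b) x (coordVF φ a x) -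
      nab.cov (coordVF φ a) x (coordVF φ b x) - 0 := h
    rw [sub_zero] at this
    exact (sub_eq_zero.1 this.symm)
  unfold ProjTractor.Gam
  rw [h']

theorem cov_coordVF (hφ : φ ∈ atlas (Model n) M) (hx : x ∈ φ.source) (a b : Fin n) :
    nab.cov (coordVF φ b) x (coordVF φ a x) = ∑ c, Gam nab φ a b c x • coordVF φ c x :=
  sum_vecComp_smul hφ hx _

theorem cov_sum_smul {ι : Type*} (s : Finset ι) {f : ι → M → ℝ}
    {X : ι → (x : M) → TangentSpace (𝓡 n) x} (hf : ∀ i ∈ s, Sm n (f i) x)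
    (hX : ∀ i ∈ s, SmVF (X i) x) (hφ : φ ∈ atlas (Model n) M) (hx : x ∈ φ.source) (a : Fin n) :
    SmVF (fun y => ∑ i ∈ s, f i y • X i y) x ∧
    nab.cov (fun y => ∑ i ∈ s, f i y • X i y) x (coordVF φ a x) =
      ∑ i ∈ s, (f i x • nab.cov (X i) x (coordVF φ a x) + pd φ a (f i) x • X i x) := by
  classical
  induction s using Finset.induction_on with
  | empty =>
    simp only [Finset.sum_empty]
    refine ⟨(Bundle.contMDiff_zeroSection ℝ (TangentSpace (𝓡 n) : M → Type _)) x, ?_⟩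
    have := congrFun nab.cov.zero x
    exact congrArg (fun T => T (coordVF φ a x)) this
  | insert i s hi ih =>
    obtain ⟨ih1, ih2⟩ := ih (fun j hj => hf j (by simp [hj])) (fun j hj => hX j (by simp [hj]))
    simp only [Finset.sum_insert hi]
    have h1 : SmVF (fun y => f i y • X i y) x :=
      ContMDiffAt.smul_section (hf i (by simp)) (hX i (by simp))
    refine ⟨ContMDiffAt.add_section h1 ih1, ?_⟩
    have h2 := nab.cov.isCovariantDerivativeOnUniv.add (h1.mdifferentiableAt (by simp))
      (ih1.mdifferentiableAt (by simp)) (x := x)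
    have h3 := nab.cov.isCovariantDerivativeOnUniv.leibniz (g := f i)
      ((hX i (by simp)).mdifferentiableAt (by simp))
      (ContMDiffAt.mdifferentiableAt (hf i (by simp)) (by simp)) (x := x)
    rw [← ih2, ← mfderiv_apply_coordVF hφ hx (hf i (by simp)) a]
    have h2' := congrArg (fun T => T (coordVF φ a x)) h2
    have h3' := congrArg (fun T => T (coordVF φ a x)) h3
    refine h2'.trans ?_
    exact congrArg (fun u => u + nab.cov (fun y => ∑ i ∈ s, f i y • X i y) x (coordVF φ a x)) h3'

/-- The transformation law of the Christoffel symbols under a change of coordinates. -/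
theorem Gam_change (hφ : φ ∈ atlas (Model n) M) (hψ : ψ ∈ atlas (Model n) M)
    (hx : x ∈ φ.source) (hx' : x ∈ ψ.source) (a b g : Fin n) :
    ∑ c, Gam nab φ a b c x * jac φ ψ x g c = pd φ a (fun z => jac φ ψ z g b) x +
      ∑ f, ∑ h, jac φ ψ x f a * jac φ ψ x h b * Gam nab ψ f h g x := by
  have h1 : vecComp ψ g x (nab.cov (coordVF φ b) x (coordVF φ a x)) =
      ∑ c, Gam nab φ a b c x * jac φ ψ x g c := by
    rw [cov_coordVF nab hφ hx, vecComp_sum]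
    simp only [vecComp_smul, vecComp_coordVF_change hφ hψ hx hx']
  have hev : ∀ᶠ y in 𝓝 x, coordVF φ b y = ∑ e, jac φ ψ y e b • coordVF ψ e y := by
    filter_upwards [φ.open_source.mem_nhds hx, ψ.open_source.mem_nhds hx'] with y hy hy'
    exact coordVF_change hφ hψ hy hy' b
  have h2 := (cov_sum_smul nab Finset.univ (f := fun e y => jac φ ψ y e b) (X := coordVF ψ)
    (fun e _ => Sm.jac hφ hψ hx hx' e b) (fun e _ => coordVF_smooth hψ hx' e) hφ hx a).2
  rw [← h1, cov_congr nab (coordVF_smooth hφ hx b) hev, h2, vecComp_sum]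
  simp only [vecComp_add, vecComp_smul, vecComp_coordVF hψ hx']
  rw [Finset.sum_add_distrib, add_comm]
  congr 1
  · simp only [mul_ite, mul_one, mul_zero, Finset.sum_ite_eq, Finset.mem_univ, if_true]
  · rw [Finset.sum_comm]
    refine Finset.sum_congr rfl fun h _ => ?_
    rw [coordVF_change hφ hψ hx hx' a, map_sum, vecComp_sum, Finset.mul_sum]
    refine Finset.sum_congr rfl fun f _ => ?_
    rw [map_smul, vecComp_smul]
    unfold ProjTractor.Gam
    ring

theorem ProjEquiv.exists_Gam {nab nab' : AffineConnection n M} (h : ProjEquiv nab nab')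
    (hφ : φ ∈ atlas (Model n) M) :
    ∃ Υ : Fin n → M → ℝ, ∀ x ∈ φ.source, ∀ a b c, ProjTractor.Gam nab' φ a b c x =
      ProjTractor.Gam nab φ a b c x + (if c = b then Υ a x else 0) +
        (if c = a then Υ b x else 0) := by
  obtain ⟨Υ, -, hΥ⟩ := h
  refine ⟨fun a x => Υ x (coordVF φ a x), fun x hx a b c => ?_⟩
  unfold ProjTractor.Gam
  rw [hΥ _ x ((coordVF_smooth hφ hx b).mdifferentiableAt (by simp)), vecComp_add, vecComp_add,
    vecComp_smul, vecComp_smul, vecComp_coordVF hφ hx, vecComp_coordVF hφ hx]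
  simp

end christoffel

/-! ### The Thomas parameters and the tractor connection -/

section thomas

variable {n : ℕ} {M : Type*} [TopologicalSpace M] [ChartedSpace (Model n) M]
  [IsManifold (𝓡 n) ∞ M] (nab : AffineConnection n M) (φ : OpenPartialHomeomorph M (Model n))

/-- The projectively invariant Thomas parameters `Π_{ab}^c`, the trace-free part of the
Christoffel symbols. -/
def thomasPi (a b c : Fin n) (x : M) : ℝ :=
  Gam nab φ a b c x - (if c = b then gam nab φ a x else 0) - (if c = a then gam nab φ b x else 0)

/-- The Ricci curvature of the Thomas parameters. -/
def thomasRic (b d : Fin n) (x : M) : ℝ :=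
  ∑ c, pd φ c (thomasPi nab φ b d c) x -
    ∑ c, ∑ e, thomasPi nab φ b e c x * thomasPi nab φ c d e x

theorem tgam_none_none (a : Fin n) (x : M) : tgam nab φ a none none x = 0 := by
  simp [tgam, cotractorCov, Xt, Zt, Wt, Yt, pd_const]

theorem tgam_none_some (a b : Fin n) (x : M) :
    tgam nab φ a none (some b) x = if a = b then 1 else 0 := by
  simp [tgam, cotractorCov, Xt, Zt, Wt, Yt, pd_const, eq_comm]

theorem tgam_some_some (a b c : Fin n) (x : M) :
    tgam nab φ a (some b) (some c) x = thomasPi nab φ a b c x := by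
  simp only [tgam, cotractorCov, Fintype.sum_option, Xt, Zt, Wt, Yt, thomasPi]
  simp [pd_const, eq_comm (a := c)]
  split_ifs <;> ring

theorem tgam_some_none_aux (a b : Fin n) (x : M) :
    tgam nab φ a (some b) none x = - (pd φ a (gam nab φ b) x -
      ∑ c, Gam nab φ a b c x * gam nab φ c x + gam nab φ a x * gam nab φ b x +
        Schouten nab φ a b x) := by
  have h : (fun y => gam nab φ b y) = gam nab φ b := rfl
  simp [tgam, cotractorCov, Xt, Zt, Wt, Yt, pd_const, h]

variable {φ} {x : M} [T2Space M]

theorem Sm.gam (hφ : φ ∈ atlas (Model n) M) (hx : x ∈ φ.source) (a : Fin n) :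
    Sm n (gam nab φ a) x :=
  (Sm.const _).mul (Sm.sum fun b _ => Sm.Gam nab hφ hx a b b)

theorem Sm.ite_zero {p : Prop} [Decidable p] {f : M → ℝ} (hf : Sm n f x) :
    Sm n (fun y => if p then f y else 0) x := by
  split_ifs
  · exact hf
  · exact Sm.const 0

theorem Sm.thomasPi (hφ : φ ∈ atlas (Model n) M) (hx : x ∈ φ.source) (a b c : Fin n) :
    Sm n (thomasPi nab φ a b c) x :=
  ((Sm.Gam nab hφ hx a b c).sub (Sm.gam nab hφ hx a).ite_zero).sub (Sm.gam nab hφ hx b).ite_zero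

theorem thomasPi_symm (hφ : φ ∈ atlas (Model n) M) (hx : x ∈ φ.source) (a b c : Fin n) :
    ProjTractor.thomasPi nab φ a b c x = ProjTractor.thomasPi nab φ b a c x := by
  unfold ProjTractor.thomasPi
  rw [Gam_symm nab hφ hx a b c]
  ring

theorem eventually_source {P : M → Prop} (hx : x ∈ φ.source) (h : ∀ y ∈ φ.source, P y) :
    ∀ᶠ y in 𝓝 x, P y := by
  filter_upwards [φ.open_source.mem_nhds hx] with y hy using h y hy

theorem sum_Gam (a : Fin n) (x : M) :
    ∑ b, ProjTractor.Gam nab φ a b b x = ((n : ℝ) + 1) * ProjTractor.gam nab φ a x := by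
  have : (n : ℝ) + 1 ≠ 0 := by positivity
  unfold ProjTractor.gam
  field_simp

theorem sum_thomasPi (a : Fin n) (x : M) :
    ∑ b, ProjTractor.thomasPi nab φ a b b x = 0 := by
  unfold ProjTractor.thomasPi
  rw [Finset.sum_sub_distrib, Finset.sum_sub_distrib, sum_Gam]
  simp
  ring

theorem sum_thomasPi' (hφ : φ ∈ atlas (Model n) M) (hx : x ∈ φ.source) (a : Fin n) :
    ∑ b, ProjTractor.thomasPi nab φ b a b x = 0 := by
  rw [← sum_thomasPi nab (φ := φ) a x]
  exact Finset.sum_congr rfl fun b _ => thomasPi_symm nab hφ hx b a b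

theorem Gam_eq_thomasPi (a b c : Fin n) (x : M) : ProjTractor.Gam nab φ a b c x =
    ProjTractor.thomasPi nab φ a b c x + (if c = b then ProjTractor.gam nab φ a x else 0) +
      (if c = a then ProjTractor.gam nab φ b x else 0) := by
  unfold ProjTractor.thomasPi
  ring

theorem pd_Gam (hφ : φ ∈ atlas (Model n) M) (hx : x ∈ φ.source) (a b c d : Fin n) :
    pd φ d (ProjTractor.Gam nab φ a b c) x = pd φ d (ProjTractor.thomasPi nab φ a b c) x +
      (if c = b then pd φ d (ProjTractor.gam nab φ a) x else 0) +
      (if c = a then pd φ d (ProjTractor.gam nab φ b) x else 0) := by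
  have e : ProjTractor.Gam nab φ a b c = fun y => (ProjTractor.thomasPi nab φ a b c y +
      (if c = b then ProjTractor.gam nab φ a y else 0)) +
      (if c = a then ProjTractor.gam nab φ b y else 0) :=
    funext fun y => Gam_eq_thomasPi nab a b c y
  have h1 := Sm.thomasPi nab hφ hx a b c
  have h2 : Sm n (fun y => if c = b then ProjTractor.gam nab φ a y else 0) x :=
    (Sm.gam nab hφ hx a).ite_zero
  have h3 : Sm n (fun y => if c = a then ProjTractor.gam nab φ b y else 0) x :=
    (Sm.gam nab hφ hx b).ite_zero
  rw [e, pd_add hφ hx (h1.add h2) h3, pd_add hφ hx h1 h2]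
  congr 2
  · split_ifs <;> [rfl; exact pd_const φ d 0 x]
  · split_ifs <;> [rfl; exact pd_const φ d 0 x]

theorem Ric_eq (hφ : φ ∈ atlas (Model n) M) (hx : x ∈ φ.source) (b d : Fin n) :
    Ric nab φ b d x = thomasRic nab φ b d x - n * pd φ b (ProjTractor.gam nab φ d) x +
      pd φ d (ProjTractor.gam nab φ b) x + ((n : ℝ) - 1) *
        (∑ c, ProjTractor.thomasPi nab φ b d c x * ProjTractor.gam nab φ c x +
          ProjTractor.gam nab φ b x * ProjTractor.gam nab φ d x) := by
  have h1 : ∑ c, pd φ c (ProjTractor.Gam nab φ b d c) x =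
      ∑ c, pd φ c (ProjTractor.thomasPi nab φ b d c) x + pd φ d (ProjTractor.gam nab φ b) x +
        pd φ b (ProjTractor.gam nab φ d) x := by
    simp only [pd_Gam nab hφ hx, Finset.sum_add_distrib]
    simp
  have h2 : ∑ c, pd φ b (ProjTractor.Gam nab φ c d c) x =
      ((n : ℝ) + 1) * pd φ b (ProjTractor.gam nab φ d) x := by
    rw [← pd_const_mul hφ hx _ (Sm.gam nab hφ hx d),
      ← pd_sum hφ hx fun c _ => Sm.Gam nab hφ hx c d c]
    refine pd_congr hx (eventually_source hx fun y hy => ?_) b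
    rw [← sum_Gam]
    exact Finset.sum_congr rfl fun c _ => Gam_symm nab hφ hy c d c
  have h3 : ∑ c, ∑ e, ProjTractor.Gam nab φ c e c x * ProjTractor.Gam nab φ b d e x =
      ((n : ℝ) + 1) * (∑ c, ProjTractor.thomasPi nab φ b d c x * ProjTractor.gam nab φ c x +
          2 * ProjTractor.gam nab φ b x * ProjTractor.gam nab φ d x) := by
    rw [Finset.sum_comm]
    have : ∀ e, ∑ c, ProjTractor.Gam nab φ c e c x = ((n : ℝ) + 1) * ProjTractor.gam nab φ e x := by
      intro e
      rw [← sum_Gam]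
      exact Finset.sum_congr rfl fun c _ => Gam_symm nab hφ hx c e c
    simp only [← Finset.sum_mul, this, Gam_eq_thomasPi nab b d, mul_add, Finset.sum_add_distrib]
    simp [Finset.mul_sum]
    have : ∀ i, ((n : ℝ) + 1) * ProjTractor.gam nab φ i x * ProjTractor.thomasPi nab φ b d i x =
      ((n : ℝ) + 1) * (ProjTractor.thomasPi nab φ b d i x * ProjTractor.gam nab φ i x) :=
      fun i => by ring
    simp only [this]
    ring
  have h4 : ∑ c, ∑ e, ProjTractor.Gam nab φ b e c x * ProjTractor.Gam nab φ c d e x =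
      ∑ c, ∑ e, ProjTractor.thomasPi nab φ b e c x * ProjTractor.thomasPi nab φ c d e x +
      2 * ∑ c, ProjTractor.thomasPi nab φ b d c x * ProjTractor.gam nab φ c x +
      ((n : ℝ) + 3) * (ProjTractor.gam nab φ b x * ProjTractor.gam nab φ d x) := by
    simp only [Gam_eq_thomasPi nab b _ _, Gam_eq_thomasPi nab _ d _, mul_add, add_mul,
      Finset.sum_add_distrib, mul_ite, ite_mul, mul_zero, zero_mul, Finset.sum_ite_eq,
      Finset.sum_ite_eq', Finset.mem_univ, if_true]
    simp only [← Finset.sum_mul, sum_thomasPi]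
    simp
    have t : ∑ c, ProjTractor.gam nab φ b x * ProjTractor.thomasPi nab φ c d c x = 0 := by
      rw [← Finset.mul_sum, sum_thomasPi' nab hφ hx, mul_zero]
    have t' : ∑ c, ProjTractor.gam nab φ c x * ProjTractor.thomasPi nab φ b d c x =
      ∑ c, ProjTractor.thomasPi nab φ b d c x * ProjTractor.gam nab φ c x :=
      Finset.sum_congr rfl fun c _ => mul_comm _ _
    rw [t, t']
    ring
  simp only [Ric, Riem, Finset.sum_add_distrib, Finset.sum_sub_distrib, h1, h2, h3, h4, thomasRic]
  ring

theorem thomasRic_symm (hφ : φ ∈ atlas (Model n) M) (hx : x ∈ φ.source) (a b : Fin n) :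
    thomasRic nab φ a b x = thomasRic nab φ b a x := by
  unfold thomasRic
  congr 1
  · refine Finset.sum_congr rfl fun c _ => ?_
    exact pd_congr hx (eventually_source hx fun y hy => thomasPi_symm nab hφ hy a b c) c
  · rw [Finset.sum_comm]
    refine Finset.sum_congr rfl fun e _ => Finset.sum_congr rfl fun c _ => ?_
    rw [thomasPi_symm nab hφ hx a e c, thomasPi_symm nab hφ hx c b e]
    ring

theorem Sm.thomasRic (hφ : φ ∈ atlas (Model n) M) (hx : x ∈ φ.source) (a b : Fin n) :
    Sm n (thomasRic nab φ a b) x :=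
  (Sm.sum fun c _ => (Sm.thomasPi nab hφ hx a b c).pd hφ hx c).sub
    (Sm.sum fun c _ => Sm.sum fun e _ =>
      (Sm.thomasPi nab hφ hx a e c).mul (Sm.thomasPi nab hφ hx c b e))

/-- The tractor connection coefficient that involves the Schouten tensor depends on the
Thomas parameters only. -/
theorem tgam_some_none (hn : 2 ≤ n) (hφ : φ ∈ atlas (Model n) M) (hx : x ∈ φ.source)
    (a b : Fin n) : tgam nab φ a (some b) none x = - (thomasRic nab φ a b x / ((n : ℝ) - 1)) := by
  have hn' : (2 : ℝ) ≤ n := by exact_mod_cast hn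
  have h1 : (n : ℝ) - 1 ≠ 0 := by linarith
  have h2 : (n : ℝ) + 1 ≠ 0 := by linarith
  have hs : thomasRic nab φ b a x = thomasRic nab φ a b x := thomasRic_symm nab hφ hx b a
  have hp : ∑ c, ProjTractor.thomasPi nab φ b a c x * ProjTractor.gam nab φ c x =
      ∑ c, ProjTractor.thomasPi nab φ a b c x * ProjTractor.gam nab φ c x :=
    Finset.sum_congr rfl fun c _ => by rw [thomasPi_symm nab hφ hx b a c]
  have hG : ∑ c, ProjTractor.Gam nab φ a b c x * ProjTractor.gam nab φ c x =
      ∑ c, ProjTractor.thomasPi nab φ a b c x * ProjTractor.gam nab φ c x +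
        2 * (ProjTractor.gam nab φ a x * ProjTractor.gam nab φ b x) := by
    simp only [Gam_eq_thomasPi nab a b, add_mul, Finset.sum_add_distrib]
    simp
    ring
  rw [tgam_some_none_aux, hG, Schouten, Ric_eq nab hφ hx a b, Ric_eq nab hφ hx b a, hs, hp,
    show (n : ℝ) ^ 2 - 1 = ((n : ℝ) - 1) * ((n : ℝ) + 1) by ring]
  field_simp
  ring

theorem tgam_some_none_symm (hn : 2 ≤ n) (hφ : φ ∈ atlas (Model n) M) (hx : x ∈ φ.source)
    (a b : Fin n) : tgam nab φ a (some b) none x = tgam nab φ b (some a) none x := by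
  rw [tgam_some_none nab hn hφ hx, tgam_some_none nab hn hφ hx, thomasRic_symm nab hφ hx]

theorem tgam_some_symm (hn : 2 ≤ n) (hφ : φ ∈ atlas (Model n) M) (hx : x ∈ φ.source)
    (a b : Fin n) (C : TIdx n) : tgam nab φ a (some b) C x = tgam nab φ b (some a) C x := by
  cases C with
  | none => exact tgam_some_none_symm nab hn hφ hx a b
  | some c => rw [tgam_some_some, tgam_some_some, thomasPi_symm nab hφ hx]

theorem Sm.tgam (hn : 2 ≤ n) (hφ : φ ∈ atlas (Model n) M) (hx : x ∈ φ.source)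
    (a : Fin n) (A B : TIdx n) : Sm n (tgam nab φ a A B) x := by
  cases A with
  | none => cases B with
    | none =>
      exact Sm.congr (Sm.const 0) (Eventually.of_forall fun y => (tgam_none_none nab φ a y).symm)
    | some b =>
      exact Sm.congr (Sm.const _) (Eventually.of_forall fun y => (tgam_none_some nab φ a b y).symm)
  | some b => cases B with
    | none =>
      refine Sm.congr (((Sm.thomasRic nab hφ hx a b).mul (Sm.const ((n : ℝ) - 1)⁻¹)).neg)
        (eventually_source hx fun y hy => ?_)
      rw [tgam_some_none nab hn hφ hy, div_eq_mul_inv]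
    | some c =>
      exact Sm.congr (Sm.thomasPi nab hφ hx a b c)
        (Eventually.of_forall fun y => (tgam_some_some nab φ a b c y).symm)

variable {nab} {nab' : AffineConnection n M}

theorem ProjEquiv.thomasPi_eq (h : ProjEquiv nab nab') (hφ : φ ∈ atlas (Model n) M)
    (hx : x ∈ φ.source) (a b c : Fin n) :
    ProjTractor.thomasPi nab' φ a b c x = ProjTractor.thomasPi nab φ a b c x := by
  obtain ⟨Υ, hΥ⟩ := h.exists_Gam hφ
  have hg : ∀ a, ProjTractor.gam nab' φ a x = ProjTractor.gam nab φ a x + Υ a x := by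
    intro a
    have hn : (n : ℝ) + 1 ≠ 0 := by positivity
    unfold ProjTractor.gam
    simp only [hΥ x hx, Finset.sum_add_distrib]
    simp
    field_simp
    ring
  unfold ProjTractor.thomasPi
  rw [hΥ x hx, hg, hg]
  split_ifs <;> ring

/-- Projectively equivalent connections induce the same tractor connection. -/
theorem ProjEquiv.tgam_eq (h : ProjEquiv nab nab') (hn : 2 ≤ n) (hφ : φ ∈ atlas (Model n) M)
    (hx : x ∈ φ.source) (a : Fin n) (A B : TIdx n) :
    ProjTractor.tgam nab' φ a A B x = ProjTractor.tgam nab φ a A B x := by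
  cases A with
  | none => cases B with
    | none => rw [tgam_none_none, tgam_none_none]
    | some b => rw [tgam_none_some, tgam_none_some]
  | some b => cases B with
    | none =>
      rw [tgam_some_none nab' hn hφ hx, tgam_some_none nab hn hφ hx]
      congr 2
      unfold ProjTractor.thomasRic
      congr 1
      · refine Finset.sum_congr rfl fun c _ => ?_
        exact pd_congr hx (eventually_source hx fun y hy => h.thomasPi_eq hφ hy a b c) c
      · simp only [h.thomasPi_eq hφ hx]
    | some c => rw [tgam_some_some, tgam_some_some, h.thomasPi_eq hφ hx]

end thomas

/-! ### The action of endomorphisms on cotractors -/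

section sharpAlgebra

variable {n r : ℕ}

theorem sharp_cons (T : TIdx n → TIdx n → ℝ) (l : (Fin (r + 1) → TIdx n) → ℝ) (A : TIdx n)
    (I : Fin r → TIdx n) : sharp T l (Matrix.vecCons A I) =
      - ∑ H, T H A * l (Matrix.vecCons H I) + sharp T (fun J => l (Matrix.vecCons A J)) I := by
  unfold sharp Matrix.vecCons
  rw [Fin.sum_univ_succ, neg_add]
  simp only [Fin.update_cons_zero, Fin.cons_zero, Fin.cons_succ, Fin.cons_update]

theorem sharp_nil (T : TIdx n → TIdx n → ℝ) (l : (Fin 0 → TIdx n) → ℝ) (I : Fin 0 → TIdx n) :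
    sharp T l I = 0 := by
  simp [sharp]

theorem sharp_add_right (T : TIdx n → TIdx n → ℝ) (l l' : (Fin r → TIdx n) → ℝ)
    (I : Fin r → TIdx n) : sharp T (fun J => l J + l' J) I = sharp T l I + sharp T l' I := by
  simp only [sharp, mul_add, Finset.sum_add_distrib, neg_add]

theorem sharp_smul_right (T : TIdx n → TIdx n → ℝ) (c : ℝ) (l : (Fin r → TIdx n) → ℝ)
    (I : Fin r → TIdx n) : sharp T (fun J => c * l J) I = c * sharp T l I := by
  simp only [sharp, mul_left_comm _ c, ← Finset.mul_sum, mul_neg]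

theorem sharp_add_left (T S : TIdx n → TIdx n → ℝ) (l : (Fin r → TIdx n) → ℝ)
    (I : Fin r → TIdx n) : sharp (fun H G => T H G + S H G) l I = sharp T l I + sharp S l I := by
  simp only [sharp, add_mul, Finset.sum_add_distrib, neg_add]

theorem sharp_smul_left (T : TIdx n → TIdx n → ℝ) (c : ℝ) (l : (Fin r → TIdx n) → ℝ)
    (I : Fin r → TIdx n) : sharp (fun H G => c * T H G) l I = c * sharp T l I := by
  simp only [sharp, mul_assoc, ← Finset.mul_sum, mul_neg]

theorem sharp_sub_left (T S : TIdx n → TIdx n → ℝ) (l : (Fin r → TIdx n) → ℝ)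
    (I : Fin r → TIdx n) : sharp (fun H G => T H G - S H G) l I = sharp T l I - sharp S l I := by
  simp only [sharp, sub_mul, Finset.sum_sub_distrib]
  ring

theorem sharp_sum_left {ι : Type*} (s : Finset ι) (T : ι → TIdx n → TIdx n → ℝ)
    (l : (Fin r → TIdx n) → ℝ) (I : Fin r → TIdx n) :
    sharp (fun H G => ∑ k ∈ s, T k H G) l I = ∑ k ∈ s, sharp (T k) l I := by
  simp only [sharp, Finset.sum_mul, Finset.sum_neg_distrib]
  rw [Finset.sum_comm (s := s)]
  congr 1
  exact Finset.sum_congr rfl fun i _ => Finset.sum_comm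

theorem sharp_zero_left (l : (Fin r → TIdx n) → ℝ) (I : Fin r → TIdx n) :
    sharp (fun _ _ => 0) l I = 0 := by
  simp [sharp]

theorem sharp_perm (T : TIdx n → TIdx n → ℝ) (l : (Fin r → TIdx n) → ℝ) (σ : Equiv.Perm (Fin r))
    (I : Fin r → TIdx n) : sharp T (fun J => l (J ∘ σ)) I = sharp T l (I ∘ σ) := by
  unfold sharp
  congr 1
  refine (Fintype.sum_equiv σ _ _ fun i => ?_).symm
  refine Finset.sum_congr rfl fun H _ => ?_
  simp only [Function.comp_apply, Function.update_comp_equiv, Equiv.symm_apply_apply]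

/-- The action `♯` is a representation of the Lie algebra of endomorphisms. -/
theorem sharp_comm (T S : TIdx n → TIdx n → ℝ) (l : (Fin r → TIdx n) → ℝ) (I : Fin r → TIdx n) :
    sharp T (sharp S l) I - sharp S (sharp T l) I =
      sharp (fun K G => ∑ H, (T K H * S H G - S K H * T H G)) l I := by
  have key : ∀ T S : TIdx n → TIdx n → ℝ, sharp T (sharp S l) I =
      ∑ i, ∑ j, (if i = j then ∑ K, (∑ H, S K H * T H (I i)) * l (Function.update I i K) else
        ∑ H, ∑ K, T H (I i) * S K (I j) * l (Function.update (Function.update I i H) j K)) := by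
    intro T S
    unfold sharp
    rw [← Finset.sum_neg_distrib]
    refine Finset.sum_congr rfl fun i _ => ?_
    have : ∀ H, T H (I i) * -∑ j, ∑ K, S K (Function.update I i H j) *
        l (Function.update (Function.update I i H) j K) = - ∑ j, ∑ K, T H (I i) *
        (S K (Function.update I i H j) * l (Function.update (Function.update I i H) j K)) := by
      intro H
      rw [mul_neg, Finset.mul_sum]
      simp only [Finset.mul_sum]
    simp only [this]
    rw [Finset.sum_neg_distrib, neg_neg, Finset.sum_comm]
    refine Finset.sum_congr rfl fun j _ => ?_
    split_ifs with h
    · subst h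
      rw [Finset.sum_comm]
      refine Finset.sum_congr rfl fun K _ => ?_
      rw [Finset.sum_mul]
      refine Finset.sum_congr rfl fun H _ => ?_
      rw [Function.update_self, Function.update_idem]
      ring
    · refine Finset.sum_congr rfl fun H _ => Finset.sum_congr rfl fun K _ => ?_
      rw [Function.update_of_ne (Ne.symm h)]
      ring
  rw [key T S, key S T, Finset.sum_comm (f := fun i j => if i = j then
    ∑ K, (∑ H, T K H * S H (I i)) * l (Function.update I i K) else _), ← Finset.sum_sub_distrib]
  unfold sharp
  rw [← Finset.sum_neg_distrib]
  refine Finset.sum_congr rfl fun i _ => ?_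
  rw [← Finset.sum_sub_distrib, Finset.sum_eq_single i]
  · rw [if_pos rfl, if_pos rfl, ← Finset.sum_sub_distrib, ← Finset.sum_neg_distrib]
    refine Finset.sum_congr rfl fun K _ => ?_
    simp only [Finset.sum_sub_distrib]
    ring
  · intro j _ hj
    rw [if_neg (Ne.symm hj), if_neg hj, Finset.sum_comm, sub_eq_zero]
    refine Finset.sum_congr rfl fun H _ => Finset.sum_congr rfl fun K _ => ?_
    rw [Function.update_comm hj]
    ring
  · simp

/-- The action of a matrix on the components of a covariant tensor. -/
def tens (T : TIdx n → TIdx n → ℝ) (l : (Fin r → TIdx n) → ℝ) (I : Fin r → TIdx n) : ℝ :=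
  ∑ J : Fin r → TIdx n, (∏ i, T (I i) (J i)) * l J

theorem tens_cons (T : TIdx n → TIdx n → ℝ) (l : (Fin (r + 1) → TIdx n) → ℝ) (A : TIdx n)
    (I : Fin r → TIdx n) : tens T l (Matrix.vecCons A I) =
      ∑ B, T A B * tens T (fun J => l (Matrix.vecCons B J)) I := by
  unfold tens
  rw [← (Fin.consEquiv fun _ => TIdx n).sum_comp, Fintype.sum_prod_type]
  refine Finset.sum_congr rfl fun B _ => ?_
  rw [Finset.mul_sum]
  refine Finset.sum_congr rfl fun J _ => ?_
  rw [Fin.prod_univ_succ]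
  simp only [Fin.consEquiv, Equiv.coe_fn_mk, Matrix.vecCons, Fin.cons_zero, Fin.cons_succ]
  ring

theorem tens_add (T : TIdx n → TIdx n → ℝ) (l l' : (Fin r → TIdx n) → ℝ) (I : Fin r → TIdx n) :
    tens T (fun J => l J + l' J) I = tens T l I + tens T l' I := by
  simp only [tens, mul_add, Finset.sum_add_distrib]

theorem tens_smul (T : TIdx n → TIdx n → ℝ) (c : ℝ) (l : (Fin r → TIdx n) → ℝ)
    (I : Fin r → TIdx n) : tens T (fun J => c * l J) I = c * tens T l I := by
  simp only [tens, mul_left_comm _ c, ← Finset.mul_sum]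

theorem tens_sum {ι : Type*} (s : Finset ι) (T : TIdx n → TIdx n → ℝ)
    (l : ι → (Fin r → TIdx n) → ℝ) (I : Fin r → TIdx n) :
    tens T (fun J => ∑ k ∈ s, l k J) I = ∑ k ∈ s, tens T (l k) I := by
  simp only [tens, Finset.mul_sum]
  exact Finset.sum_comm

/-- The derivative of the action on tensors of a matrix `T` with derivative
`DT = X T - T Y`. -/
theorem sum_prod_erase_mul (T X Y DT : TIdx n → TIdx n → ℝ)
    (h : ∀ A B, DT A B = ∑ C, X C A * T C B - ∑ C, T A C * Y B C) (l : (Fin r → TIdx n) → ℝ)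
    (I : Fin r → TIdx n) :
    ∑ J : Fin r → TIdx n, (∑ i, (∏ j ∈ Finset.univ.erase i, T (I j) (J j)) * DT (I i) (J i)) * l J =
      - sharp X (tens T l) I + tens T (sharp Y l) I := by
  have hprod : ∀ (J : Fin r → TIdx n) i, ∏ j, T (I j) (J j) =
      T (I i) (J i) * ∏ j ∈ Finset.univ.erase i, T (I j) (J j) := fun J i =>
    (Finset.mul_prod_erase _ _ (Finset.mem_univ i)).symm
  have h1 : - sharp X (tens T l) I = ∑ i, ∑ J : Fin r → TIdx n,
      (∏ j ∈ Finset.univ.erase i, T (I j) (J j)) * (∑ C, X C (I i) * T C (J i)) * l J := by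
    simp only [sharp, neg_neg, tens, Finset.mul_sum, Finset.sum_mul]
    refine Finset.sum_congr rfl fun i _ => ?_
    rw [Finset.sum_comm]
    refine Finset.sum_congr rfl fun J _ => Finset.sum_congr rfl fun C _ => ?_
    rw [← Finset.mul_prod_erase _ _ (Finset.mem_univ i), Function.update_self]
    have : ∏ j ∈ Finset.univ.erase i, T (Function.update I i C j) (J j) =
        ∏ j ∈ Finset.univ.erase i, T (I j) (J j) := by
      refine Finset.prod_congr rfl fun j hj => ?_
      rw [Function.update_of_ne (Finset.ne_of_mem_erase hj)]
    rw [this]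
    ring
  have h2 : tens T (sharp Y l) I = - ∑ i, ∑ J : Fin r → TIdx n,
      (∏ j ∈ Finset.univ.erase i, T (I j) (J j)) * (∑ C, T (I i) C * Y (J i) C) * l J := by
    simp only [sharp, tens, mul_neg, Finset.sum_neg_distrib, Finset.mul_sum, Finset.sum_mul]
    rw [Finset.sum_comm]
    congr 1
    refine Finset.sum_congr rfl fun i _ => ?_
    rw [← Fintype.sum_prod_type', ← Fintype.sum_prod_type']
    -- exchange the summation index in the slot `i` with the contracted one
    have hinv : Function.Involutive fun p : (Fin r → TIdx n) × TIdx n =>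
        (Function.update p.1 i p.2, p.1 i) := by
      rintro ⟨J, C⟩
      simp
    refine Fintype.sum_equiv hinv.toPerm _ _ fun p => ?_
    simp only [Function.Involutive.coe_toPerm, Function.update_self]
    have : ∏ j ∈ Finset.univ.erase i, T (I j) (Function.update p.1 i p.2 j) =
        ∏ j ∈ Finset.univ.erase i, T (I j) (p.1 j) := by
      refine Finset.prod_congr rfl fun j hj => ?_
      rw [Function.update_of_ne (Finset.ne_of_mem_erase hj)]
    rw [this, hprod p.1 i]
    ring
  rw [h1, h2, ← sub_eq_add_neg, ← Finset.sum_sub_distrib]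
  simp only [Finset.sum_mul]
  rw [Finset.sum_comm]
  refine Finset.sum_congr rfl fun i _ => ?_
  rw [← Finset.sum_sub_distrib]
  refine Finset.sum_congr rfl fun J _ => ?_
  rw [h]
  simp only [mul_sub, sub_mul]

/-- The action `♯` is equivariant. -/
theorem sharp_tens (T X Y : TIdx n → TIdx n → ℝ)
    (h : ∀ A B, ∑ C, X C A * T C B = ∑ C, T A C * Y B C) (l : (Fin r → TIdx n) → ℝ)
    (I : Fin r → TIdx n) : sharp X (tens T l) I = tens T (sharp Y l) I := by
  have := sum_prod_erase_mul T X Y (fun _ _ => 0) (fun A B => by rw [h, sub_self]) l I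
  simp only [mul_zero, Finset.sum_const_zero, zero_mul] at this
  linarith

end sharpAlgebra

/-! ### The Thomas operator in a chart -/

section thomasOperator

variable {n r : ℕ} {M : Type*} [TopologicalSpace M] [ChartedSpace (Model n) M]
  [IsManifold (𝓡 n) ∞ M] (nab : AffineConnection n M) (φ : OpenPartialHomeomorph M (Model n))

theorem tractorDeriv_eq (w : ℝ) (a : Fin n) (V : (Fin r → TIdx n) → M → ℝ) (I : Fin r → TIdx n)
    (x : M) : tractorDeriv nab φ w a V I x = pd φ a (V I) x + w * gam nab φ a x * V I x +
      sharp (fun H G => tgam nab φ a G H x) (fun J => V J x) I := by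
  unfold tractorDeriv sharp
  ring

theorem thomasD_none (w : ℝ) (V : (Fin r → TIdx n) → M → ℝ) (I : Fin r → TIdx n) (x : M) :
    thomasD nab φ w V (Matrix.vecCons none I) x = w * V I x := by
  simp [thomasD, Matrix.vecCons, Yt, Zt]

theorem thomasD_some (w : ℝ) (V : (Fin r → TIdx n) → M → ℝ) (a : Fin n) (I : Fin r → TIdx n)
    (x : M) : thomasD nab φ w V (Matrix.vecCons (some a) I) x = pd φ a (V I) x +
      sharp (fun H G => tgam nab φ a G H x) (fun J => V J x) I := by
  simp only [thomasD, Matrix.vecCons, Yt, Zt, Fin.cons_zero, Fin.tail_cons, tractorDeriv_eq]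
  simp only [ite_mul, one_mul, zero_mul, Finset.sum_ite_eq, Finset.mem_univ, if_true]
  ring

theorem vecCons_eta (I : Fin (r + 1) → TIdx n) : Matrix.vecCons (I 0) (Fin.tail I) = I :=
  Fin.cons_self_tail I

variable {φ} {x : M} [T2Space M]

theorem Sm.sharp {T : M → TIdx n → TIdx n → ℝ} {V : (Fin r → TIdx n) → M → ℝ}
    (hT : ∀ H G, Sm n (fun y => T y H G) x) (hV : ∀ J, Sm n (V J) x) (I : Fin r → TIdx n) :
    Sm n (fun y => sharp (T y) (fun J => V J y) I) x :=
  (Sm.sum fun _ _ => Sm.sum fun _ _ => (hT _ _).mul (hV _)).neg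

theorem pd_sharp (hφ : φ ∈ atlas (Model n) M) (hx : x ∈ φ.source)
    {T : M → TIdx n → TIdx n → ℝ} {V : (Fin r → TIdx n) → M → ℝ}
    (hT : ∀ H G, Sm n (fun y => T y H G) x) (hV : ∀ J, Sm n (V J) x) (a : Fin n)
    (I : Fin r → TIdx n) : pd φ a (fun y => ProjTractor.sharp (T y) (fun J => V J y) I) x =
      ProjTractor.sharp (fun H G => pd φ a (fun y => T y H G) x) (fun J => V J x) I +
      ProjTractor.sharp (T x) (fun J => pd φ a (V J) x) I := by
  have h1 : ∀ i, Sm n (fun y => ∑ H, T y H (I i) * V (Function.update I i H) y) x := fun i =>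
    Sm.sum fun H _ => (hT _ _).mul (hV _)
  unfold ProjTractor.sharp
  rw [pd_neg hφ hx (Sm.sum fun i _ => h1 i), pd_sum hφ hx fun i _ => h1 i, ← neg_add,
    ← Finset.sum_add_distrib]
  congr 1
  refine Finset.sum_congr rfl fun i _ => ?_
  rw [pd_sum hφ hx fun H _ => (hT _ _).mul (hV _), ← Finset.sum_add_distrib]
  exact Finset.sum_congr rfl fun H _ => pd_mul hφ hx (hT _ _) (hV _) a

theorem Sm.thomasD (hn : 2 ≤ n) (hφ : φ ∈ atlas (Model n) M) (hx : x ∈ φ.source) (w : ℝ)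
    {V : (Fin r → TIdx n) → M → ℝ} (hV : ∀ J, Sm n (V J) x) (I : Fin (r + 1) → TIdx n) :
    Sm n (thomasD nab φ w V I) x := by
  rw [← vecCons_eta I]
  cases I 0 with
  | none =>
    refine Sm.congr ((Sm.const w).mul (hV (Fin.tail I))) (Eventually.of_forall fun y => ?_)
    exact (thomasD_none nab φ w V _ y).symm
  | some a =>
    refine Sm.congr (((hV (Fin.tail I)).pd hφ hx a).add
      (Sm.sharp (T := fun y H G => ProjTractor.tgam nab φ a G H y)
      (fun H G => Sm.tgam nab hn hφ hx a G H) hV (Fin.tail I))) (Eventually.of_forall fun y => ?_)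
    exact (thomasD_some nab φ w V a _ y).symm

theorem thomasD_congr (hx : x ∈ φ.source) (w : ℝ) {V V' : (Fin r → TIdx n) → M → ℝ}
    (h : ∀ y ∈ φ.source, ∀ J, V J y = V' J y) (I : Fin (r + 1) → TIdx n) :
    ProjTractor.thomasD nab φ w V I x = ProjTractor.thomasD nab φ w V' I x := by
  rw [← vecCons_eta I]
  have h' : (fun J => V J x) = fun J => V' J x := funext (h x hx)
  cases I 0 with
  | none => rw [thomasD_none, thomasD_none, h x hx]
  | some a =>
    rw [thomasD_some, thomasD_some, h',
      pd_congr hx (eventually_source hx fun y hy => h y hy (Fin.tail I)) a]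

theorem thomasD_add (hφ : φ ∈ atlas (Model n) M) (hx : x ∈ φ.source) (w : ℝ)
    {V V' : (Fin r → TIdx n) → M → ℝ} (hV : ∀ J, Sm n (V J) x) (hV' : ∀ J, Sm n (V' J) x)
    (I : Fin (r + 1) → TIdx n) : ProjTractor.thomasD nab φ w (fun J y => V J y + V' J y) I x =
      ProjTractor.thomasD nab φ w V I x + ProjTractor.thomasD nab φ w V' I x := by
  rw [← vecCons_eta I]
  cases I 0 with
  | none => simp only [thomasD_none]; ring
  | some a =>
    simp only [thomasD_some, pd_add hφ hx (hV _) (hV' _), sharp_add_right]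
    ring

theorem thomasD_smul (hφ : φ ∈ atlas (Model n) M) (hx : x ∈ φ.source) (w c : ℝ)
    {V : (Fin r → TIdx n) → M → ℝ} (hV : ∀ J, Sm n (V J) x)
    (I : Fin (r + 1) → TIdx n) : ProjTractor.thomasD nab φ w (fun J y => c * V J y) I x =
      c * ProjTractor.thomasD nab φ w V I x := by
  rw [← vecCons_eta I]
  cases I 0 with
  | none => simp only [thomasD_none]; ring
  | some a =>
    simp only [thomasD_some, pd_const_mul hφ hx c (hV _), sharp_smul_right]
    ring

theorem thomasD_perm (w : ℝ) (V : (Fin r → TIdx n) → M → ℝ) (σ : Equiv.Perm (Fin r))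
    (A : TIdx n) (I : Fin r → TIdx n) (x : M) :
    ProjTractor.thomasD nab φ w (fun J => V (J ∘ σ)) (Matrix.vecCons A I) x =
      ProjTractor.thomasD nab φ w V (Matrix.vecCons A (I ∘ σ)) x := by
  cases A with
  | none => simp only [thomasD_none]
  | some a =>
    simp only [thomasD_some]
    rw [sharp_perm _ (fun J => V J x)]

theorem thomasD_symAt (hφ : φ ∈ atlas (Model n) M) (hx : x ∈ φ.source) (w : ℝ) (i j : Fin 4)
    {V : (Fin 4 → TIdx n) → M → ℝ} (hV : ∀ J, Sm n (V J) x) (A : TIdx n) (I : Fin 4 → TIdx n) :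
    ProjTractor.thomasD nab φ w (fun J y => symAt i j (fun J => V J y) J) (Matrix.vecCons A I) x =
      symAt i j (fun J => ProjTractor.thomasD nab φ w V (Matrix.vecCons A J) x) I := by
  have e : (fun J y => symAt i j (fun J => V J y) J) =
      fun (J : Fin 4 → TIdx n) y => 2⁻¹ * (V J y + V (J ∘ Equiv.swap i j) y) := by
    funext J y
    simp only [symAt]
    ring
  rw [e, thomasD_smul nab hφ hx w _ fun J => (hV J).add (hV _),
    thomasD_add nab hφ hx w hV fun J => hV _, thomasD_perm]
  simp only [symAt]
  ring

theorem thomasD_skewAt (hφ : φ ∈ atlas (Model n) M) (hx : x ∈ φ.source) (w : ℝ) (i j : Fin 4)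
    {V : (Fin 4 → TIdx n) → M → ℝ} (hV : ∀ J, Sm n (V J) x) (A : TIdx n) (I : Fin 4 → TIdx n) :
    ProjTractor.thomasD nab φ w (fun J y => skewAt i j (fun J => V J y) J) (Matrix.vecCons A I) x =
      skewAt i j (fun J => ProjTractor.thomasD nab φ w V (Matrix.vecCons A J) x) I := by
  have e : (fun J y => skewAt i j (fun J => V J y) J) =
      fun (J : Fin 4 → TIdx n) y => 2⁻¹ * (V J y + (-1) * V (J ∘ Equiv.swap i j) y) := by
    funext J y
    simp only [skewAt]
    ring
  rw [e, thomasD_smul nab hφ hx w _ fun J => (hV J).add ((Sm.const _).mul (hV _)),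
    thomasD_add nab hφ hx w hV fun J => (Sm.const _).mul (hV _),
    thomasD_smul nab hφ hx w _ fun J => hV _, thomasD_perm]
  simp only [skewAt]
  ring

theorem Sm.symAt (i j : Fin 4) {V : (Fin 4 → TIdx n) → M → ℝ} (hV : ∀ J, Sm n (V J) x)
    (I : Fin 4 → TIdx n) : Sm n (fun y => symAt i j (fun J => V J y) I) x :=
  ((hV _).add (hV _)).mul (Sm.const 2⁻¹)

theorem Sm.skewAt (i j : Fin 4) {V : (Fin 4 → TIdx n) → M → ℝ} (hV : ∀ J, Sm n (V J) x)
    (I : Fin 4 → TIdx n) : Sm n (fun y => skewAt i j (fun J => V J y) I) x :=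
  ((hV _).sub (hV _)).mul (Sm.const 2⁻¹)

theorem Sm.youngP {V : (Fin 4 → TIdx n) → M → ℝ} (hV : ∀ J, Sm n (V J) x)
    (I : Fin 4 → TIdx n) : Sm n (fun y => youngP (fun J => V J y) I) x :=
  Sm.symAt _ _ (Sm.symAt _ _ (Sm.skewAt _ _ (Sm.skewAt _ _ hV))) I

theorem thomasD_youngP (hφ : φ ∈ atlas (Model n) M) (hx : x ∈ φ.source) (w : ℝ)
    {V : (Fin 4 → TIdx n) → M → ℝ} (hV : ∀ J, Sm n (V J) x) (A : TIdx n) (I : Fin 4 → TIdx n) :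
    ProjTractor.thomasD nab φ w (fun J y => ProjTractor.youngP (fun J => V J y) J)
      (Matrix.vecCons A I) x =
      ProjTractor.youngP (fun J => ProjTractor.thomasD nab φ w V (Matrix.vecCons A J) x) I := by
  have h1 := Sm.skewAt (x := x) 1 3 hV
  have h2 := Sm.skewAt (x := x) 0 2 h1
  have h3 := Sm.symAt (x := x) 2 3 h2
  unfold ProjTractor.youngP
  rw [thomasD_symAt nab hφ hx w 0 1 h3]
  congr 1
  funext J
  rw [thomasD_symAt nab hφ hx w 2 3 h2]
  congr 1
  funext J
  rw [thomasD_skewAt nab hφ hx w 0 2 h1]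
  congr 1
  funext J
  rw [thomasD_skewAt nab hφ hx w 1 3 hV]

end thomasOperator

/-! ### Curvature in terms of the Thomas operator -/

section ambientCurvature

variable {n r : ℕ} {M : Type*} [TopologicalSpace M] [ChartedSpace (Model n) M]
  [IsManifold (𝓡 n) ∞ M] (nab : AffineConnection n M) (φ : OpenPartialHomeomorph M (Model n))

/-- The curvature `W_{AB}^H_G = Z_A^a Z_B^b κ_{ab}^H_G` of the Thomas operator. -/
def ambW (A B H G : TIdx n) (x : M) : ℝ :=
  match A, B with
  | some a, some b => kap nab φ a b H G x
  | _, _ => 0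

/-- The derivative `𝔻_A W_{BC}^H_G`, where `W` has weight `-2`. -/
def ambDW (A B C H G : TIdx n) (x : M) : ℝ :=
  match A with
  | none => -2 * ambW nab φ B C H G x
  | some a => pd φ a (ambW nab φ B C H G) x
    - ∑ F, tgam nab φ a B F x * ambW nab φ F C H G x
    - ∑ F, tgam nab φ a C F x * ambW nab φ B F H G x
    + ∑ E, (tgam nab φ a E H x * ambW nab φ B C E G x - tgam nab φ a G E x * ambW nab φ B C H E x)

theorem ambW_none_left (B H G : TIdx n) (x : M) : ambW nab φ none B H G x = 0 := rfl

theorem ambW_none_right (A H G : TIdx n) (x : M) : ambW nab φ A none H G x = 0 := by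
  cases A <;> rfl

theorem ambW_some (a b : Fin n) (H G : TIdx n) (x : M) :
    ambW nab φ (some a) (some b) H G x = kap nab φ a b H G x := rfl

theorem kap_anti (a b : Fin n) (H G : TIdx n) (x : M) :
    kap nab φ a b H G x = - kap nab φ b a H G x := by
  simp only [kap, Finset.sum_sub_distrib]
  ring

theorem ambW_anti (A B H G : TIdx n) (x : M) :
    ambW nab φ A B H G x = - ambW nab φ B A H G x := by
  cases A <;> cases B <;> simp only [ambW, neg_zero]
  exact kap_anti nab φ _ _ _ _ x

variable {φ} {x : M} [T2Space M]

theorem Sm.kap (hn : 2 ≤ n) (hφ : φ ∈ atlas (Model n) M) (hx : x ∈ φ.source) (a b : Fin n)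
    (H G : TIdx n) : Sm n (kap nab φ a b H G) x :=
  (((Sm.tgam nab hn hφ hx b G H).pd hφ hx a).sub ((Sm.tgam nab hn hφ hx a G H).pd hφ hx b)).add
    (Sm.sum fun E _ => ((Sm.tgam nab hn hφ hx a E H).mul (Sm.tgam nab hn hφ hx b G E)).sub
      ((Sm.tgam nab hn hφ hx b E H).mul (Sm.tgam nab hn hφ hx a G E)))

theorem Sm.ambW (hn : 2 ≤ n) (hφ : φ ∈ atlas (Model n) M) (hx : x ∈ φ.source)
    (A B H G : TIdx n) : Sm n (ambW nab φ A B H G) x := by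
  cases A with
  | none => exact Sm.const 0
  | some a => cases B with
    | none => exact Sm.const 0
    | some b => exact Sm.kap nab hn hφ hx a b H G

/-- The curvature annihilates the canonical tractor. -/
theorem kap_none_right (hn : 2 ≤ n) (hφ : φ ∈ atlas (Model n) M) (hx : x ∈ φ.source)
    (a b : Fin n) (H : TIdx n) : ProjTractor.kap nab φ a b H none x = 0 := by
  have h : ∀ a b : Fin n, ProjTractor.pd φ a (ProjTractor.tgam nab φ b none H) x = 0 := by
    intro a b
    cases H with
    | none =>
      rw [← pd_const φ a 0 x]
      exact pd_congr hx (Eventually.of_forall fun y => tgam_none_none nab φ b y) a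
    | some c =>
      rw [← pd_const φ a (if b = c then 1 else 0) x]
      exact pd_congr hx (Eventually.of_forall fun y => tgam_none_some nab φ b c y) a
  simp only [ProjTractor.kap, h, Fintype.sum_option, tgam_none_none, tgam_none_some]
  simp [tgam_some_symm nab hn hφ hx a b H]

theorem ambW_none_last (hn : 2 ≤ n) (hφ : φ ∈ atlas (Model n) M) (hx : x ∈ φ.source)
    (A B H : TIdx n) : ProjTractor.ambW nab φ A B H none x = 0 := by
  cases A with
  | none => rfl
  | some a => cases B with
    | none => rfl
    | some b => exact kap_none_right nab hn hφ hx a b H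

/-- The first Bianchi identity. -/
theorem ambW_bianchi (hn : 2 ≤ n) (hφ : φ ∈ atlas (Model n) M) (hx : x ∈ φ.source)
    (A B C H : TIdx n) : ProjTractor.ambW nab φ A B H C x + ProjTractor.ambW nab φ B C H A x +
      ProjTractor.ambW nab φ C A H B x = 0 := by
  rcases A with _ | a
  · rw [ambW_none_last nab hn hφ hx, ambW_none_left, ambW_none_right]; ring
  rcases B with _ | b
  · rw [ambW_none_last nab hn hφ hx, ambW_none_left, ambW_none_right]; ring
  rcases C with _ | c
  · rw [ambW_none_last nab hn hφ hx, ambW_none_left, ambW_none_right]; ring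
  have hs := tgam_some_symm nab hn hφ hx
  have hp : ∀ a b c, ProjTractor.pd φ a (ProjTractor.tgam nab φ b (some c) H) x =
      ProjTractor.pd φ a (ProjTractor.tgam nab φ c (some b) H) x := fun a b c =>
    pd_congr hx (eventually_source hx fun y hy => tgam_some_symm nab hn hφ hy b c H) a
  simp only [ambW_some, ProjTractor.kap, Finset.sum_sub_distrib]
  rw [hp a b c, hp b a c, hp c a b]
  simp only [hs b a, hs c a, hs c b]
  ring

/-- The commutator of Thomas operators is the action of the curvature. -/
theorem thomasD_comm (hn : 2 ≤ n) (hφ : φ ∈ atlas (Model n) M) (hx : x ∈ φ.source)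
    {w w' : ℝ} (hw : w' = w - 1)
    {V : (Fin r → TIdx n) → M → ℝ} (hV : ∀ J, Sm n (V J) x)
    (A B : TIdx n) (I : Fin r → TIdx n) :
    thomasD nab φ w' (thomasD nab φ w V) (Matrix.vecCons A (Matrix.vecCons B I)) x -
      thomasD nab φ w' (thomasD nab φ w V) (Matrix.vecCons B (Matrix.vecCons A I)) x =
      sharp (fun H G => ambW nab φ A B H G x) (fun J => V J x) I := by
  subst hw
  have hVx := hV
  -- the mixed components, in which the two weights differ by one
  have hmix : ∀ b : Fin n,
      thomasD nab φ (w - 1) (thomasD nab φ w V) (Matrix.vecCons none (Matrix.vecCons (some b) I)) x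
      = thomasD nab φ (w - 1) (thomasD nab φ w V)
        (Matrix.vecCons (some b) (Matrix.vecCons none I)) x := by
    intro b
    have e : thomasD nab φ w V (Matrix.vecCons none I) = fun y => w * V I y :=
      funext fun y => thomasD_none nab φ w V I y
    rw [thomasD_none, thomasD_some nab φ (w - 1), sharp_cons, e, pd_const_mul hφ hx w (hVx I)]
    simp only [thomasD_none, sharp_smul_right, Fintype.sum_option, tgam_none_none, tgam_none_some]
    simp only [ite_mul, one_mul, zero_mul, Finset.sum_ite_eq, Finset.mem_univ, if_true]
    rw [thomasD_some]
    ring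
  rcases A with _ | a
  · rcases B with _ | b
    · simp [ambW_none_left, sharp_zero_left]
    · simp [hmix b, ambW_none_left, sharp_zero_left]
  rcases B with _ | b
  · simp [hmix a, ambW_none_right, sharp_zero_left]
  have key : ∀ a b : Fin n, thomasD nab φ (w - 1) (thomasD nab φ w V)
      (Matrix.vecCons (some a) (Matrix.vecCons (some b) I)) x =
      pd φ a (pd φ b (V I)) x + sharp (fun H G => pd φ a (tgam nab φ b G H) x) (fun J => V J x) I +
      sharp (fun H G => tgam nab φ b G H x) (fun J => pd φ a (V J) x) I -
      ∑ H, tgam nab φ a (some b) H x * thomasD nab φ w V (Matrix.vecCons H I) x +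
      sharp (fun H G => tgam nab φ a G H x) (fun J => pd φ b (V J) x) I +
      sharp (fun H G => tgam nab φ a G H x) (sharp (fun H G => tgam nab φ b G H x)
        (fun J => V J x)) I := by
    intro a b
    have e : thomasD nab φ w V (Matrix.vecCons (some b) I) = fun y => pd φ b (V I) y +
        sharp (fun H G => tgam nab φ b G H y) (fun J => V J y) I :=
      funext fun y => thomasD_some nab φ w V b I y
    have hT : ∀ H G, Sm n (fun y => tgam nab φ b G H y) x := fun H G => Sm.tgam nab hn hφ hx b G H
    rw [thomasD_some, sharp_cons, e,
      pd_add hφ hx ((hVx I).pd hφ hx b) (Sm.sharp (T := fun y H G => tgam nab φ b G H y) hT hVx I),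
      pd_sharp hφ hx (T := fun y H G => tgam nab φ b G H y) hT hVx]
    simp only [thomasD_some]
    rw [sharp_add_right]
    ring
  have hs : ∀ H, tgam nab φ b (some a) H x = tgam nab φ a (some b) H x := fun H =>
    tgam_some_symm nab hn hφ hx b a H
  rw [key a b, key b a, pd_comm hφ hx (hVx I) b a]
  simp only [hs]
  have hc := sharp_comm (fun H G => tgam nab φ a G H x) (fun H G => tgam nab φ b G H x)
    (fun J => V J x) I
  have hk : sharp (fun H G => ambW nab φ (some a) (some b) H G x) (fun J => V J x) I =
      sharp (fun H G => pd φ a (tgam nab φ b G H) x) (fun J => V J x) I -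
      sharp (fun H G => pd φ b (tgam nab φ a G H) x) (fun J => V J x) I +
      sharp (fun K G => ∑ H, (tgam nab φ a H K x * tgam nab φ b G H x -
        tgam nab φ b H K x * tgam nab φ a G H x)) (fun J => V J x) I := by
    rw [← sharp_sub_left, ← sharp_add_left]
    rfl
  rw [hk, ← hc]
  ring

/-- The Leibniz rule for the Thomas operator applied to `W_{BC}♯V`. -/
theorem thomasD_ambW_sharp (hn : 2 ≤ n) (hφ : φ ∈ atlas (Model n) M) (hx : x ∈ φ.source)
    {w w' : ℝ} (hw : w' = w - 2)
    {V : (Fin r → TIdx n) → M → ℝ} (hV : ∀ J, Sm n (V J) x)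
    (A B C : TIdx n) (I : Fin r → TIdx n) :
    thomasD nab φ w' (fun J y => sharp (fun H G => ambW nab φ (J 0) (J 1) H G y)
      (fun J => V J y) (Fin.tail (Fin.tail J)))
      (Matrix.vecCons A (Matrix.vecCons B (Matrix.vecCons C I))) x =
      sharp (fun H G => ambDW nab φ A B C H G x) (fun J => V J x) I +
      sharp (fun H G => ambW nab φ B C H G x)
        (fun J => thomasD nab φ w V (Matrix.vecCons A J) x) I := by
  subst hw
  have e0 : ∀ (B C : TIdx n) (J : Fin r → TIdx n),
      Fin.tail (Fin.tail (Matrix.vecCons B (Matrix.vecCons C J))) = J := fun _ _ _ => rfl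
  rcases A with _ | a
  · simp only [thomasD_none, e0, sharp_smul_right, ambDW, sharp_smul_left, Matrix.cons_val_zero,
      Matrix.cons_val_one]
    ring
  have hW : ∀ B C H G, Sm n (fun y => ambW nab φ B C H G y) x := Sm.ambW nab hn hφ hx
  rw [thomasD_some, sharp_cons, sharp_cons]
  simp only [e0, Matrix.cons_val_zero, Matrix.cons_val_one]
  rw [pd_sharp hφ hx (T := fun y H G => ambW nab φ B C H G y) (hW B C) hV]
  simp only [thomasD_some]
  rw [sharp_add_right]
  have hc := sharp_comm (fun H G => tgam nab φ a G H x) (fun H G => ambW nab φ B C H G x)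
    (fun J => V J x) I
  have e1 : ∀ T : TIdx n → TIdx n → ℝ, (fun J => sharp T (fun J => V J x) J) =
    sharp T (fun J => V J x) := fun _ => rfl
  have hd : sharp (fun H G => ambDW nab φ (some a) B C H G x) (fun J => V J x) I =
      sharp (fun H G => pd φ a (fun y => ambW nab φ B C H G y) x) (fun J => V J x) I -
      ∑ F, tgam nab φ a B F x * sharp (fun H G => ambW nab φ F C H G x) (fun J => V J x) I -
      ∑ F, tgam nab φ a C F x * sharp (fun H G => ambW nab φ B F H G x) (fun J => V J x) I +
      sharp (fun K G => ∑ H, (tgam nab φ a H K x * ambW nab φ B C H G x -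
        ambW nab φ B C K H x * tgam nab φ a G H x)) (fun J => V J x) I := by
    simp only [← sharp_smul_left]
    rw [← sharp_sum_left, ← sharp_sum_left, ← sharp_sub_left, ← sharp_sub_left, ← sharp_add_left]
    simp only [ambDW, mul_comm (tgam nab φ a _ _ x) (ambW nab φ B C _ _ x)]
  rw [hd, ← hc]
  simp only [e1]
  ring

theorem vecCons_comp_swap (B C : TIdx n) (I : Fin r → TIdx n) :
    Matrix.vecCons B (Matrix.vecCons C I) ∘ Equiv.swap 0 1 =
      Matrix.vecCons C (Matrix.vecCons B I) := by
  funext i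
  refine Fin.cases ?_ (fun i => Fin.cases ?_ (fun i => ?_) i) i
  · rw [Function.comp_apply, Equiv.swap_apply_left]; rfl
  · have : (Fin.succ 0 : Fin (r + 2)) = 1 := rfl
    rw [Function.comp_apply, this, Equiv.swap_apply_right]; rfl
  · rw [Function.comp_apply, Equiv.swap_apply_of_ne_of_ne (by exact Fin.succ_ne_zero _)
      (by simp [Fin.ext_iff])]; rfl

/-- The commutator of the two Thomas operators applied first, differentiated once more. -/
theorem thomasD_comm_inner (hn : 2 ≤ n) (hφ : φ ∈ atlas (Model n) M) (hx : x ∈ φ.source)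
    {w w' w'' : ℝ} (hw : w' = w - 1) (hw' : w'' = w - 2)
    {V : (Fin r → TIdx n) → M → ℝ} (hV : ∀ y ∈ φ.source, ∀ J, Sm n (V J) y)
    (A B C : TIdx n) (I : Fin r → TIdx n) :
    thomasD nab φ w'' (thomasD nab φ w' (thomasD nab φ w V))
        (Matrix.vecCons A (Matrix.vecCons B (Matrix.vecCons C I))) x -
      thomasD nab φ w'' (thomasD nab φ w' (thomasD nab φ w V))
        (Matrix.vecCons A (Matrix.vecCons C (Matrix.vecCons B I))) x =
      sharp (fun H G => ambDW nab φ A B C H G x) (fun J => V J x) I +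
      sharp (fun H G => ambW nab φ B C H G x)
        (fun J => thomasD nab φ w V (Matrix.vecCons A J) x) I := by
  set U := thomasD nab φ w' (thomasD nab φ w V) with hU
  have hUs : ∀ J, Sm n (U J) x := fun J =>
    Sm.thomasD nab hn hφ hx w' (fun J => Sm.thomasD nab hn hφ hx w (hV x hx) J) J
  rw [← thomasD_ambW_sharp nab hn hφ hx hw' (hV x hx)]
  have h1 : thomasD nab φ w'' (fun J y => U J y + (-1) * U (J ∘ Equiv.swap 0 1) y)
      (Matrix.vecCons A (Matrix.vecCons B (Matrix.vecCons C I))) x =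
      thomasD nab φ w'' U (Matrix.vecCons A (Matrix.vecCons B (Matrix.vecCons C I))) x -
      thomasD nab φ w'' U (Matrix.vecCons A (Matrix.vecCons C (Matrix.vecCons B I))) x := by
    rw [thomasD_add nab hφ hx w'' hUs fun J => (Sm.const _).mul (hUs _),
      thomasD_smul nab hφ hx w'' _ fun J => hUs _, thomasD_perm, vecCons_comp_swap]
    ring
  rw [← h1]
  refine thomasD_congr nab hx w'' (fun y hy J => ?_) _
  obtain ⟨J0, J1, K, rfl⟩ : ∃ J0 J1 K, J = Matrix.vecCons J0 (Matrix.vecCons J1 K) :=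
    ⟨J 0, J 1, Fin.tail (Fin.tail J), by
      rw [← vecCons_eta J]; congr 1; exact (vecCons_eta (Fin.tail J)).symm⟩
  rw [vecCons_comp_swap]
  refine Eq.trans ?_ (thomasD_comm nab hn hφ hy hw (hV y hy) J0 J1 K)
  rw [hU]
  ring

/-- The second Bianchi identity, a consequence of the Jacobi identity for Thomas operators. -/
theorem ambDW_bianchi (hn : 2 ≤ n) (hφ : φ ∈ atlas (Model n) M) (hx : x ∈ φ.source)
    (A B C H G : TIdx n) : ambDW nab φ A B C H G x + ambDW nab φ B C A H G x +
      ambDW nab φ C A B H G x = 0 := by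
  let V : (Fin 1 → TIdx n) → M → ℝ := fun J _ => if J 0 = H then 1 else 0
  have hV : ∀ y ∈ φ.source, ∀ J, Sm n (V J) y := fun y _ J => Sm.const _
  have hDV : ∀ J, Sm n (thomasD nab φ 0 V J) x := fun J =>
    Sm.thomasD nab hn hφ hx 0 (hV x hx) J
  have h1 := fun A B C : TIdx n => thomasD_comm_inner nab hn hφ hx (w := 0) (w' := -1) (w'' := -2)
    (by norm_num) (by norm_num) hV A B C ![G]
  have h2 := fun A B C : TIdx n => thomasD_comm nab hn hφ hx (w := -1) (w' := -2)
    (by norm_num) hDV A B (Matrix.vecCons C ![G])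
  have h3 : ∀ A B C, sharp (fun H G => ambDW nab φ A B C H G x) (fun J => V J x) ![G] =
      - ambDW nab φ A B C H G x := by
    intro A B C
    rw [sharp_cons, sharp_nil]
    simp [V]
  simp only [sharp_cons _ (fun J => thomasD nab φ 0 V J x)] at h2
  have h4 : ∀ K : TIdx n, ambW nab φ A B K C x * thomasD nab φ 0 V (Matrix.vecCons K ![G]) x +
      ambW nab φ B C K A x * thomasD nab φ 0 V (Matrix.vecCons K ![G]) x +
      ambW nab φ C A K B x * thomasD nab φ 0 V (Matrix.vecCons K ![G]) x = 0 := by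
    intro K
    rw [← add_mul, ← add_mul, ambW_bianchi nab hn hφ hx, zero_mul]
  have h5 := Finset.sum_congr (rfl : (Finset.univ : Finset (TIdx n)) = Finset.univ)
    fun K _ => h4 K
  simp only [Finset.sum_add_distrib, Finset.sum_const_zero] at h5
  have a1 := h1 A B C
  have a2 := h1 B C A
  have a3 := h1 C A B
  have b1 := h2 A B C
  have b2 := h2 B C A
  have b3 := h2 C A B
  rw [h3] at a1 a2 a3
  linarith

end ambientCurvature

/-! ### Change of charts -/

section chartChange

variable {n r : ℕ} {M : Type*} [TopologicalSpace M] [ChartedSpace (Model n) M]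
  [IsManifold (𝓡 n) ∞ M] [T2Space M] (nab : AffineConnection n M)
  {φ ψ : OpenPartialHomeomorph M (Model n)} {x : M}

theorem Gam_change' (hφ : φ ∈ atlas (Model n) M) (hψ : ψ ∈ atlas (Model n) M)
    (hx : x ∈ φ.source) (hx' : x ∈ ψ.source) (a b c : Fin n) :
    Gam nab φ a b c x = ∑ g, jac ψ φ x c g * (pd φ a (fun z => jac φ ψ z g b) x +
      ∑ f, ∑ h, jac φ ψ x f a * jac φ ψ x h b * Gam nab ψ f h g x) := by
  simp only [← Gam_change nab hφ hψ hx hx', Finset.mul_sum]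
  rw [Finset.sum_comm]
  have h := fun c' => congrFun (congrFun (jac_mul_jac hφ hψ hx hx') c) c'
  simp only [Matrix.mul_apply, Matrix.one_apply] at h
  have : ∀ c', ∑ g, jac ψ φ x c g * (Gam nab φ a b c' x * jac φ ψ x g c') =
      Gam nab φ a b c' x * if c = c' then 1 else 0 := by
    intro c'
    rw [← h, Finset.mul_sum]
    exact Finset.sum_congr rfl fun g _ => by ring
  simp [this]

theorem gam_change (hφ : φ ∈ atlas (Model n) M) (hψ : ψ ∈ atlas (Model n) M)
    (hx : x ∈ φ.source) (hx' : x ∈ ψ.source) (a : Fin n) :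
    dens 1 φ ψ x * gam nab φ a x =
      dens 1 φ ψ x * ∑ f, jac φ ψ x f a * gam nab ψ f x - pd φ a (dens 1 φ ψ) x := by
  have hn : (n : ℝ) + 1 ≠ 0 := by positivity
  have h := fun e g => congrFun (congrFun (jac_mul_jac hψ hφ hx' hx) e) g
  simp only [Matrix.mul_apply, Matrix.one_apply] at h
  have h1 : ∑ b, Gam nab φ a b b x =
      ∑ b, ∑ g, jac ψ φ x b g * pd φ a (fun z => jac φ ψ z g b) x +
      ((n : ℝ) + 1) * ∑ f, jac φ ψ x f a * gam nab ψ f x := by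
    simp only [Gam_change' nab hφ hψ hx hx', mul_add, Finset.sum_add_distrib]
    congr 1
    have : ∀ f, ((n : ℝ) + 1) * (jac φ ψ x f a * gam nab ψ f x) =
        ∑ g, ∑ e, (∑ b, jac φ ψ x e b * jac ψ φ x b g) * (jac φ ψ x f a * Gam nab ψ f e g x) := by
      intro f
      simp only [h, ite_mul, one_mul, zero_mul]
      simp only [Finset.sum_ite_eq', Finset.mem_univ, if_true]
      rw [← Finset.mul_sum, sum_Gam]
      ring
    rw [Finset.mul_sum]
    simp only [this, Finset.mul_sum, Finset.sum_mul]
    rw [Finset.sum_comm]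
    conv_rhs => rw [Finset.sum_comm]
    refine Finset.sum_congr rfl fun g _ => ?_
    rw [Finset.sum_comm]
    refine Finset.sum_congr rfl fun f _ => ?_
    rw [Finset.sum_comm]
    exact Finset.sum_congr rfl fun e _ => Finset.sum_congr rfl fun b _ => by ring
  rw [pd_dens hφ hψ hx hx', gam, h1]
  field_simp
  ring

/-- The derivative of a matrix of functions. -/
def pdM (φ : OpenPartialHomeomorph M (Model n)) (a : Fin n)
    (A : M → Matrix (TIdx n) (TIdx n) ℝ) (x : M) : Matrix (TIdx n) (TIdx n) ℝ :=
  Matrix.of fun i j => pd φ a (fun y => A y i j) x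

/-- Smoothness of a matrix of functions. -/
def SmM (A : M → Matrix (TIdx n) (TIdx n) ℝ) (x : M) : Prop := ∀ i j, Sm n (fun y => A y i j) x

variable {A B : M → Matrix (TIdx n) (TIdx n) ℝ}

theorem SmM.mul (hA : SmM A x) (hB : SmM B x) : SmM (fun y => A y * B y) x := fun i j => by
  simp only [Matrix.mul_apply]
  exact Sm.sum fun k _ => (hA i k).mul (hB k j)

theorem pdM_mul (hφ : φ ∈ atlas (Model n) M) (hx : x ∈ φ.source) (hA : SmM A x) (hB : SmM B x)
    (a : Fin n) : pdM φ a (fun y => A y * B y) x = pdM φ a A x * B x + A x * pdM φ a B x := by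
  ext i j
  simp only [pdM, Matrix.of_apply, Matrix.mul_apply, Matrix.add_apply]
  rw [pd_sum hφ hx fun k _ => (hA i k).mul (hB k j), ← Finset.sum_add_distrib]
  exact Finset.sum_congr rfl fun k _ => pd_mul hφ hx (hA i k) (hB k j) a

theorem pdM_sub (hφ : φ ∈ atlas (Model n) M) (hx : x ∈ φ.source) (hA : SmM A x) (hB : SmM B x)
    (a : Fin n) : pdM φ a (fun y => A y - B y) x = pdM φ a A x - pdM φ a B x := by
  ext i j
  exact pd_sub hφ hx (hA i j) (hB i j) a

theorem pdM_congr (hx : x ∈ φ.source) (h : A =ᶠ[𝓝 x] B) (a : Fin n) :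
    pdM φ a A x = pdM φ a B x := by
  ext i j
  exact pd_congr hx (h.mono fun y hy => by simp only [hy]) a

theorem pdM_comm (hφ : φ ∈ atlas (Model n) M) (hx : x ∈ φ.source) (hA : SmM A x) (a b : Fin n) :
    pdM φ a (pdM φ b A) x = pdM φ b (pdM φ a A) x := by
  ext i j
  exact pd_comm hφ hx (hA i j) a b

/-- Gauge covariance of the curvature: if `∂_a T = G_a T - T H_a`, then `T` intertwines the
curvatures of `G` and of `H`. -/
theorem gauge_curvature (hφ : φ ∈ atlas (Model n) M) (hx : x ∈ φ.source)
    {T : M → Matrix (TIdx n) (TIdx n) ℝ} {G H : Fin n → M → Matrix (TIdx n) (TIdx n) ℝ}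
    (hT : SmM T x) (hG : ∀ a, SmM (G a) x) (hH : ∀ a, SmM (H a) x)
    (h : ∀ a, ∀ᶠ y in 𝓝 x, pdM φ a T y = G a y * T y - T y * H a y) (a b : Fin n) :
    (pdM φ a (G b) x - pdM φ b (G a) x + G b x * G a x - G a x * G b x) * T x =
      T x * (pdM φ a (H b) x - pdM φ b (H a) x + H b x * H a x - H a x * H b x) := by
  have key : ∀ a b, pdM φ b (pdM φ a T) x = pdM φ b (G a) x * T x +
      G a x * (G b x * T x - T x * H b x) - (G b x * T x - T x * H b x) * H a x -
      T x * pdM φ b (H a) x := by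
    intro a b
    rw [pdM_congr hx (h a) b, pdM_sub hφ hx ((hG a).mul hT) (hT.mul (hH a)),
      pdM_mul hφ hx (hG a) hT, pdM_mul hφ hx hT (hH a), (h b).self_of_nhds]
    abel
  have h1 := key a b
  rw [pdM_comm hφ hx hT, key b a] at h1
  rw [← sub_eq_zero] at h1 ⊢
  rw [← h1]
  noncomm_ring

/-- The connection coefficients of the tractor connection as a matrix. -/
def tgamM (φ : OpenPartialHomeomorph M (Model n)) (a : Fin n) (y : M) :
    Matrix (TIdx n) (TIdx n) ℝ := Matrix.of fun A B => tgam nab φ a A B y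

/-- The connection coefficients in the chart `ψ`, with the form index transformed to `φ`. -/
def pullTgamM (φ ψ : OpenPartialHomeomorph M (Model n)) (a : Fin n) (y : M) :
    Matrix (TIdx n) (TIdx n) ℝ := ∑ d, jac φ ψ y d a • tgamM nab ψ d y

/-- The curvature of the tractor connection as a matrix. -/
def kapM (φ : OpenPartialHomeomorph M (Model n)) (a b : Fin n) (y : M) :
    Matrix (TIdx n) (TIdx n) ℝ := Matrix.of fun D C => kap nab φ a b C D y

theorem kapM_eq (φ : OpenPartialHomeomorph M (Model n)) (a b : Fin n) (y : M) :
    kapM nab φ a b y = pdM φ a (tgamM nab φ b) y - pdM φ b (tgamM nab φ a) y +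
      tgamM nab φ b y * tgamM nab φ a y - tgamM nab φ a y * tgamM nab φ b y := by
  ext D C
  simp only [kapM, kap, pdM, tgamM, Matrix.of_apply, Matrix.sub_apply, Matrix.add_apply,
    Matrix.mul_apply, Finset.sum_sub_distrib]
  have : ∀ E, tgam nab φ a E C y * tgam nab φ b D E y = tgam nab φ b D E y * tgam nab φ a E C y :=
    fun E => mul_comm _ _
  have : ∀ E, tgam nab φ b E C y * tgam nab φ a D E y = tgam nab φ a D E y * tgam nab φ b E C y :=
    fun E => mul_comm _ _
  simp only [*]
  ring

theorem SmM.tgamM (hn : 2 ≤ n) (hφ : φ ∈ atlas (Model n) M) (hx : x ∈ φ.source) (a : Fin n) :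
    SmM (tgamM nab φ a) x := fun A B => Sm.tgam nab hn hφ hx a A B

theorem SmM.pullTgamM (hn : 2 ≤ n) (hφ : φ ∈ atlas (Model n) M) (hψ : ψ ∈ atlas (Model n) M)
    (hx : x ∈ φ.source) (hx' : x ∈ ψ.source) (a : Fin n) : SmM (pullTgamM nab φ ψ a) x := by
  intro A B
  simp only [ProjTractor.pullTgamM, Matrix.sum_apply, Matrix.smul_apply, smul_eq_mul]
  exact Sm.sum fun d _ => (Sm.jac hφ hψ hx hx' d a).mul (Sm.tgam nab hn hψ hx' d A B)

/-- The curvature of the transformed connection coefficients. -/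
theorem pullTgamM_curvature (hn : 2 ≤ n) (hφ : φ ∈ atlas (Model n) M)
    (hψ : ψ ∈ atlas (Model n) M) (hx : x ∈ φ.source) (hx' : x ∈ ψ.source) (a b : Fin n) :
    pdM φ a (pullTgamM nab φ ψ b) x - pdM φ b (pullTgamM nab φ ψ a) x +
      pullTgamM nab φ ψ b x * pullTgamM nab φ ψ a x -
      pullTgamM nab φ ψ a x * pullTgamM nab φ ψ b x =
      ∑ d, ∑ e, (jac φ ψ x d a * jac φ ψ x e b) • kapM nab ψ d e x := by
  have hp : ∀ a b, pdM φ a (pullTgamM nab φ ψ b) x =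
      ∑ d, pd φ a (fun y => jac φ ψ y d b) x • tgamM nab ψ d x +
      ∑ d, ∑ e, (jac φ ψ x d a * jac φ ψ x e b) • pdM ψ d (tgamM nab ψ e) x := by
    intro a b
    ext A B
    simp only [pdM, pullTgamM, Matrix.of_apply, Matrix.sum_apply, Matrix.smul_apply, smul_eq_mul,
      Matrix.add_apply]
    have hs : ∀ d, Sm n (fun y => tgamM nab ψ d y A B) x := fun d =>
      Sm.tgam nab hn hψ hx' d A B
    rw [pd_sum hφ hx fun d _ => (Sm.jac hφ hψ hx hx' d b).mul (hs d)]
    simp only [pd_mul hφ hx (Sm.jac hφ hψ hx hx' _ b) (hs _), pd_chain hφ hψ hx hx' (hs _),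
      Finset.sum_add_distrib, Finset.mul_sum]
    congr 1
    rw [Finset.sum_comm]
    exact Finset.sum_congr rfl fun d _ => Finset.sum_congr rfl fun e _ => by ring
  have hm : ∀ a b, pullTgamM nab φ ψ b x * pullTgamM nab φ ψ a x =
      ∑ d, ∑ e, (jac φ ψ x d a * jac φ ψ x e b) • (tgamM nab ψ e x * tgamM nab ψ d x) := by
    intro a b
    simp only [pullTgamM, Finset.sum_mul, Finset.mul_sum, smul_mul_assoc, mul_smul_comm,
      Finset.smul_sum, smul_smul]
  have hsw : ∀ F : Fin n → Fin n → Matrix (TIdx n) (TIdx n) ℝ,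
      ∑ d, ∑ e, (jac φ ψ x d b * jac φ ψ x e a) • F d e =
      ∑ d, ∑ e, (jac φ ψ x d a * jac φ ψ x e b) • F e d := by
    intro F
    rw [Finset.sum_comm]
    exact Finset.sum_congr rfl fun d _ => Finset.sum_congr rfl fun e _ => by rw [mul_comm]
  rw [hp a b, hp b a, hm a b, hm b a]
  simp only [hsw, pd_jac_comm hφ hψ hx hx' _ a b, kapM_eq, smul_sub, smul_add,
    Finset.sum_add_distrib, Finset.sum_sub_distrib]
  abel

theorem Sm.cotractorTrans (hφ : φ ∈ atlas (Model n) M) (hψ : ψ ∈ atlas (Model n) M)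
    (hx : x ∈ φ.source) (hx' : x ∈ ψ.source) (A B : TIdx n) :
    Sm n (fun y => cotractorTrans φ ψ y A B) x := by
  rcases A with _ | a <;> rcases B with _ | b
  · exact Sm.dens hφ hψ hx hx' 1
  · exact Sm.const 0
  · exact (Sm.dens hφ hψ hx hx' 1).pd hφ hx a
  · exact (Sm.dens hφ hψ hx hx' 1).mul (Sm.jac hφ hψ hx hx' b a)

end chartChange

/-! ### The gauge law of the tractor connection -/

section gauge

variable {n r : ℕ} {M : Type*} [TopologicalSpace M] [ChartedSpace (Model n) M]
  [IsManifold (𝓡 n) ∞ M] [T2Space M] (nab : AffineConnection n M)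
  {φ ψ : OpenPartialHomeomorph M (Model n)} {x : M}

/-- The tractor curvature is trace-free: this is the normalisation of the Schouten tensor. -/
theorem sum_kap_some_some (hn : 2 ≤ n) (hφ : φ ∈ atlas (Model n) M) (hx : x ∈ φ.source)
    (b d : Fin n) : ∑ a, kap nab φ a b (some a) (some d) x = 0 := by
  have hn1 : (n : ℝ) - 1 ≠ 0 := by
    have : (2 : ℝ) ≤ n := by exact_mod_cast hn
    linarith
  have h1 : ∀ a b c d : Fin n, pd φ a (tgam nab φ b (some d) (some c)) x =
      pd φ a (thomasPi nab φ b d c) x := fun a b c d =>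
    pd_congr hx (Eventually.of_forall fun y => tgam_some_some nab φ b d c y) a
  have h2 : ∑ a, pd φ b (thomasPi nab φ a d a) x = 0 := by
    rw [← pd_sum hφ hx fun a _ => Sm.thomasPi nab hφ hx a d a, ← pd_const φ b 0 x]
    exact pd_congr hx (eventually_source hx fun y hy => sum_thomasPi' nab hφ hy d) b
  have h3 : ∑ a, ∑ e, thomasPi nab φ a e a x * thomasPi nab φ b d e x = 0 := by
    rw [Finset.sum_comm]
    simp only [← Finset.sum_mul, sum_thomasPi' nab hφ hx]
    simp
  simp only [kap, Fintype.sum_option, tgam_none_some, tgam_some_some, h1,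
    tgam_some_none nab hn hφ hx, Finset.sum_add_distrib, Finset.sum_sub_distrib, h2, h3]
  have h4 : ∑ c, ∑ e, thomasPi nab φ b e c x * thomasPi nab φ c d e x =
      ∑ c, pd φ c (thomasPi nab φ b d c) x - thomasRic nab φ b d x := by
    unfold thomasRic; ring
  rw [h4]
  simp only [ite_mul, one_mul, zero_mul, Finset.sum_ite_eq, Finset.mem_univ, if_true,
    Finset.sum_const, Finset.card_univ, Fintype.card_fin, nsmul_eq_mul]
  field_simp
  ring

/-- The transition matrix of the cotractor bundle. -/
def transM (φ ψ : OpenPartialHomeomorph M (Model n)) (y : M) : Matrix (TIdx n) (TIdx n) ℝ :=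
  Matrix.of (cotractorTrans φ ψ y)

/-- The failure of the gauge law of the tractor connection in the component
`(some b, none)`; it is shown to vanish. -/
def gaugeDefect (φ ψ : OpenPartialHomeomorph M (Model n)) (a b : Fin n) (y : M) : ℝ :=
  (pd φ a (pd φ b (dens 1 φ ψ)) y -
    ∑ C, tgam nab φ a (some b) C y * cotractorTrans φ ψ y C none +
    ∑ d, jac φ ψ y d a * ∑ C, cotractorTrans φ ψ y (some b) C * tgam nab ψ d C none y) /
    dens 1 φ ψ y

/-- The connection coefficients in the chart `φ`, corrected by the gauge defect. -/
def tgamDefM (φ ψ : OpenPartialHomeomorph M (Model n)) (a : Fin n) (y : M) :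
    Matrix (TIdx n) (TIdx n) ℝ := Matrix.of fun
  | some b, none => tgam nab φ a (some b) none y + gaugeDefect nab φ ψ a b y
  | A, B => tgam nab φ a A B y

theorem SmM.transM (hφ : φ ∈ atlas (Model n) M) (hψ : ψ ∈ atlas (Model n) M)
    (hx : x ∈ φ.source) (hx' : x ∈ ψ.source) : SmM (transM φ ψ) x :=
  fun A B => Sm.cotractorTrans hφ hψ hx hx' A B

theorem Sm.gaugeDefect (hn : 2 ≤ n) (hφ : φ ∈ atlas (Model n) M) (hψ : ψ ∈ atlas (Model n) M)
    (hx : x ∈ φ.source) (hx' : x ∈ ψ.source) (a b : Fin n) :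
    Sm n (gaugeDefect nab φ ψ a b) x := by
  have h1 : Sm n (fun y => (ProjTractor.dens 1 φ ψ y)⁻¹) x := by
    refine Sm.congr (Sm.dens hφ hψ hx hx' (-1)) ?_
    filter_upwards [φ.open_source.mem_nhds hx, ψ.open_source.mem_nhds hx'] with y hy hy'
    refine eq_inv_of_mul_eq_one_left ?_
    rw [← dens_add hφ hψ hy hy', neg_add_cancel, dens_zero]
  exact ((((Sm.dens hφ hψ hx hx' 1).pd hφ hx b).pd hφ hx a).sub (Sm.sum fun C _ =>
    (Sm.tgam nab hn hφ hx a _ C).mul (Sm.cotractorTrans hφ hψ hx hx' C none))).add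
    (Sm.sum fun d _ => (Sm.jac hφ hψ hx hx' d a).mul (Sm.sum fun C _ =>
      (Sm.cotractorTrans hφ hψ hx hx' _ C).mul (Sm.tgam nab hn hψ hx' d C none))) |>.mul h1

theorem SmM.tgamDefM (hn : 2 ≤ n) (hφ : φ ∈ atlas (Model n) M) (hψ : ψ ∈ atlas (Model n) M)
    (hx : x ∈ φ.source) (hx' : x ∈ ψ.source) (a : Fin n) : SmM (tgamDefM nab φ ψ a) x := by
  rintro (_ | b) (_ | c)
  · exact Sm.tgam nab hn hφ hx a none none
  · exact Sm.tgam nab hn hφ hx a none (some c)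
  · exact (Sm.tgam nab hn hφ hx a (some b) none).add (Sm.gaugeDefect nab hn hφ hψ hx hx' a b)
  · exact Sm.tgam nab hn hφ hx a (some b) (some c)

theorem gauge_law_some_some (hφ : φ ∈ atlas (Model n) M) (hψ : ψ ∈ atlas (Model n) M)
    (hx : x ∈ φ.source) (hx' : x ∈ ψ.source) (a b e : Fin n) :
    pd φ a (fun y => dens 1 φ ψ y * jac φ ψ y e b) x =
      ∑ c, thomasPi nab φ a b c x * (dens 1 φ ψ x * jac φ ψ x e c) -
      (pd φ b (dens 1 φ ψ) x * jac φ ψ x e a +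
        ∑ d, jac φ ψ x d a * ∑ f, dens 1 φ ψ x * jac φ ψ x f b * thomasPi nab ψ d f e x) := by
  have hG := Gam_change nab hφ hψ hx hx' a b e
  have hga := gam_change nab hφ hψ hx hx' a
  have hgb := gam_change nab hφ hψ hx hx' b
  rw [pd_mul hφ hx (Sm.dens hφ hψ hx hx' 1) (Sm.jac hφ hψ hx hx' e b)]
  simp only [thomasPi, sub_mul, mul_sub, Finset.sum_sub_distrib, ite_mul, mul_ite, mul_zero,
    zero_mul, Finset.sum_ite_eq, Finset.sum_ite_eq', Finset.mem_univ, if_true]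
  have e1 : ∑ c, Gam nab φ a b c x * (dens 1 φ ψ x * jac φ ψ x e c) =
      dens 1 φ ψ x * ∑ c, Gam nab φ a b c x * jac φ ψ x e c := by
    rw [Finset.mul_sum]; exact Finset.sum_congr rfl fun c _ => by ring
  have e2 : ∑ d, jac φ ψ x d a * ∑ f, dens 1 φ ψ x * jac φ ψ x f b * Gam nab ψ d f e x =
      dens 1 φ ψ x * ∑ f, ∑ h, jac φ ψ x f a * jac φ ψ x h b * Gam nab ψ f h e x := by
    simp only [Finset.mul_sum]
    exact Finset.sum_congr rfl fun d _ => Finset.sum_congr rfl fun f _ => by ring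
  have e3 : ∑ d, jac φ ψ x d a * (dens 1 φ ψ x * jac φ ψ x e b * gam nab ψ d x) =
      dens 1 φ ψ x * jac φ ψ x e b * ∑ d, jac φ ψ x d a * gam nab ψ d x := by
    rw [Finset.mul_sum]; exact Finset.sum_congr rfl fun c _ => by ring
  have e4 : ∑ d, jac φ ψ x d a * ∑ f, (if e = d then dens 1 φ ψ x * jac φ ψ x f b *
      gam nab ψ f x else 0) = jac φ ψ x e a * (dens 1 φ ψ x * ∑ d, jac φ ψ x d b * gam nab ψ d x) := by
    rw [Finset.sum_eq_single e (fun d _ hd => by simp [hd.symm]) (by simp)]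
    simp only [if_true, Finset.mul_sum]
    exact Finset.sum_congr rfl fun c _ => by ring
  rw [e1, e2, e3, e4, hG]
  linear_combination jac φ ψ x e b * hga + jac φ ψ x e a * hgb

/-- The corrected connection coefficients satisfy the gauge law. -/
theorem gauge_law_defect (hφ : φ ∈ atlas (Model n) M) (hψ : ψ ∈ atlas (Model n) M)
    (hx : x ∈ φ.source) (hx' : x ∈ ψ.source) (a : Fin n) :
    pdM φ a (transM φ ψ) x =
      tgamDefM nab φ ψ a x * transM φ ψ x - transM φ ψ x * pullTgamM nab φ ψ a x := by
  have hd := dens_ne_zero hφ hψ hx hx' 1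
  have hs : ∀ A B, (transM φ ψ x * pullTgamM nab φ ψ a x) A B =
      ∑ d, jac φ ψ x d a * ∑ C, cotractorTrans φ ψ x A C * tgam nab ψ d C B x := by
    intro A B
    simp only [Matrix.mul_apply, transM, pullTgamM, tgamM, Matrix.sum_apply, Matrix.smul_apply,
      Matrix.of_apply, smul_eq_mul, Finset.mul_sum]
    rw [Finset.sum_comm]
    exact Finset.sum_congr rfl fun d _ => Finset.sum_congr rfl fun C _ => by ring
  ext A B
  rw [Matrix.sub_apply, hs, Matrix.mul_apply]
  rcases A with _ | b <;> rcases B with _ | e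
  · simp [pdM, transM, tgamDefM, Fintype.sum_option, cotractorTrans, tgam_none_none,
      tgam_none_some]
  · simp [pdM, transM, tgamDefM, Fintype.sum_option, cotractorTrans, tgam_none_none,
      tgam_none_some, pd_const]
    ring
  · have : pdM φ a (transM φ ψ) x (some b) none = pd φ a (pd φ b (dens 1 φ ψ)) x := rfl
    rw [this]
    simp only [tgamDefM, transM, Matrix.of_apply, Fintype.sum_option, gaugeDefect]
    simp only [cotractorTrans]
    field_simp
    ring
  · have h := gauge_law_some_some nab hφ hψ hx hx' a b e
    have : pdM φ a (transM φ ψ) x (some b) (some e) =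
      pd φ a (fun y => dens 1 φ ψ y * jac φ ψ y e b) x := rfl
    rw [this, h]
    simp [tgamDefM, transM, Fintype.sum_option, cotractorTrans, tgam_none_some, tgam_some_some,
      mul_add, Finset.sum_add_distrib]
    ring

/-- The gauge defect vanishes: it changes the trace of the curvature, which is zero in both
charts. -/
theorem gaugeDefect_eq_zero (hn : 2 ≤ n) (hφ : φ ∈ atlas (Model n) M)
    (hψ : ψ ∈ atlas (Model n) M) (hx : x ∈ φ.source) (hx' : x ∈ ψ.source) (b d : Fin n) :
    gaugeDefect nab φ ψ b d x = 0 := by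
  have hn1 : (n : ℝ) - 1 ≠ 0 := by
    have : (2 : ℝ) ≤ n := by exact_mod_cast hn
    linarith
  have hd := dens_ne_zero hφ hψ hx hx' 1
  have hG := SmM.tgamDefM nab hn hφ hψ hx hx'
  have key := fun a => gauge_curvature hφ hx (SmM.transM hφ hψ hx hx') hG
    (SmM.pullTgamM nab hn hφ hψ hx hx') (fun a => by
      filter_upwards [φ.open_source.mem_nhds hx, ψ.open_source.mem_nhds hx'] with y hy hy'
      exact gauge_law_defect nab hφ hψ hy hy' a) a b
  simp only [pullTgamM_curvature nab hn hφ hψ hx hx'] at key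
  -- the curvature of the corrected coefficients
  have hR : ∀ a c, (pdM φ a (tgamDefM nab φ ψ b) x - pdM φ b (tgamDefM nab φ ψ a) x +
      tgamDefM nab φ ψ b x * tgamDefM nab φ ψ a x -
      tgamDefM nab φ ψ a x * tgamDefM nab φ ψ b x) (some d) (some c) =
      kap nab φ a b (some c) (some d) x + (if a = c then gaugeDefect nab φ ψ b d x else 0) -
        (if b = c then gaugeDefect nab φ ψ a d x else 0) := by
    intro a c
    have : kap nab φ a b (some c) (some d) x = kapM nab φ a b x (some d) (some c) := rfl
    rw [this, kapM_eq]
    simp only [Matrix.sub_apply, Matrix.add_apply, Matrix.mul_apply, pdM, tgamM, Matrix.of_apply,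
      Fintype.sum_option, tgamDefM, tgam_none_some]
    split_ifs <;> ring
  have hR' : ∀ a e, ∑ c, (kap nab φ a b (some c) (some d) x +
      (if a = c then gaugeDefect nab φ ψ b d x else 0) -
      (if b = c then gaugeDefect nab φ ψ a d x else 0)) * jac φ ψ x e c =
      ∑ f, jac φ ψ x f d * ∑ p, ∑ q, jac φ ψ x p a * jac φ ψ x q b *
        kap nab ψ p q (some e) (some f) x := by
    intro a e
    have h := congrFun (congrFun (key a) (some d)) (some e)
    rw [Matrix.mul_apply, Matrix.mul_apply, Fintype.sum_option, Fintype.sum_option] at h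
    simp only [hR, transM, Matrix.of_apply, cotractorTrans, Matrix.sum_apply, Matrix.smul_apply,
      smul_eq_mul] at h
    have h0 : ∀ p q, kapM nab ψ p q x none (some e) = 0 := fun p q =>
      kap_none_right nab hn hψ hx' p q (some e)
    simp only [h0, mul_zero, Finset.sum_const_zero, zero_add] at h
    refine mul_left_cancel₀ hd ?_
    rw [Finset.mul_sum, Finset.mul_sum]
    refine Eq.trans (Finset.sum_congr rfl fun c _ => ?_) (h.trans (Finset.sum_congr rfl
      fun f _ => ?_))
    · ring
    · rw [mul_assoc]; rfl
  have hJ := fun e g => congrFun (congrFun (jac_mul_jac hφ hψ hx hx') e) g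
  have hJ' := fun e g => congrFun (congrFun (jac_mul_jac hψ hφ hx' hx) e) g
  simp only [Matrix.mul_apply, Matrix.one_apply] at hJ hJ'
  -- contract with the inverse Jacobian
  have h1 : ∑ a, ∑ e, jac ψ φ x a e * (∑ c, (kap nab φ a b (some c) (some d) x +
      (if a = c then gaugeDefect nab φ ψ b d x else 0) -
      (if b = c then gaugeDefect nab φ ψ a d x else 0)) * jac φ ψ x e c) =
      ((n : ℝ) - 1) * gaugeDefect nab φ ψ b d x := by
    have : ∀ a, ∑ e, jac ψ φ x a e * (∑ c, (kap nab φ a b (some c) (some d) x +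
      (if a = c then gaugeDefect nab φ ψ b d x else 0) -
      (if b = c then gaugeDefect nab φ ψ a d x else 0)) * jac φ ψ x e c) =
      kap nab φ a b (some a) (some d) x + gaugeDefect nab φ ψ b d x -
      (if b = a then gaugeDefect nab φ ψ a d x else 0) := by
      intro a
      simp only [Finset.mul_sum]
      rw [Finset.sum_comm]
      have : ∀ c, ∑ e, jac ψ φ x a e * ((kap nab φ a b (some c) (some d) x +
          (if a = c then gaugeDefect nab φ ψ b d x else 0) -
          (if b = c then gaugeDefect nab φ ψ a d x else 0)) * jac φ ψ x e c) =
          (if a = c then 1 else 0) * (kap nab φ a b (some c) (some d) x +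
          (if a = c then gaugeDefect nab φ ψ b d x else 0) -
          (if b = c then gaugeDefect nab φ ψ a d x else 0)) := by
        intro c
        rw [← hJ, Finset.sum_mul]
        exact Finset.sum_congr rfl fun e _ => by ring
      simp only [this, ite_mul, one_mul, zero_mul]
      simp
    simp only [this, Finset.sum_sub_distrib, Finset.sum_add_distrib,
      sum_kap_some_some nab hn hφ hx]
    simp
    ring
  rw [Finset.sum_congr rfl fun a _ => Finset.sum_congr rfl fun e _ => by rw [hR']] at h1
  have h2 : ∑ a, ∑ e, jac ψ φ x a e * ∑ f, jac φ ψ x f d * ∑ p, ∑ q, jac φ ψ x p a *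
      jac φ ψ x q b * kap nab ψ p q (some e) (some f) x =
      ∑ f, jac φ ψ x f d * ∑ q, jac φ ψ x q b * ∑ p, ∑ e, (∑ a, jac φ ψ x p a * jac ψ φ x a e) *
        kap nab ψ p q (some e) (some f) x := by
    simp only [Finset.mul_sum, Finset.sum_mul]
    rw [Finset.sum_congr rfl fun a _ => Finset.sum_comm, Finset.sum_comm]
    refine Finset.sum_congr rfl fun f _ => ?_
    rw [Finset.sum_congr rfl fun a _ => Finset.sum_congr rfl fun e _ => Finset.sum_comm,
      Finset.sum_congr rfl fun a _ => Finset.sum_comm, Finset.sum_comm]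
    refine Finset.sum_congr rfl fun q _ => ?_
    rw [Finset.sum_congr rfl fun a _ => Finset.sum_comm, Finset.sum_comm]
    refine Finset.sum_congr rfl fun p _ => ?_
    rw [Finset.sum_comm]
    exact Finset.sum_congr rfl fun e _ => Finset.sum_congr rfl fun a _ => by ring
  rw [h2] at h1
  simp only [hJ', ite_mul, one_mul, zero_mul, Finset.sum_ite_eq, Finset.mem_univ, if_true,
    sum_kap_some_some nab hn hψ hx', mul_zero, Finset.sum_const_zero] at h1
  exact (mul_eq_zero.mp h1.symm).resolve_left hn1

/-- The tractor connection is a connection on the cotractor bundle. -/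
theorem gauge_law (hn : 2 ≤ n) (hφ : φ ∈ atlas (Model n) M) (hψ : ψ ∈ atlas (Model n) M)
    (hx : x ∈ φ.source) (hx' : x ∈ ψ.source) (a : Fin n) :
    pdM φ a (transM φ ψ) x =
      tgamM nab φ a x * transM φ ψ x - transM φ ψ x * pullTgamM nab φ ψ a x := by
  rw [gauge_law_defect nab hφ hψ hx hx' a]
  congr 2
  ext A B
  rcases A with _ | b <;> rcases B with _ | e <;> try rfl
  simp [tgamDefM, tgamM, gaugeDefect_eq_zero nab hn hφ hψ hx hx']

theorem kapM_change (hn : 2 ≤ n) (hφ : φ ∈ atlas (Model n) M) (hψ : ψ ∈ atlas (Model n) M)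
    (hx : x ∈ φ.source) (hx' : x ∈ ψ.source) (a b : Fin n) :
    kapM nab φ a b x * transM φ ψ x = transM φ ψ x *
      ∑ d, ∑ e, (jac φ ψ x d a * jac φ ψ x e b) • kapM nab ψ d e x := by
  rw [kapM_eq, ← pullTgamM_curvature nab hn hφ hψ hx hx']
  exact gauge_curvature hφ hx (SmM.transM hφ hψ hx hx') (SmM.tgamM nab hn hφ hx)
    (SmM.pullTgamM nab hn hφ hψ hx hx') (fun a => by
      filter_upwards [φ.open_source.mem_nhds hx, ψ.open_source.mem_nhds hx'] with y hy hy'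
      exact gauge_law nab hn hφ hψ hy hy' a) a b

end gauge

/-! ### Weighted tractor fields -/

section tractorFields

variable {n r : ℕ} {M : Type*} [TopologicalSpace M] [ChartedSpace (Model n) M]
  [IsManifold (𝓡 n) ∞ M] [T2Space M] (nab : AffineConnection n M)
  {φ ψ : OpenPartialHomeomorph M (Model n)} {x : M}

theorem pd_cotractorTrans (hn : 2 ≤ n) (hφ : φ ∈ atlas (Model n) M) (hψ : ψ ∈ atlas (Model n) M)
    (hx : x ∈ φ.source) (hx' : x ∈ ψ.source) (a : Fin n) (A B : TIdx n) :
    pd φ a (fun y => cotractorTrans φ ψ y A B) x =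
      ∑ C, tgam nab φ a A C x * cotractorTrans φ ψ x C B -
      ∑ C, cotractorTrans φ ψ x A C * ∑ d, jac φ ψ x d a * tgam nab ψ d C B x := by
  have h := congrFun (congrFun (gauge_law nab hn hφ hψ hx hx' a) A) B
  rw [Matrix.sub_apply, Matrix.mul_apply, Matrix.mul_apply] at h
  simpa [pdM, transM, tgamM, pullTgamM, Matrix.sum_apply] using h

/-- The ambient curvature is a tractor field of weight `-2`. -/
theorem ambW_change (hn : 2 ≤ n) (hφ : φ ∈ atlas (Model n) M) (hψ : ψ ∈ atlas (Model n) M)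
    (hx : x ∈ φ.source) (hx' : x ∈ ψ.source) (A B G K : TIdx n) :
    ∑ H, ambW nab φ A B H G x * cotractorTrans φ ψ x H K =
      dens (-2) φ ψ x * ∑ H, cotractorTrans φ ψ x G H *
        ∑ D, ∑ E, cotractorTrans φ ψ x A D * cotractorTrans φ ψ x B E * ambW nab ψ D E K H x := by
  rcases A with _ | a
  · simp [ambW_none_left, Fintype.sum_option, cotractorTrans]
  rcases B with _ | b
  · simp [ambW_none_right, Fintype.sum_option, cotractorTrans]
  have hd : dens (-2) φ ψ x * (dens 1 φ ψ x * dens 1 φ ψ x) = 1 := by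
    rw [← dens_add hφ hψ hx hx', ← dens_add hφ hψ hx hx']
    norm_num [dens_zero]
  have h := congrFun (congrFun (kapM_change nab hn hφ hψ hx hx' a b) G) K
  rw [Matrix.mul_apply, Matrix.mul_apply] at h
  simp only [transM, kapM, Matrix.of_apply, Matrix.sum_apply, Matrix.smul_apply, smul_eq_mul] at h
  simp only [ambW_some]
  rw [h, Finset.mul_sum]
  refine Finset.sum_congr rfl fun H _ => ?_
  have : ∑ D, ∑ E, cotractorTrans φ ψ x (some a) D * cotractorTrans φ ψ x (some b) E *
      ambW nab ψ D E K H x = (dens 1 φ ψ x * dens 1 φ ψ x) *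
      ∑ d, ∑ e, jac φ ψ x d a * jac φ ψ x e b * kap nab ψ d e K H x := by
    simp only [Fintype.sum_option, ambW_none_left, ambW_none_right, mul_zero, zero_add,
      Finset.sum_const_zero, ambW_some, cotractorTrans, Finset.mul_sum]
    exact Finset.sum_congr rfl fun d _ => Finset.sum_congr rfl fun e _ => by ring
  rw [this]
  linear_combination (-cotractorTrans φ ψ x G H *
    ∑ d, ∑ e, jac φ ψ x d a * jac φ ψ x e b * kap nab ψ d e K H x) * hd

theorem pd_dens_eq (hφ : φ ∈ atlas (Model n) M) (hψ : ψ ∈ atlas (Model n) M)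
    (hx : x ∈ φ.source) (hx' : x ∈ ψ.source) (w : ℝ) (a : Fin n) :
    pd φ a (dens w φ ψ) x = w * dens (w - 1) φ ψ x * pd φ a (dens 1 φ ψ) x := by
  rw [pd_dens hφ hψ hx hx', pd_dens hφ hψ hx hx']
  have : dens w φ ψ x = dens (w - 1) φ ψ x * dens 1 φ ψ x := by
    rw [← dens_add hφ hψ hx hx', sub_add_cancel]
  rw [this]
  ring

theorem tens_sharp_sum {ι : Type*} (s : Finset ι) (T : TIdx n → TIdx n → ℝ) (c : ι → ℝ)
    (S : ι → TIdx n → TIdx n → ℝ) (l : (Fin r → TIdx n) → ℝ) (I : Fin r → TIdx n) :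
    tens T (sharp (fun H G => ∑ k ∈ s, c k * S k H G) l) I =
      ∑ k ∈ s, c k * tens T (sharp (S k) l) I := by
  have : sharp (fun H G => ∑ k ∈ s, c k * S k H G) l = fun J => ∑ k ∈ s, c k * sharp (S k) l J :=
    funext fun J => by simp only [sharp_sum_left, sharp_smul_left]
  rw [this, tens_sum]
  simp only [tens_smul]

theorem pd_tens (hn : 2 ≤ n) (hφ : φ ∈ atlas (Model n) M) (hψ : ψ ∈ atlas (Model n) M)
    (hx : x ∈ φ.source) (hx' : x ∈ ψ.source) {V : (Fin r → TIdx n) → M → ℝ}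
    (hV : ∀ J, Sm n (V J) x) (a : Fin n) (I : Fin r → TIdx n) :
    pd φ a (fun y => tens (cotractorTrans φ ψ y) (fun J => V J y) I) x =
      - sharp (fun H G => tgam nab φ a G H x)
        (tens (cotractorTrans φ ψ x) (fun J => V J x)) I +
      ∑ d, jac φ ψ x d a * tens (cotractorTrans φ ψ x)
        (fun J => pd ψ d (V J) x + sharp (fun H G => tgam nab ψ d G H x) (fun J => V J x) J) I := by
  have hT := Sm.cotractorTrans hφ hψ hx hx'
  have h1 : pd φ a (fun y => tens (cotractorTrans φ ψ y) (fun J => V J y) I) x =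
      ∑ J : Fin r → TIdx n, (∑ i, (∏ j ∈ Finset.univ.erase i,
        cotractorTrans φ ψ x (I j) (J j)) * pd φ a (fun y => cotractorTrans φ ψ y (I i) (J i)) x) *
          V J x + tens (cotractorTrans φ ψ x) (fun J => pd φ a (V J) x) I := by
    simp only [tens]
    rw [pd_sum hφ hx fun J _ => (Sm.prod fun i _ => hT (I i) (J i)).mul (hV J),
      ← Finset.sum_add_distrib]
    refine Finset.sum_congr rfl fun J _ => ?_
    rw [pd_mul hφ hx (Sm.prod fun i _ => hT (I i) (J i)) (hV J),
      pd_prod hφ hx fun i _ => hT (I i) (J i)]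
  have h2 := sum_prod_erase_mul (cotractorTrans φ ψ x) (fun H G => tgam nab φ a G H x)
    (fun H G => ∑ d, jac φ ψ x d a * tgam nab ψ d G H x)
    (fun A B => pd φ a (fun y => cotractorTrans φ ψ y A B) x)
    (fun A B => pd_cotractorTrans nab hn hφ hψ hx hx' a A B) (fun J => V J x) I
  rw [h1, h2]
  simp only [tens_add, mul_add, Finset.sum_add_distrib, pd_chain hφ hψ hx hx' (hV _),
    tens_sum, tens_smul, tens_sharp_sum]
  ring

/-- The Thomas operator is compatible with changes of charts. -/
theorem thomasD_tens (hn : 2 ≤ n) (hφ : φ ∈ atlas (Model n) M) (hψ : ψ ∈ atlas (Model n) M)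
    (hx : x ∈ φ.source) (hx' : x ∈ ψ.source) {w : ℝ} {V V' : (Fin r → TIdx n) → M → ℝ}
    (hV' : ∀ J, Sm n (V' J) x)
    (h : ∀ y ∈ φ.source ∩ ψ.source, ∀ I, V I y =
      dens w φ ψ y * tens (cotractorTrans φ ψ y) (fun J => V' J y) I) (I : Fin (r + 1) → TIdx n) :
    thomasD nab φ w V I x = dens (w - 1) φ ψ x *
      tens (cotractorTrans φ ψ x) (fun J => thomasD nab ψ w V' J x) I := by
  have hd : dens w φ ψ x = dens (w - 1) φ ψ x * dens 1 φ ψ x := by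
    rw [← dens_add hφ hψ hx hx', sub_add_cancel]
  rw [← vecCons_eta I, tens_cons, Fintype.sum_option]
  simp only [thomasD_none, thomasD_some, tens_smul]
  cases I 0 with
  | none =>
    rw [thomasD_none, h x ⟨hx, hx'⟩, hd]
    simp only [cotractorTrans, zero_mul, Finset.sum_const_zero]
    ring
  | some a =>
    rw [thomasD_some]
    have e : V (Fin.tail I) =ᶠ[𝓝 x] fun y => dens w φ ψ y *
        tens (cotractorTrans φ ψ y) (fun J => V' J y) (Fin.tail I) := by
      filter_upwards [φ.open_source.mem_nhds hx, ψ.open_source.mem_nhds hx'] with y hy hy'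
      exact h y ⟨hy, hy'⟩ _
    have hs : Sm n (fun y => tens (cotractorTrans φ ψ y) (fun J => V' J y) (Fin.tail I)) x :=
      Sm.sum fun J _ => (Sm.prod fun i _ => Sm.cotractorTrans hφ hψ hx hx' _ _).mul (hV' J)
    have e2 : (fun J => V J x) = fun J => dens w φ ψ x *
        tens (cotractorTrans φ ψ x) (fun J => V' J x) J := funext fun J => h x ⟨hx, hx'⟩ J
    rw [pd_congr hx e, pd_mul hφ hx (Sm.dens hφ hψ hx hx' w) hs, pd_tens nab hn hφ hψ hx hx' hV',
      e2, sharp_smul_right, pd_dens_eq hφ hψ hx hx']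
    simp only [cotractorTrans, hd, mul_assoc, ← Finset.mul_sum]
    ring

/-- `V` is a smooth section of the `r`-th tensor power of the cotractor bundle, of weight `w`. -/
structure IsTractor (w : ℝ) (V : CotractorComp n M r) : Prop where
  smooth : ∀ φ : atlas (Model n) M, ∀ x ∈ φ.1.source, ∀ J, Sm n (V φ J) x
  trans : ∀ φ ψ : atlas (Model n) M, ∀ x ∈ φ.1.source ∩ ψ.1.source, ∀ I,
    V φ I x = dens w φ.1 ψ.1 x * tens (cotractorTrans φ.1 ψ.1 x) (fun J => V ψ J x) I

variable {w : ℝ} {V V' : CotractorComp n M r}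

theorem IsTractor.add (h : IsTractor w V) (h' : IsTractor w V') :
    IsTractor w (fun φ J y => V φ J y + V' φ J y) where
  smooth φ x hx J := (h.smooth φ x hx J).add (h'.smooth φ x hx J)
  trans φ ψ x hx I := by rw [h.trans φ ψ x hx, h'.trans φ ψ x hx, tens_add, mul_add]

theorem IsTractor.smul (c : ℝ) (h : IsTractor w V) : IsTractor w (fun φ J y => c * V φ J y) where
  smooth φ x hx J := (Sm.const c).mul (h.smooth φ x hx J)
  trans φ ψ x hx I := by rw [h.trans φ ψ x hx, tens_smul]; ring

theorem IsTractor.sub (h : IsTractor w V) (h' : IsTractor w V') :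
    IsTractor w (fun φ J y => V φ J y - V' φ J y) := by
  have := h.add (h'.smul (-1))
  simpa only [neg_one_mul, ← sub_eq_add_neg] using this

theorem IsTractor.thomasD (hn : 2 ≤ n) (h : IsTractor w V) {w' : ℝ} (hw : w' = w - 1) :
    IsTractor w' (fun φ => thomasD nab φ.1 w (V φ)) where
  smooth φ x hx J := Sm.thomasD nab hn φ.2 hx w (h.smooth φ x hx) J
  trans φ ψ x hx I := by
    rw [hw]
    exact thomasD_tens nab hn φ.2 ψ.2 hx.1 hx.2 (h.smooth ψ x hx.2) (h.trans φ ψ) I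

theorem tens_comp_perm (T : TIdx n → TIdx n → ℝ) (l : (Fin r → TIdx n) → ℝ)
    (σ : Equiv.Perm (Fin r)) (I : Fin r → TIdx n) :
    tens T l (I ∘ σ) = tens T (fun J => l (J ∘ σ)) I := by
  unfold tens
  rw [← (Equiv.arrowCongr σ.symm (Equiv.refl (TIdx n))).sum_comp]
  refine Finset.sum_congr rfl fun J _ => ?_
  have : (Equiv.arrowCongr σ.symm (Equiv.refl (TIdx n))) J = J ∘ σ := by
    funext i; simp [Equiv.arrowCongr]
  rw [this]
  congr 1
  exact Equiv.prod_comp σ fun i => T (I i) (J i)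

theorem IsTractor.perm (h : IsTractor w V) {σ : Fin r → Fin r} (hσ : Function.Bijective σ) :
    IsTractor w (fun φ J => V φ (J ∘ σ)) where
  smooth φ x hx J := h.smooth φ x hx _
  trans φ ψ x hx I := by
    rw [h.trans φ ψ x hx]
    exact congrArg _ (tens_comp_perm _ _ (Equiv.ofBijective σ hσ) I)

/-- Contraction of the first index with the canonical tractor `X^A`. -/
theorem IsTractor.plug {V : CotractorComp n M (r + 1)} (h : IsTractor w V) {w' : ℝ}
    (hw : w' = w + 1) : IsTractor w' (fun φ J => V φ (Matrix.vecCons none J)) where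
  smooth φ x hx J := h.smooth φ x hx _
  trans φ ψ x hx I := by
    rw [h.trans φ ψ x hx, tens_cons, Fintype.sum_option, hw, dens_add φ.2 ψ.2 hx.1 hx.2]
    simp only [cotractorTrans, zero_mul, Finset.sum_const_zero]
    ring

/-- The field `(W_{AB}♯V)_I` with indices `A, B, I`. -/
def ambWSharp (V : CotractorComp n M r) : CotractorComp n M (r + 2) := fun φ J x =>
  sharp (fun H G => ambW nab φ.1 (J 0) (J 1) H G x) (fun J => V φ J x) (Fin.tail (Fin.tail J))

/-- The field `((𝔻_A W_{BC})♯V)_I` with indices `A, B, C, I`. -/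
def ambDWSharp (V : CotractorComp n M r) : CotractorComp n M (r + 3) := fun φ J x =>
  sharp (fun H G => ambDW nab φ.1 (J 0) (J 1) (J 2) H G x) (fun J => V φ J x)
    (Fin.tail (Fin.tail (Fin.tail J)))

theorem IsTractor.ambWSharp (hn : 2 ≤ n) (h : IsTractor w V) {w' : ℝ} (hw : w' = w - 2) :
    IsTractor w' (ambWSharp nab V) where
  smooth φ x hx J := Sm.sharp (fun H G => Sm.ambW nab hn φ.2 hx _ _ H G) (h.smooth φ x hx) _
  trans φ ψ x hx I := by
    rw [← vecCons_eta I, ← vecCons_eta (Fin.tail I), tens_cons]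
    simp only [tens_cons]
    have e : (fun J => V φ J x) = fun J => dens w φ.1 ψ.1 x *
        tens (cotractorTrans φ.1 ψ.1 x) (fun J => V ψ J x) J := funext fun J => h.trans φ ψ x hx J
    have hs := sharp_tens (cotractorTrans φ.1 ψ.1 x)
      (fun H G => ambW nab φ.1 (I 0) (Fin.tail I 0) H G x)
      (fun K H => ∑ D, (dens (-2) φ.1 ψ.1 x * cotractorTrans φ.1 ψ.1 x (I 0) D) *
        ∑ E, cotractorTrans φ.1 ψ.1 x (Fin.tail I 0) E * ambW nab ψ.1 D E K H x) (fun A B => by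
          rw [ambW_change nab hn φ.2 ψ.2 hx.1 hx.2, Finset.mul_sum]
          refine Finset.sum_congr rfl fun C _ => ?_
          simp only [mul_assoc, ← Finset.mul_sum]
          ring) (fun J => V ψ J x) (Fin.tail (Fin.tail I))
    change sharp (fun H G => ambW nab φ.1 (I 0) (Fin.tail I 0) H G x) (fun J => V φ J x)
      (Fin.tail (Fin.tail I)) = _
    rw [e, sharp_smul_right, hs, hw, sub_eq_add_neg, dens_add φ.2 ψ.2 hx.1 hx.2]
    rw [tens_sharp_sum]
    simp only [tens_sharp_sum, mul_assoc, ← Finset.mul_sum]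
    rfl

theorem sum_comm₄ {ι : Type*} [Fintype ι] (f : ι → ι → ι → ι → ℝ) :
    ∑ l, ∑ k, ∑ d, ∑ e, f l k d e = ∑ d, ∑ e, ∑ k, ∑ l, f l k d e := by
  calc _ = ∑ k, ∑ l, ∑ d, ∑ e, f l k d e := Finset.sum_comm
    _ = ∑ k, ∑ d, ∑ l, ∑ e, f l k d e := Finset.sum_congr rfl fun _ _ => Finset.sum_comm
    _ = ∑ d, ∑ k, ∑ l, ∑ e, f l k d e := Finset.sum_comm
    _ = ∑ d, ∑ k, ∑ e, ∑ l, f l k d e :=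
      Finset.sum_congr rfl fun _ _ => Finset.sum_congr rfl fun _ _ => Finset.sum_comm
    _ = _ := Finset.sum_congr rfl fun _ _ => Finset.sum_comm

/-- The field `W_{AB}^H_C V_{HI}` with indices `A, B, C, I`. -/
def ambWContr (V : CotractorComp n M (r + 1)) : CotractorComp n M (r + 3) := fun φ J x =>
  ∑ H, ambW nab φ.1 (J 0) (J 1) H (J 2) x *
    V φ (Matrix.vecCons H (Fin.tail (Fin.tail (Fin.tail J)))) x

theorem IsTractor.ambWContr {V : CotractorComp n M (r + 1)} (hn : 2 ≤ n) (h : IsTractor w V)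
    {w' : ℝ} (hw : w' = w - 2) : IsTractor w' (ambWContr nab V) where
  smooth φ x hx J := Sm.sum fun H _ => (Sm.ambW nab hn φ.2 hx _ _ H _).mul (h.smooth φ x hx _)
  trans φ ψ x hx I := by
    rw [← vecCons_eta I, ← vecCons_eta (Fin.tail I), ← vecCons_eta (Fin.tail (Fin.tail I)),
      tens_cons]
    simp only [tens_cons]
    change ∑ H, ambW nab φ.1 (I 0) (Fin.tail I 0) H (Fin.tail (Fin.tail I) 0) x *
      V φ (Matrix.vecCons H (Fin.tail (Fin.tail (Fin.tail I)))) x = _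
    generalize I 0 = A, Fin.tail I 0 = B, Fin.tail (Fin.tail I) 0 = C,
      Fin.tail (Fin.tail (Fin.tail I)) = K
    have e : ∀ D E F, tens (cotractorTrans φ.1 ψ.1 x) (fun J => ProjTractor.ambWContr nab V ψ
        (Matrix.vecCons D (Matrix.vecCons E (Matrix.vecCons F J))) x) K =
        ∑ H, ambW nab ψ.1 D E H F x * tens (cotractorTrans φ.1 ψ.1 x)
          (fun J => V ψ (Matrix.vecCons H J) x) K := by
      intro D E F
      simp only [← tens_smul, ← tens_sum]
      rfl
    simp only [e, h.trans φ ψ x hx, tens_cons]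
    obtain ⟨u, hu⟩ : ∃ u : TIdx n → ℝ, ∀ H, tens (cotractorTrans φ.1 ψ.1 x)
      (fun J => V ψ (Matrix.vecCons H J) x) K = u H := ⟨_, fun _ => rfl⟩
    simp only [hu]
    have h1 : ∑ H, ambW nab φ.1 A B H C x * (dens w φ.1 ψ.1 x *
        ∑ L, cotractorTrans φ.1 ψ.1 x H L * u L) = dens w φ.1 ψ.1 x *
        ∑ L, (∑ H, ambW nab φ.1 A B H C x * cotractorTrans φ.1 ψ.1 x H L) * u L := by
      simp only [Finset.mul_sum, Finset.sum_mul]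
      rw [Finset.sum_comm]
      exact Finset.sum_congr rfl fun _ _ => Finset.sum_congr rfl fun _ _ => by ring
    rw [h1, hw, sub_eq_add_neg, dens_add φ.2 ψ.2 hx.1 hx.2, mul_assoc]
    congr 1
    simp only [ambW_change nab hn φ.2 ψ.2 hx.1 hx.2, Finset.mul_sum, Finset.sum_mul]
    rw [sum_comm₄]
    exact Finset.sum_congr rfl fun _ _ => Finset.sum_congr rfl fun _ _ =>
      Finset.sum_congr rfl fun _ _ => Finset.sum_congr rfl fun _ _ => by ring

theorem IsTractor.ambDWSharp {V : CotractorComp n M 4} (hn : 2 ≤ n) (h : IsTractor w V) {w' : ℝ}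
    (hw : w' = w - 3) : IsTractor w' (ambDWSharp nab V) := by
  have h1 := (h.ambWSharp nab hn (w' := w - 2) rfl).thomasD nab hn (w' := w') (by rw [hw]; ring)
  have h2 := (h.thomasD nab hn (w' := w - 1) rfl).ambWSharp nab hn (w' := w') (by rw [hw]; ring)
  have h3 := (h.thomasD nab hn (w' := w - 1) rfl).ambWContr nab hn (w' := w') (by rw [hw]; ring)
  have key : ∀ (φ : atlas (Model n) M), ∀ x ∈ φ.1.source, ∀ J, ProjTractor.ambDWSharp nab V φ J x =
      ProjTractor.thomasD nab φ.1 (w - 2) (ProjTractor.ambWSharp nab V φ) J x -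
      (ProjTractor.ambWSharp nab (fun φ => ProjTractor.thomasD nab φ.1 w (V φ)) φ
        (J ∘ ![1, 2, 0, 3, 4, 5, 6]) x +
      ProjTractor.ambWContr nab (fun φ => ProjTractor.thomasD nab φ.1 w (V φ)) φ
        (J ∘ ![1, 2, 0, 3, 4, 5, 6]) x) := by
    intro φ x hx J
    obtain ⟨A, B, C, I, rfl⟩ : ∃ A B C I,
        J = Matrix.vecCons A (Matrix.vecCons B (Matrix.vecCons C I)) :=
      ⟨J 0, J 1, J 2, Fin.tail (Fin.tail (Fin.tail J)), by
        funext i; fin_cases i <;> rfl⟩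
    have e := thomasD_ambW_sharp nab hn φ.2 hx (w' := w - 2) rfl (h.smooth φ x hx) A B C I
    have e2 : Matrix.vecCons A (Matrix.vecCons B (Matrix.vecCons C I)) ∘
        ![1, 2, 0, 3, 4, 5, 6] = Matrix.vecCons B (Matrix.vecCons C (Matrix.vecCons A I)) := by
      funext i; fin_cases i <;> rfl
    have e3 : ProjTractor.ambWSharp nab (fun φ => ProjTractor.thomasD nab φ.1 w (V φ)) φ
        (Matrix.vecCons B (Matrix.vecCons C (Matrix.vecCons A I))) x = _ :=
      sharp_cons (fun H G => ambW nab φ.1 B C H G x)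
        (fun J => ProjTractor.thomasD nab φ.1 w (V φ) J x) A I
    rw [e2, e3]
    change _ = _ - (_ + ∑ H, ambW nab φ.1 B C H A x *
      ProjTractor.thomasD nab φ.1 w (V φ) (Matrix.vecCons H I) x)
    have e4 : ProjTractor.thomasD nab φ.1 (w - 2) (ProjTractor.ambWSharp nab V φ)
      (Matrix.vecCons A (Matrix.vecCons B (Matrix.vecCons C I))) x = _ := e
    rw [e4]
    change sharp (fun H G => ambDW nab φ.1 A B C H G x) (fun J => V φ J x) I = _
    ring
  have hσ : Function.Bijective (![1, 2, 0, 3, 4, 5, 6] : Fin 7 → Fin 7) := by decide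
  have h4 := h1.sub ((h2.add h3).perm hσ)
  refine ⟨fun φ x hx J => ?_, fun φ ψ x hx I => ?_⟩
  · exact (h4.smooth φ x hx J).congr (eventually_source hx fun y hy => (key φ y hy J).symm)
  · rw [key φ x hx.1, funext (key ψ x hx.2)]
    exact h4.trans φ ψ x hx I

end tractorFields

/-! ### The operator `Q` in ambient form -/

section ambientQ

variable {n : ℕ} {M : Type*} [TopologicalSpace M] [ChartedSpace (Model n) M]
  [IsManifold (𝓡 n) ∞ M] [T2Space M] (nab : AffineConnection n M)

/-- The operator `Q` written without a choice of splitting, in terms of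
`u A B D E F = X^G (W_{AB}♯l)_{DGEF}` and `v A B C D E = X^F X^G ((𝔻_A W_{BC})♯l)_{DEFG}`.
The form index of `Q_c` becomes the tractor index `C`. -/
def ambQ (u v : TIdx n → TIdx n → TIdx n → TIdx n → TIdx n → ℝ) (C D E A B : TIdx n) : ℝ :=
  sym₂ (fun A B => u C A B E D) A B + sym₂ (fun D E => u C D E A B) D E
    + sym₂ (fun A B => sym₂ (fun D E => u A D E B C - u A D B E C) D E) A B
    + 1 / 12 * (sym₂ (fun A D => v A D C B E) A D + sym₂ (fun A E => v A E C B D) A E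
      + sym₂ (fun B D => v B D C A E) B D + sym₂ (fun B E => v B E C A D) B E)
    - 1 / 6 * (sym₂ (fun A B => v A B C D E) A B + sym₂ (fun D E => v D E C A B) D E)
    - 1 / 3 * (sym₂ (fun A B => sym₂ (fun D E => v A B D E C) D E) A B
      + sym₂ (fun D E => sym₂ (fun A B => v D E A B C) A B) D E)

variable {φ : OpenPartialHomeomorph M (Model n)} {x : M}

theorem dkap_eq (a b c : Fin n) (H G : TIdx n) : dkap nab φ a b c H G x =
    ambDW nab φ (some a) (some b) (some c) H G x - 2 * gam nab φ a x * kap nab φ b c H G x -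
      gam nab φ b x * kap nab φ a c H G x - gam nab φ c x * kap nab φ b a H G x := by
  have e : pd φ a (ambW nab φ (some b) (some c) H G) x = pd φ a (kap nab φ b c H G) x := rfl
  simp only [dkap, ambDW, e, Fintype.sum_option, tgam_some_some, Gam_eq_thomasPi, ambW_some,
    ambW_none_left, ambW_none_right, mul_zero, zero_add, add_mul, Finset.sum_add_distrib, ite_mul,
    zero_mul, Finset.sum_ite_eq', Finset.mem_univ, if_true, Finset.sum_sub_distrib]
  ring

theorem dkapSharp_eq (l : (Fin 4 → TIdx n) → ℝ) (a b c : Fin n) (I : Fin 4 → TIdx n) :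
    dkapSharp nab φ x l a b c I =
      sharp (fun H G => ambDW nab φ (some a) (some b) (some c) H G x) l I -
      2 * gam nab φ a x * kapSharp nab φ x l b c I - gam nab φ b x * kapSharp nab φ x l a c I -
      gam nab φ c x * kapSharp nab φ x l b a I := by
  simp only [dkapSharp, kapSharp, dkap_eq, sharp_sub_left, sharp_smul_left]

theorem kapSharp_anti (l : (Fin 4 → TIdx n) → ℝ) (a b : Fin n) (I : Fin 4 → TIdx n) :
    kapSharp nab φ x l a b I = - kapSharp nab φ x l b a I := by
  simp only [kapSharp, sharp, kap_anti nab φ a b, neg_mul, Finset.sum_neg_distrib]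

theorem sharp_ambDW_none (l : (Fin 4 → TIdx n) → ℝ) (b c : Fin n) (I : Fin 4 → TIdx n) :
    sharp (fun H G => ambDW nab φ none (some b) (some c) H G x) l I =
      -2 * kapSharp nab φ x l b c I := by
  simp only [ambDW, sharp_smul_left, ambW_some]
  rfl

theorem sharp_ambDW_some_none (l : (Fin 4 → TIdx n) → ℝ) (a c : Fin n) (I : Fin 4 → TIdx n) :
    sharp (fun H G => ambDW nab φ (some a) none (some c) H G x) l I =
      - kapSharp nab φ x l a c I := by
  have e : ∀ c H G, pd φ a (ambW nab φ none c H G) x = 0 := fun c H G => pd_const φ a 0 x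
  have : ∀ H G, ambDW nab φ (some a) none (some c) H G x = -1 * kap nab φ a c H G x := by
    intro H G
    simp [ambDW, e, Fintype.sum_option, tgam_none_some, ambW_none_left, ambW_some]
  simp only [this, sharp_smul_left, kapSharp]
  ring

theorem ambDW_anti (A B C H G : TIdx n) :
    ambDW nab φ A B C H G x = - ambDW nab φ A C B H G x := by
  cases A with
  | none => simp only [ambDW, ambW_anti nab φ B C]; ring
  | some a =>
    have e : pd φ a (ambW nab φ B C H G) x = - pd φ a (ambW nab φ C B H G) x := by
      have : ambW nab φ B C H G = fun y => - ambW nab φ C B H G y :=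
        funext fun y => ambW_anti nab φ B C H G y
      rw [this]
      unfold pd
      have : (fun y => - ambW nab φ C B H G y) ∘ φ.symm = - (ambW nab φ C B H G ∘ φ.symm) := rfl
      rw [this, fderiv_neg]
      rfl
    have h1 : ∀ F H G, ambW nab φ F C H G x = - ambW nab φ C F H G x := fun F H G =>
      ambW_anti nab φ F C H G x
    have h2 : ∀ F H G, ambW nab φ B F H G x = - ambW nab φ F B H G x := fun F H G =>
      ambW_anti nab φ B F H G x
    simp only [ambDW, e, h1, h2, mul_neg, Finset.sum_neg_distrib, Finset.sum_sub_distrib]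
    ring

theorem sharp_ambDW_anti {r : ℕ} (l : (Fin r → TIdx n) → ℝ) (A B C : TIdx n)
    (I : Fin r → TIdx n) : sharp (fun H G => ambDW nab φ A B C H G x) l I =
      - sharp (fun H G => ambDW nab φ A C B H G x) l I := by
  simp only [sharp, ambDW_anti nab A B C, neg_mul, Finset.sum_neg_distrib]

theorem sharp_ambDW_some_some_none (l : (Fin 4 → TIdx n) → ℝ) (a b : Fin n)
    (I : Fin 4 → TIdx n) : sharp (fun H G => ambDW nab φ (some a) (some b) none H G x) l I =
      kapSharp nab φ x l a b I := by
  rw [sharp_ambDW_anti, sharp_ambDW_some_none, neg_neg]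

theorem sharp_ambDW_none_none (l : (Fin 4 → TIdx n) → ℝ) (C : TIdx n)
    (I : Fin 4 → TIdx n) : sharp (fun H G => ambDW nab φ none none C H G x) l I = 0 := by
  simp [ambDW, ambW_none_left, sharp]

theorem sharp_ambDW_some_none_none (l : (Fin 4 → TIdx n) → ℝ) (a : Fin n)
    (I : Fin 4 → TIdx n) : sharp (fun H G => ambDW nab φ (some a) none none H G x) l I = 0 := by
  have h := sharp_ambDW_anti nab l (φ := φ) (x := x) (some a) none none I
  linarith

theorem sharp_ambDW_none_right (l : (Fin 4 → TIdx n) → ℝ) (B : TIdx n)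
    (I : Fin 4 → TIdx n) : sharp (fun H G => ambDW nab φ none B none H G x) l I = 0 := by
  simp [ambDW, ambW_none_right, sharp]

theorem termN_eq (l : (Fin 4 → TIdx n) → ℝ) (c : Fin n) (A B D E : TIdx n) :
    termN nab φ x l c A B D E = - sym₂ (fun A B =>
      sharp (fun H G => ambDW nab φ A B (some c) H G x) l ![D, E, none, none]) A B := by
  have key : ∀ A B, ∑ F, ∑ G, Xt F * Xt G *
      (3 * ∑ b, Yt nab φ A x * Zt B b * kapSharp nab φ x l b c ![D, E, F, G]
      - ∑ a, ∑ b, Zt A a * Zt B b * dkapSharp nab φ x l a b c ![D, E, F, G]) =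
      3 * ∑ b, Yt nab φ A x * Zt B b * kapSharp nab φ x l b c ![D, E, none, none]
      - ∑ a, ∑ b, Zt A a * Zt B b * dkapSharp nab φ x l a b c ![D, E, none, none] := by
    intro A B
    simp [Fintype.sum_option, Xt]
  simp only [termN, sym₂, key]
  rcases A with _ | a <;> rcases B with _ | b <;>
    simp [Yt, Zt, sharp_ambDW_none, sharp_ambDW_some_none, dkapSharp_eq, sharp_ambDW_none_none]
  · ring
  · ring
  · rw [kapSharp_anti nab l b a]
    ring

theorem termR_eq {l : (Fin 4 → TIdx n) → ℝ} (c : Fin n) (A B D E : TIdx n)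
    (hl : ∀ T : TIdx n → TIdx n → ℝ, ∀ E, sharp T l ![E, none, none, none] = 0) :
    termR nab φ x l c A B D E = - sym₂ (fun A B => sym₂ (fun D E =>
      sharp (fun H G => ambDW nab φ A B D H G x) l ![E, some c, none, none]) D E) A B := by
  have hk : ∀ a b E, kapSharp nab φ x l a b ![E, none, none, none] = 0 := fun _ _ _ => hl _ _
  have hdk : ∀ e a b E, dkapSharp nab φ x l e a b ![E, none, none, none] = 0 :=
    fun _ _ _ _ => hl _ _
  have key : ∀ A B D E, ∑ F, ∑ G, ∑ C, Xt F * Xt G * Wt nab φ C c x *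
    (3 * ∑ b, ∑ d, Yt nab φ A x * Zt B b * Zt D d * kapSharp nab φ x l b d ![E, C, F, G]
      - ∑ a, ∑ b, ∑ d, Zt A a * Zt B b * Zt D d * dkapSharp nab φ x l a b d ![E, C, F, G]) =
    (3 * ∑ b, ∑ d, Yt nab φ A x * Zt B b * Zt D d * kapSharp nab φ x l b d ![E, some c, none, none]
      - ∑ a, ∑ b, ∑ d, Zt A a * Zt B b * Zt D d *
        dkapSharp nab φ x l a b d ![E, some c, none, none]) := by
    intro A B D E
    simp [Fintype.sum_option, Xt, Wt, hk, hdk]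
  have key2 : ∀ A B D E, ((3 * ∑ b, ∑ d, Yt nab φ A x * Zt B b * Zt D d *
      kapSharp nab φ x l b d ![E, some c, none, none] - ∑ a, ∑ b, ∑ d, Zt A a * Zt B b * Zt D d *
        dkapSharp nab φ x l a b d ![E, some c, none, none]) +
      (3 * ∑ b, ∑ d, Yt nab φ B x * Zt A b * Zt D d *
      kapSharp nab φ x l b d ![E, some c, none, none] - ∑ a, ∑ b, ∑ d, Zt B a * Zt A b * Zt D d *
        dkapSharp nab φ x l a b d ![E, some c, none, none])) =
      -(sharp (fun H G => ambDW nab φ A B D H G x) l ![E, some c, none, none] +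
      sharp (fun H G => ambDW nab φ B A D H G x) l ![E, some c, none, none]) := by
    intro A B D E
    rcases A with _ | a <;> rcases B with _ | b <;> rcases D with _ | d <;>
    simp [Yt, Zt, sharp_ambDW_none, sharp_ambDW_some_none, dkapSharp_eq, sharp_ambDW_none_none,
      sharp_ambDW_none_right, sharp_ambDW_some_some_none, sharp_ambDW_some_none_none]
    · ring
    · ring
    · rw [kapSharp_anti nab l b a]
      ring
    · rw [kapSharp_anti nab l b a]
      ring
  simp only [termR, sym₂, key]
  linear_combination (1 / 4) * key2 A B D E + (1 / 4) * key2 A B E D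

end ambientQ

/-! ### Young symmetries -/

section young

variable {n : ℕ} {l : (Fin 4 → TIdx n) → ℝ}

theorem cons_comp_swap₀₁ (D E A B : TIdx n) : ![D, E, A, B] ∘ Equiv.swap 0 1 = ![E, D, A, B] := by
  funext i; fin_cases i <;> rfl

theorem cons_comp_swap₂₃ (D E A B : TIdx n) : ![D, E, A, B] ∘ Equiv.swap 2 3 = ![D, E, B, A] := by
  funext i; fin_cases i <;> rfl

theorem cons_comp_swap₀₂ (D E A B : TIdx n) : ![D, E, A, B] ∘ Equiv.swap 0 2 = ![A, E, D, B] := by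
  funext i; fin_cases i <;> rfl

theorem cons_comp_swap₁₃ (D E A B : TIdx n) : ![D, E, A, B] ∘ Equiv.swap 1 3 = ![D, B, A, E] := by
  funext i; fin_cases i <;> rfl

theorem eta₄ (I : Fin 4 → TIdx n) : I = ![I 0, I 1, I 2, I 3] := by
  funext i; fin_cases i <;> rfl

/-- The Young symmetriser written out. -/
theorem youngP_cons (l : (Fin 4 → TIdx n) → ℝ) (D E A B : TIdx n) : youngP l ![D, E, A, B] =
    (1 / 16) * (l ![D, E, A, B] - l ![D, B, A, E] - l ![A, E, D, B] + l ![A, B, D, E]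
      + l ![E, D, A, B] - l ![E, B, A, D] - l ![A, D, E, B] + l ![A, B, E, D]
      + l ![D, E, B, A] - l ![D, A, B, E] - l ![B, E, D, A] + l ![B, A, D, E]
      + l ![E, D, B, A] - l ![E, A, B, D] - l ![B, D, E, A] + l ![B, A, E, D]) := by
  simp only [youngP, symAt, skewAt, cons_comp_swap₀₁, cons_comp_swap₂₃, cons_comp_swap₀₂,
    cons_comp_swap₁₃]
  ring

theorem hasYoung22_youngP (l : (Fin 4 → TIdx n) → ℝ) : HasYoung22 (youngP l) where
  symm₁ D E A B := by rw [youngP_cons, youngP_cons]; ring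
  symm₂ D E A B := by rw [youngP_cons, youngP_cons]; ring
  bianchi D E A B := by rw [youngP_cons, youngP_cons, youngP_cons]; ring

theorem HasYoung22.pair (h : HasYoung22 l) (D E A B : TIdx n) :
    l ![D, E, A, B] = l ![A, B, D, E] := by
  linear_combination
    -(1 / 2) * h.bianchi A B D E - (1 / 2) * h.bianchi A E B D + (1 / 2) * h.bianchi A E D B
    + (1 / 2) * h.bianchi B D E A - (1 / 2) * h.symm₁ A B E D + (1 / 2) * h.symm₁ D E A B
    - (1 / 2) * h.symm₂ A B D E + (1 / 2) * h.symm₂ A E B D + (1 / 2) * h.symm₂ B D A E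
    + (1 / 2) * h.symm₂ D A B E + (1 / 2) * h.symm₂ D E A B + (1 / 2) * h.symm₂ E B A D

theorem HasYoung22.youngP_eq (h : HasYoung22 l) : youngP l = fun I => 3 / 4 * l I := by
  funext I
  rw [eta₄ I, youngP_cons]
  generalize I 0 = D, I 1 = E, I 2 = A, I 3 = B
  linear_combination
    -(1 / 16) * h.bianchi A B D E - (1 / 16) * h.bianchi A B E D - (1 / 8) * h.bianchi A D E B
    + (1 / 8) * h.pair A B D E + (1 / 16) * h.pair A D E B + (1 / 16) * h.pair A E D B
    + (1 / 16) * h.pair B A D E + (3 / 16) * h.pair B A E D + (1 / 8) * h.symm₁ A B E D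
    - (1 / 8) * h.symm₁ A E D B - (1 / 16) * h.symm₁ D E A B - (1 / 4) * h.symm₁ D E B A
    + (1 / 16) * h.symm₂ B D A E + (1 / 16) * h.symm₂ B E A D - (3 / 8) * h.symm₂ D E A B

theorem HasYoung22.none₃ (h : HasYoung22 l) (E : TIdx n) : l ![E, none, none, none] = 0 := by
  have h1 := h.bianchi none none none E
  have h2 := h.pair none none none E
  have h3 := h.symm₁ none E none none
  linarith

theorem HasYoung22.add {l' : (Fin 4 → TIdx n) → ℝ} (h : HasYoung22 l) (h' : HasYoung22 l') :
    HasYoung22 (fun I => l I + l' I) where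
  symm₁ D E A B := by rw [h.symm₁, h'.symm₁]
  symm₂ D E A B := by rw [h.symm₂, h'.symm₂]
  bianchi D E A B := by linear_combination h.bianchi D E A B + h'.bianchi D E A B

/-- Endomorphisms preserve Young symmetries. -/
theorem HasYoung22.sharp (h : HasYoung22 l) (T : TIdx n → TIdx n → ℝ) :
    HasYoung22 (sharp T l) where
  symm₁ D E A B := by
    have e : (fun J => l (J ∘ Equiv.swap 0 1)) = l := funext fun J => by
      rw [eta₄ J, cons_comp_swap₀₁]; exact (h.symm₁ _ _ _ _).symm
    rw [← cons_comp_swap₀₁, ← sharp_perm, e]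
  symm₂ D E A B := by
    have e : (fun J => l (J ∘ Equiv.swap 2 3)) = l := funext fun J => by
      rw [eta₄ J, cons_comp_swap₂₃]; exact (h.symm₂ _ _ _ _).symm
    rw [← cons_comp_swap₂₃, ← sharp_perm, e]
  bianchi D E A B := by
    let σ : Equiv.Perm (Fin 4) := Equiv.swap 0 2 * Equiv.swap 0 1
    let τ : Equiv.Perm (Fin 4) := Equiv.swap 0 1 * Equiv.swap 0 2
    have e1 : ∀ D E A B : TIdx n, ![D, E, A, B] ∘ σ =
        ![E, A, D, B] := fun D E A B => by funext i; fin_cases i <;> rfl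
    have e2 : ∀ D E A B : TIdx n, ![D, E, A, B] ∘ τ =
        ![A, D, E, B] := fun D E A B => by funext i; fin_cases i <;> rfl
    rw [← e1 D E A B, ← e2 D E A B, ← sharp_perm, ← sharp_perm, ← sharp_add_right,
      ← sharp_add_right]
    have e : (fun J => l J + l (J ∘ σ) +
        l (J ∘ τ)) = fun _ => 0 := funext fun J => by
      rw [eta₄ J, e1, e2]; exact h.bianchi _ _ _ _
    rw [e]
    simp [ProjTractor.sharp]

end young

section ambQ

variable {n : ℕ} {u v : TIdx n → TIdx n → TIdx n → TIdx n → TIdx n → ℝ}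

theorem hasYoung22_ambQ (hu : ∀ X Y i j k, u X Y i j k = u X Y i k j)
    (huc : ∀ X Y i j k, u X Y i j k + u X Y j k i + u X Y k i j = 0)
    (hua : ∀ X Y i j k, u X Y i j k + u Y X i j k = 0)
    (hv : ∀ X Y Z i j, v X Y Z i j = v X Y Z j i)
    (hva : ∀ X Y Z i j, v X Y Z i j + v X Z Y i j = 0)
    (hvb : ∀ X Y Z i j, v X Y Z i j + v Y Z X i j + v Z X Y i j = 0) (C : TIdx n) :
    HasYoung22 fun I => ambQ u v C (I 0) (I 1) (I 2) (I 3) where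
  symm₁ D E A B := by
    change ambQ u v C D E A B = ambQ u v C E D A B
    simp only [ambQ, sym₂]
    linear_combination -(1 / 2) * hu C A B D E - (1 / 2) * hu C B A D E - (1 / 12) * hv A B C D E
      - (1 / 12) * hv B A C D E
  symm₂ D E A B := by
    change ambQ u v C D E A B = ambQ u v C D E B A
    simp only [ambQ, sym₂]
    linear_combination (1 / 2) * hu C D E A B + (1 / 2) * hu C E D A B - (1 / 12) * hv D E C A B
      - (1 / 12) * hv E D C A B
  bianchi D E A B := by
    change ambQ u v C D E A B + ambQ u v C E A D B + ambQ u v C A D E B = 0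
    simp only [ambQ, sym₂]
    linear_combination
      (1 / 2) * hu A C D B E + (1 / 4) * hu A D C B E - (1 / 4) * hu A D E B C
      - (1 / 2) * hu C E A B D + (1 / 4) * hu D A C B E - (1 / 4) * hu D A E B C
      - (1 / 2) * hu D C E A B - (1 / 2) * hua A C D B E + (1 / 2) * hua A C D E B
      + (1 / 4) * hua A D C E B + (1 / 2) * hua A D E B C - (1 / 4) * hua A E B D C
      + (1 / 4) * hua A E D B C + (1 / 2) * hua C D E A B - (1 / 2) * hua C D E B A
      + (1 / 4) * hua D E A B C - (1 / 4) * hua D E B A C - (1 / 4) * huc A D B E C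
      + (1 / 2) * huc C A B E D + (1 / 2) * huc C B A E D + (1 / 2) * huc C D A E B
      + (1 / 2) * huc C E A B D - (1 / 4) * huc D A B E C - (1 / 24) * hv A B C D E
      + (1 / 12) * hv A B E C D + (1 / 12) * hv A D C B E + (1 / 12) * hv A E C B D
      - (1 / 24) * hv B A C D E + (1 / 24) * hv B D C A E + (1 / 12) * hv B E A C D
      - (1 / 24) * hv B E C A D + (1 / 12) * hv D A C B E + (1 / 24) * hv D B C A E
      - (1 / 12) * hv D E C A B + (1 / 12) * hv E A B C D + (1 / 12) * hv E A C B D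
      - (1 / 24) * hv E B C A D - (1 / 12) * hv E D C A B - (1 / 12) * hva B D E A C
      - (1 / 12) * hva D B E A C - (1 / 12) * hva E B D A C - (1 / 12) * hvb A B D E C
      - (1 / 12) * hvb A B E C D - (1 / 12) * hvb A D B E C - (1 / 12) * hvb A D E B C
      - (1 / 12) * hvb A E B D C - (1 / 12) * hvb A E D B C

end ambQ

/-! ### Formal identities for the prolongation -/

section formal

variable {n : ℕ}

/-- The linear algebra behind the prolongation of the Killing equation.  Here `T` stands for
`𝔻𝔻𝔻K`, `Q A B C D E` for `W_{AB}^H_C 𝔻_D K_{HE}` and `S E A B C D` for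
`(𝔻_E W_{AB}^H_C) K_{HD}`; the hypotheses are the symmetries, the Killing equation, the
commutation rules of Thomas operators and the Bianchi identities. -/
theorem youngP_eq_ambQ {T Q S : TIdx n → TIdx n → TIdx n → TIdx n → TIdx n → ℝ}
    (hT : ∀ C D E A B, T C D E A B = T C D E B A)
    (hK : ∀ C D E A B, T C D E A B + T C D A B E + T C D B E A = 0)
    (h1 : ∀ C D E A B, T C D E A B - T D C E A B =
      Q C D E A B + Q C D E B A - Q C D A E B - Q C D B E A)
    (h2 : ∀ C D E A B, T C D E A B - T C E D A B =
      -(S C D E A B + S C D E B A + Q D E A C B + Q D E B C A))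
    (hQa : ∀ A B C D E, Q A B C D E + Q B A C D E = 0)
    (hQb : ∀ A B C D E, Q A B C D E + Q B C A D E + Q C A B D E = 0)
    (hSa : ∀ E A B C D, S E A B C D + S E B A C D = 0)
    (hSb : ∀ E A B C D, S E A B C D + S E B C A D + S E C A B D = 0)
    (hSc : ∀ E A B C D, S E A B C D + S A B E C D + S B E A C D = 0) (C D E A B : TIdx n) :
    youngP (fun J => T C (J 0) (J 1) (J 2) (J 3)) ![D, E, A, B] =
      ambQ (fun X Y i j k => 3 / 4 * (Q X Y i j k + Q X Y i k j - Q X Y j i k - Q X Y k i j))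
        (fun X Y Z i j => -3 / 2 * (S X Y Z i j + S X Y Z j i + Q Y Z X i j + Q Y Z X j i))
        C D E A B := by
  rw [youngP_cons]
  simp only [ambQ, sym₂, Matrix.cons_val]
  -- Both sides are linear in `T`, `Q`, `S`; the coefficients solve the linear system that
  -- expresses their difference through the instances of the hypotheses.
  linear_combination
    (1 / 4) * h1 A C B D E + (1 / 16) * h1 A C D E B + (1 / 16) * h1 A C E D B
    - (1 / 4) * h1 A D B E C - (1 / 16) * h1 A D C E B - (3 / 16) * h1 A E B C D
    - (1 / 16) * h1 A E B D C - (1 / 8) * h1 A E C B D - (1 / 8) * h1 B A C D E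
    + (1 / 8) * h1 B A C E D - (3 / 16) * h1 B C D A E - (3 / 16) * h1 B C E D A
    - (1 / 8) * h1 B D A E C - (1 / 16) * h1 B D C A E + (1 / 8) * h1 B D E A C
    + (1 / 16) * h1 B E C D A + (1 / 4) * h1 B E D C A + (3 / 8) * h1 C A B D E
    + (1 / 8) * h1 C B A E D - (1 / 4) * h1 C B D A E - (1 / 4) * h1 C B E D A
    + (3 / 8) * h1 C D E B A - (1 / 16) * h1 C E B D A + (3 / 8) * h1 C E D A B
    - (1 / 8) * h1 D A B E C + (1 / 8) * h1 D B E A C + (1 / 16) * h1 D C A B E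
    + (1 / 16) * h1 D C B E A - (1 / 8) * h1 D C E A B + (3 / 8) * h1 D C E B A
    + (1 / 8) * h1 D E B A C - (1 / 8) * h1 D E B C A - (1 / 16) * h1 E A B C D
    + (1 / 8) * h1 E A D B C - (1 / 16) * h1 E A D C B + (1 / 8) * h1 E B D C A
    + (1 / 16) * h1 E C A B D + (1 / 4) * h1 E C D A B - (1 / 8) * h2 A B C D E
    - (1 / 8) * h2 A B D C E - (1 / 8) * h2 A B E C D - (1 / 16) * h2 A C E B D
    - (1 / 8) * h2 A D B C E + (1 / 8) * h2 A D B E C + (1 / 16) * h2 A D C E B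
    - (3 / 16) * h2 B A C D E - (1 / 8) * h2 B A D E C - (1 / 8) * h2 B A E C D
    - (3 / 16) * h2 B C A D E + (1 / 8) * h2 B C A E D - (1 / 16) * h2 B C D A E
    - (1 / 16) * h2 B C E D A - (1 / 16) * h2 C A B D E + (1 / 16) * h2 C A B E D
    - (1 / 16) * h2 C A E D B - (1 / 16) * h2 C D B A E + (1 / 16) * h2 C D B E A
    - (1 / 16) * h2 C E A D B + (1 / 16) * h2 D A C E B + (1 / 16) * h2 D B C A E
    - (1 / 8) * h2 D E A C B - (1 / 8) * h2 D E B A C - (1 / 8) * h2 D E C A B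
    + (1 / 16) * h2 E A C B D - (1 / 8) * h2 E A D B C + (1 / 8) * h2 E A D C B
    + (1 / 16) * h2 E B C A D - (1 / 8) * h2 E D A B C - (1 / 8) * h2 E D B C A
    - (1 / 8) * h2 E D C B A + (1 / 8) * hK A B C E D + (1 / 16) * hK A E B D C
    + (1 / 8) * hK B A C D E - (1 / 8) * hK B E A C D - (1 / 8) * hK D A B E C
    - (1 / 8) * hK D B A E C + (1 / 8) * hK D E A B C - (1 / 8) * hK E A B C D
    - (1 / 16) * hK E A B D C + (1 / 8) * hK E D A C B + (1 / 16) * hQa A C D B E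
    - (1 / 8) * hQa A D B C E + (1 / 8) * hQa A D C B E + (1 / 8) * hQa A D C E B
    - (1 / 8) * hQa A D E C B + (1 / 16) * hQa A E C D B + (1 / 16) * hQa C D A B E
    + (1 / 16) * hQa C D E B A + (1 / 16) * hQa C E A B D - (1 / 16) * hQa C E B D A
    + (1 / 16) * hQa C E D A B + (1 / 8) * hQa C E D B A + (1 / 16) * hQb A C E B D
    + (1 / 16) * hQb A E C B D + (1 / 16) * hSa A B E C D + (1 / 16) * hSa A C E B D
    + (1 / 16) * hSa B A C D E + (1 / 16) * hSa B C D A E + (1 / 16) * hSa B C D E A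
    + (1 / 16) * hSa B C E D A + (1 / 16) * hSa C A E B D + (1 / 16) * hSa E A B C D
    - (1 / 16) * hSa E A C D B + (1 / 16) * hSb B A C E D + (1 / 16) * hSb B A E C D
    - (1 / 16) * hSc A B E C D + (1 / 16) * hSc A C E D B - (1 / 16) * hSc A E B C D
    + (1 / 16) * hSc A E C D B - (1 / 8) * hT A B D C E + (1 / 8) * hT A B E C D
    + (1 / 16) * hT A C E B D + (1 / 8) * hT A E D B C + (1 / 8) * hT B E D A C
    - (1 / 16) * hT C D E A B - (1 / 16) * hT C E B A D - (1 / 16) * hT C E D A B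
    + (1 / 8) * hT D A C B E - (1 / 8) * hT D B E A C - (1 / 16) * hT D C A B E
    + (1 / 16) * hT D C B A E - (1 / 8) * hT D E A B C - (1 / 8) * hT E A C B D
    - (1 / 16) * hT E B C A D + (1 / 16) * hT E C B A D + (1 / 8) * hT E C D A B

section zeros

variable {u v : TIdx n → TIdx n → TIdx n → TIdx n → TIdx n → ℝ}
  {U : TIdx n → TIdx n → TIdx n → TIdx n → ℝ}

/-- The form index of `Q` is a form index: the `X`-component vanishes. -/
theorem ambQ_none (hu₀ : ∀ Y i j k, u none Y i j k = 0)
    (huX : ∀ A D E B, u A D E B none = u A D B E none)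
    (hv₃ : ∀ A B i j, v A B none i j + v B A none i j = 0)
    (hvX : ∀ X Y Z i, v X Y Z i none = 0) (D E A B : TIdx n) : ambQ u v none D E A B = 0 := by
  simp only [ambQ, sym₂, hu₀, hvX]
  linear_combination (1 / 24) * (hv₃ A D B E + hv₃ A E B D + hv₃ B D A E + hv₃ B E A D)
    - (1 / 12) * (hv₃ A B D E + hv₃ D E A B)
    + (1 / 4) * (huX A D E B + huX A E D B + huX B D E A + huX B E D A)

/-- The double contraction of `Q` with the canonical tractor vanishes: `X^D X^E Q = 0`. -/
theorem ambQ_none_none (hu₁ : ∀ Y i j k, u none Y i j k = 0)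
    (hu₂ : ∀ X i j k, u X none i j k = 0)
    (hu₄ : ∀ X Y i k, u X Y i none k = -(1 / 2) * u X Y none i k)
    (huz : ∀ X Y k, u X Y none none k = 0) (huz' : ∀ X Y k, u X Y none k none = 0)
    (hv₁ : ∀ Y Z i j, v none Y Z i j = -2 * u Y Z none i j)
    (hv₂ : ∀ X Z i j, v X none Z i j = - u X Z none i j)
    (hv₃ : ∀ X Y i j, v X Y none i j = u X Y none i j)
    (hv₄ : ∀ X Y Z j, v X Y Z none j = 0)
    (A B C : TIdx n) : ambQ u v A none none B C = 0 := by
  simp only [ambQ, sym₂, hv₁, hv₂, hv₃, hv₄, hu₁, hu₂, huz, huz', hu₄]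
  ring

/-- The Young projection of `X^D Q_{CDEAB}` over the remaining four indices vanishes. -/
theorem youngP_ambQ (hu₂ : ∀ X i j k, u X none i j k = 0)
    (hu₄ : ∀ X Y i k, u X Y i none k = -(1 / 2) * u X Y none i k)
    (hu₅ : ∀ X Y i j, u X Y i j none = -(1 / 2) * u X Y none i j)
    (hU : ∀ X Y i j, u X Y none i j = -(U X Y i j + U X Y j i))
    (hUa : ∀ X Y i j, U X Y i j + U Y X i j = 0)
    (hUb : ∀ X Y i j, U X Y i j + U Y i X j + U i X Y j = 0)
    (hv₁ : ∀ Y Z i j, v none Y Z i j = -2 * u Y Z none i j)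
    (hv₂ : ∀ X Z i j, v X none Z i j = - u X Z none i j)
    (hv₃ : ∀ X Y i j, v X Y none i j = u X Y none i j)
    (hv₄ : ∀ X Y Z j, v X Y Z none j = 0) (hv₅ : ∀ X Y Z i, v X Y Z i none = 0)
    (I : Fin 4 → TIdx n) : youngP (fun J => ambQ u v (J 0) none (J 1) (J 2) (J 3)) I = 0 := by
  rw [eta₄ I, youngP_cons]
  generalize I 0 = D, I 1 = E, I 2 = A, I 3 = B
  simp only [ambQ, sym₂, Matrix.cons_val, hv₁, hv₂, hv₃, hv₄, hv₅, hu₂, hu₄, hu₅, hU]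
  linear_combination
    -(1 / 16) * hUa A B D E - (1 / 16) * hUa A B E D + (1 / 48) * hUa B D E A
    + (1 / 48) * hUa B E D A - (1 / 16) * hUa D E A B - (1 / 24) * hUa D E B A
    + (1 / 48) * hUb A B D E + (1 / 48) * hUb A B E D + (1 / 48) * hUb A D B E
    + (1 / 48) * hUb A D E B + (1 / 48) * hUb A E B D + (1 / 48) * hUb A E D B

end zeros

end formal

/-! ### The curvature terms of `Q` -/

section curvatureTerms

variable {n : ℕ} {M : Type*} [TopologicalSpace M] [ChartedSpace (Model n) M]
  [IsManifold (𝓡 n) ∞ M] [T2Space M] (nab : AffineConnection n M)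

/-- The contraction `X^G (W_{XY}♯l)_{iGjk}`. -/
def tracU (φ : OpenPartialHomeomorph M (Model n)) (x : M) (l : (Fin 4 → TIdx n) → ℝ)
    (X Y i j k : TIdx n) : ℝ := sharp (fun H G => ambW nab φ X Y H G x) l ![i, none, j, k]

/-- The contraction `X^F X^G ((𝔻_X W_{YZ})♯l)_{ijFG}`. -/
def tracV (φ : OpenPartialHomeomorph M (Model n)) (x : M) (l : (Fin 4 → TIdx n) → ℝ)
    (X Y Z i j : TIdx n) : ℝ := sharp (fun H G => ambDW nab φ X Y Z H G x) l ![i, j, none, none]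

/-- The expression `W_{XY}^H_i X^F X^G l_{FGHj}`. -/
def tracT (φ : OpenPartialHomeomorph M (Model n)) (x : M) (l : (Fin 4 → TIdx n) → ℝ)
    (X Y i j : TIdx n) : ℝ := ∑ H, ambW nab φ X Y H i x * l ![none, none, H, j]

variable {φ : OpenPartialHomeomorph M (Model n)} {x : M} {l : (Fin 4 → TIdx n) → ℝ}

theorem ambDW_none_mid (X Z H G : TIdx n) :
    ambDW nab φ X none Z H G x = - ambW nab φ X Z H G x := by
  cases X with
  | none => simp [ambDW, ambW_none_left]
  | some a =>
    have e : pd φ a (ambW nab φ none Z H G) x = 0 := pd_const φ a 0 x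
    simp [ambDW, e, Fintype.sum_option, tgam_none_some, ambW_none_left, tgam_none_none]

theorem tracU_none_left (l : (Fin 4 → TIdx n) → ℝ) (Y i j k : TIdx n) :
    tracU nab φ x l none Y i j k = 0 := by
  simp [tracU, sharp, ambW_none_left]

theorem tracU_none_right (l : (Fin 4 → TIdx n) → ℝ) (X i j k : TIdx n) :
    tracU nab φ x l X none i j k = 0 := by
  simp [tracU, sharp, ambW_none_right]

theorem tracU_anti (l : (Fin 4 → TIdx n) → ℝ) (X Y i j k : TIdx n) :
    tracU nab φ x l X Y i j k + tracU nab φ x l Y X i j k = 0 := by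
  simp only [tracU, sharp, ambW_anti nab φ X Y, neg_mul, Finset.sum_neg_distrib]
  ring

theorem tracU_symm (hl : HasYoung22 l) (X Y i j k : TIdx n) :
    tracU nab φ x l X Y i j k = tracU nab φ x l X Y i k j :=
  (hl.sharp _).symm₂ _ _ _ _

theorem tracU_cyc (hl : HasYoung22 l) (X Y i j k : TIdx n) :
    tracU nab φ x l X Y i j k + tracU nab φ x l X Y j k i + tracU nab φ x l X Y k i j = 0 := by
  have h := hl.sharp (fun H G => ambW nab φ X Y H G x)
  unfold tracU
  linear_combination h.bianchi j k i none + h.pair i none j k + h.pair j none k i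
    + h.pair k none i j

theorem tracU_mid_none (hl : HasYoung22 l) (X Y i k : TIdx n) :
    tracU nab φ x l X Y i none k = -(1 / 2) * tracU nab φ x l X Y none i k := by
  have h := hl.sharp (fun H G => ambW nab φ X Y H G x)
  have h1 := tracU_cyc nab hl (φ := φ) (x := x) X Y i none k
  have h2 := tracU_symm nab hl (φ := φ) (x := x) X Y k i none
  have h3 : tracU nab φ x l X Y k none i = tracU nab φ x l X Y i none k := by
    unfold tracU
    rw [h.pair, h.symm₁, h.symm₂]
  have h4 := tracU_symm nab hl (φ := φ) (x := x) X Y none k i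
  linarith

theorem tracU_right_none (hl : HasYoung22 l) (X Y i j : TIdx n) :
    tracU nab φ x l X Y i j none = -(1 / 2) * tracU nab φ x l X Y none i j := by
  rw [tracU_symm nab hl, tracU_mid_none nab hl]

theorem tracU_none_none (hl : HasYoung22 l) (X Y k : TIdx n) :
    tracU nab φ x l X Y none none k = 0 := by
  have := tracU_mid_none nab hl (φ := φ) (x := x) X Y none k
  linarith

theorem tracU_none_none' (hl : HasYoung22 l) (X Y k : TIdx n) :
    tracU nab φ x l X Y none k none = 0 := by
  rw [tracU_symm nab hl, tracU_none_none nab hl]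

theorem tracV_symm (hl : HasYoung22 l) (X Y Z i j : TIdx n) :
    tracV nab φ x l X Y Z i j = tracV nab φ x l X Y Z j i :=
  (hl.sharp _).symm₁ _ _ _ _

theorem tracV_anti (l : (Fin 4 → TIdx n) → ℝ) (X Y Z i j : TIdx n) :
    tracV nab φ x l X Y Z i j + tracV nab φ x l X Z Y i j = 0 := by
  unfold tracV
  rw [sharp_ambDW_anti]
  ring

theorem tracV_bianchi (hn : 2 ≤ n) (hφ : φ ∈ atlas (Model n) M) (hx : x ∈ φ.source)
    (l : (Fin 4 → TIdx n) → ℝ) (X Y Z i j : TIdx n) :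
    tracV nab φ x l X Y Z i j + tracV nab φ x l Y Z X i j + tracV nab φ x l Z X Y i j = 0 := by
  unfold tracV
  rw [← sharp_add_left, ← sharp_add_left]
  simp only [ambDW_bianchi nab hn hφ hx, sharp_zero_left]

theorem tracV_none_left (hl : HasYoung22 l) (Y Z i j : TIdx n) :
    tracV nab φ x l none Y Z i j = -2 * tracU nab φ x l Y Z none i j := by
  unfold tracU tracV
  rw [← (hl.sharp _).pair]
  simp only [ambDW, sharp_smul_left]

theorem tracV_none_mid (hl : HasYoung22 l) (X Z i j : TIdx n) :
    tracV nab φ x l X none Z i j = - tracU nab φ x l X Z none i j := by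
  unfold tracU tracV
  rw [← (hl.sharp _).pair]
  simp only [ambDW_none_mid, sharp, neg_mul, Finset.sum_neg_distrib]

theorem tracV_none_right (hl : HasYoung22 l) (X Y i j : TIdx n) :
    tracV nab φ x l X Y none i j = tracU nab φ x l X Y none i j := by
  have := tracV_anti nab l (φ := φ) (x := x) X Y none i j
  rw [tracV_none_mid nab hl] at this
  linarith

theorem tracV_last_none (hl : HasYoung22 l) (X Y Z i : TIdx n) :
    tracV nab φ x l X Y Z i none = 0 := (hl.sharp _).none₃ i

theorem tracV_snd_last_none (hl : HasYoung22 l) (X Y Z j : TIdx n) :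
    tracV nab φ x l X Y Z none j = 0 := by
  rw [tracV_symm nab hl, tracV_last_none nab hl]

theorem tracU_eq_tracT (hn : 2 ≤ n) (hφ : φ ∈ atlas (Model n) M) (hx : x ∈ φ.source)
    (hl : HasYoung22 l) (X Y i j : TIdx n) : tracU nab φ x l X Y none i j =
      -(tracT nab φ x l X Y i j + tracT nab φ x l X Y j i) := by
  unfold tracU tracT
  rw [sharp_cons, sharp_cons, sharp_cons, sharp_cons, sharp_nil]
  simp only [ambW_none_last nab hn hφ hx, zero_mul, Finset.sum_const_zero, hl.symm₂ none none i]
  ring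

theorem tracT_anti (l : (Fin 4 → TIdx n) → ℝ) (X Y i j : TIdx n) :
    tracT nab φ x l X Y i j + tracT nab φ x l Y X i j = 0 := by
  simp only [tracT, ambW_anti nab φ X Y, neg_mul, Finset.sum_neg_distrib]
  ring

theorem tracT_bianchi (hn : 2 ≤ n) (hφ : φ ∈ atlas (Model n) M) (hx : x ∈ φ.source)
    (l : (Fin 4 → TIdx n) → ℝ) (X Y i j : TIdx n) :
    tracT nab φ x l X Y i j + tracT nab φ x l Y i X j + tracT nab φ x l i X Y j = 0 := by
  simp only [tracT, ← Finset.sum_add_distrib, ← add_mul, ambW_bianchi nab hn hφ hx, zero_mul,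
    Finset.sum_const_zero]

/-- `Q` in ambient form at a point of a chart. -/
def chartQ (φ : OpenPartialHomeomorph M (Model n)) (x : M) (l : (Fin 4 → TIdx n) → ℝ)
    (C D E A B : TIdx n) : ℝ := ambQ (tracU nab φ x l) (tracV nab φ x l) C D E A B

theorem sum_Xt_Zt_kapSharp (l : (Fin 4 → TIdx n) → ℝ) (c : Fin n) (A i j k : TIdx n) :
    ∑ F, ∑ a, Xt F * Zt A a * kapSharp nab φ x l c a ![i, F, j, k] =
      tracU nab φ x l (some c) A i j k := by
  cases A with
  | none => simp [Zt, tracU_none_right]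
  | some a => simp [Zt, Xt, Fintype.sum_option]; rfl

theorem sum_Wt_kapSharp (hl : HasYoung22 l) (c : Fin n) (A B D E : TIdx n) :
    ∑ F, ∑ C, ∑ a, ∑ d, Xt F * Wt nab φ C c x * Zt A a * Zt D d *
        (kapSharp nab φ x l a d ![E, F, B, C] - kapSharp nab φ x l a d ![E, C, B, F]) =
      tracU nab φ x l A D E B (some c) - tracU nab φ x l A D B E (some c) := by
  cases A with
  | none => simp [Zt, tracU_none_left]
  | some a => cases D with
    | none => simp [Zt, tracU_none_right]
    | some d =>
      have e : tracU nab φ x l (some a) (some d) B E (some c) =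
          kapSharp nab φ x l a d ![E, some c, B, none] := ((hl.sharp _).pair _ _ _ _)
      rw [e]
      simp [Zt, Xt, Wt, Fintype.sum_option]
      rfl

/-- The operator `Q_c` is the restriction of its ambient form. -/
theorem Qalg_eq (hl : HasYoung22 l) (c : Fin n) (D E A B : TIdx n) :
    Qalg nab φ x l c D E A B = chartQ nab φ x l (some c) D E A B := by
  have hR := termR_eq nab (φ := φ) (x := x) c (hl := fun T E => (hl.sharp T).none₃ E)
  simp only [Qalg, sum_Xt_Zt_kapSharp, sum_Wt_kapSharp nab hl, termN_eq, hR, chartQ, ambQ]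
  simp only [tracV]
  ring

theorem chartQ_none (hl : HasYoung22 l) (D E A B : TIdx n) :
    chartQ nab φ x l none D E A B = 0 := by
  refine ambQ_none (tracU_none_left nab l) (fun A D E B => ?_) (fun A B i j => ?_)
    (tracV_last_none nab hl) D E A B
  · exact (hl.sharp _).pair _ _ _ _
  · rw [tracV_none_right nab hl, tracV_none_right nab hl, tracU_anti]

theorem hasYoung22_chartQ (hn : 2 ≤ n) (hφ : φ ∈ atlas (Model n) M) (hx : x ∈ φ.source)
    (hl : HasYoung22 l) (C : TIdx n) :
    HasYoung22 fun I => chartQ nab φ x l C (I 0) (I 1) (I 2) (I 3) :=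
  hasYoung22_ambQ (tracU_symm nab hl) (tracU_cyc nab hl) (tracU_anti nab l) (tracV_symm nab hl)
    (tracV_anti nab l) (tracV_bianchi nab hn hφ hx l) C

theorem chartQ_none_none (hl : HasYoung22 l) (A B C : TIdx n) :
    chartQ nab φ x l A none none B C = 0 :=
  ambQ_none_none (tracU_none_left nab l) (tracU_none_right nab l) (tracU_mid_none nab hl)
    (tracU_none_none nab hl) (tracU_none_none' nab hl) (tracV_none_left nab hl)
    (tracV_none_mid nab hl) (tracV_none_right nab hl) (tracV_snd_last_none nab hl) A B C

theorem youngP_chartQ (hn : 2 ≤ n) (hφ : φ ∈ atlas (Model n) M) (hx : x ∈ φ.source)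
    (hl : HasYoung22 l) (I : Fin 4 → TIdx n) :
    youngP (fun J => chartQ nab φ x l (J 0) none (J 1) (J 2) (J 3)) I = 0 :=
  youngP_ambQ (tracU_none_right nab l) (tracU_mid_none nab hl)
    (tracU_right_none nab hl) (tracU_eq_tracT nab hn hφ hx hl) (tracT_anti nab l)
    (tracT_bianchi nab hn hφ hx l) (tracV_none_left nab hl) (tracV_none_mid nab hl)
    (tracV_none_right nab hl) (tracV_snd_last_none nab hl) (tracV_last_none nab hl) I

variable {w : ℝ} {L : CotractorComp n M 4}

theorem isTractor_tracU (hn : 2 ≤ n) (hL : IsTractor 0 L) (a b c d e : Fin 5)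
    (h : Function.Bijective ![a, b, c, d, e]) : IsTractor (-1) (fun φ (J : Fin 5 → TIdx n) x =>
      tracU nab φ.1 x (fun K => L φ K x) (J a) (J b) (J c) (J d) (J e)) := by
  have hσ : Function.Bijective (![1, 2, 3, 0, 4, 5] : Fin 6 → Fin 6) := by decide
  have h1 := (((hL.ambWSharp nab hn (w' := -2) (by norm_num)).perm hσ).plug (w' := -1)
    (by norm_num)).perm h
  convert h1 using 3 with φ J
  have e : Matrix.vecCons none (J ∘ ![a, b, c, d, e]) ∘ ![1, 2, 3, 0, 4, 5] =
      ![J a, J b, J c, none, J d, J e] := by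
    funext i
    fin_cases i <;> rfl
  rw [e]
  rfl

theorem isTractor_tracV (hn : 2 ≤ n) (hL : IsTractor 0 L) (a b c d e : Fin 5)
    (h : Function.Bijective ![a, b, c, d, e]) : IsTractor (-1) (fun φ (J : Fin 5 → TIdx n) x =>
      tracV nab φ.1 x (fun K => L φ K x) (J a) (J b) (J c) (J d) (J e)) := by
  have hσ : Function.Bijective (![2, 3, 4, 5, 6, 0, 1] : Fin 7 → Fin 7) := by decide
  have h1 := ((((hL.ambDWSharp nab hn (w' := -3) (by norm_num)).perm hσ).plug (w' := -2)
    (by norm_num)).plug (w' := -1) (by norm_num)).perm h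
  convert h1 using 3 with φ J
  have e : Matrix.vecCons none (Matrix.vecCons none (J ∘ ![a, b, c, d, e])) ∘
      ![2, 3, 4, 5, 6, 0, 1] = ![J a, J b, J c, J d, J e, none, none] := by
    funext i
    fin_cases i <;> rfl
  rw [e]
  rfl

theorem IsTractor.div {r : ℕ} {V : CotractorComp n M r} (h : IsTractor w V) (c : ℝ) :
    IsTractor w (fun φ J y => V φ J y / c) := by
  have := h.smul c⁻¹
  simpa only [div_eq_inv_mul] using this

theorem isTractor_ambQ {u v : atlas (Model n) M → M → TIdx n → TIdx n → TIdx n → TIdx n →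
    TIdx n → ℝ}
    (hu : ∀ a b c d e : Fin 5, Function.Bijective ![a, b, c, d, e] →
      IsTractor w (fun φ (J : Fin 5 → TIdx n) x => u φ x (J a) (J b) (J c) (J d) (J e)))
    (hv : ∀ a b c d e : Fin 5, Function.Bijective ![a, b, c, d, e] →
      IsTractor w (fun φ (J : Fin 5 → TIdx n) x => v φ x (J a) (J b) (J c) (J d) (J e))) :
    IsTractor w (fun φ (J : Fin 5 → TIdx n) x =>
      ambQ (u φ x) (v φ x) (J 0) (J 1) (J 2) (J 3) (J 4)) := by
  unfold ambQ sym₂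
  repeat' first
    | apply IsTractor.sub
    | apply IsTractor.add
    | apply IsTractor.div
    | apply IsTractor.smul
    | exact hu _ _ _ _ _ (by decide)
    | exact hv _ _ _ _ _ (by decide)

/-- The ambient form of `Q♯L` is a tractor field. -/
theorem isTractor_chartQ (hn : 2 ≤ n) (hL : IsTractor 0 L) :
    IsTractor (-1) (fun φ (J : Fin 5 → TIdx n) x =>
      chartQ nab φ.1 x (fun K => L φ K x) (J 0) (J 1) (J 2) (J 3) (J 4)) :=
  isTractor_ambQ (isTractor_tracU nab hn hL) (isTractor_tracV nab hn hL)

end curvatureTerms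

/-! ### Sections of the tractor bundles -/

section sections

variable {n : ℕ} {M : Type*} [TopologicalSpace M] [ChartedSpace (Model n) M]
  [IsManifold (𝓡 n) ∞ M] [T2Space M] (nab nab' : AffineConnection n M)
  {φ : OpenPartialHomeomorph M (Model n)} {x : M}

open Classical in
theorem contMDiffOn_ite {s : Set M} (hs : IsOpen s) {f : M → ℝ} (hf : ∀ x ∈ s, Sm n f x) :
    ContMDiffOn (𝓡 n) 𝓘(ℝ, ℝ) ∞ (fun x => if x ∈ s then f x else 0) s := by
  intro x hx
  refine ContMDiffAt.contMDiffWithinAt ((hf x hx).congr ?_)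
  filter_upwards [hs.mem_nhds hx] with y hy
  rw [if_pos hy]

theorem sm_of_contMDiffOn {s : Set M} (hs : IsOpen s) {f : M → ℝ}
    (hf : ContMDiffOn (𝓡 n) 𝓘(ℝ, ℝ) ∞ f s) (hx : x ∈ s) : Sm n f x :=
  hf.contMDiffAt (hs.mem_nhds hx)

theorem HasYoung22.smul {l : (Fin 4 → TIdx n) → ℝ} (h : HasYoung22 l) (c : ℝ) :
    HasYoung22 (fun I => c * l I) where
  symm₁ D E A B := by rw [h.symm₁]
  symm₂ D E A B := by rw [h.symm₂]
  bianchi D E A B := by linear_combination c * h.bianchi D E A B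

theorem hasYoung22_zero : HasYoung22 (fun _ : Fin 4 → TIdx n => (0 : ℝ)) :=
  ⟨fun _ _ _ _ => rfl, fun _ _ _ _ => rfl, fun _ _ _ _ => by norm_num⟩

theorem IsT22.isTractor {L : CotractorComp n M 4} (hL : IsT22 L) : IsTractor 0 L where
  smooth φ _ hx J := sm_of_contMDiffOn φ.1.open_source (hL.smooth φ J) hx
  trans φ ψ x hx I := by rw [dens_zero, one_mul]; exact hL.trans φ ψ I x hx

open Classical in
theorem isT22_of_isTractor {V : CotractorComp n M 4} (hV : IsTractor 0 V)
    (hy : ∀ φ : atlas (Model n) M, ∀ x ∈ φ.1.source, HasYoung22 fun I => V φ I x) :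
    IsT22 (fun φ I x => if x ∈ φ.1.source then V φ I x else 0) where
  young φ x := by
    by_cases hx : x ∈ φ.1.source
    · simpa only [if_pos hx] using hy φ x hx
    · simpa only [if_neg hx] using hasYoung22_zero
  smooth φ I := contMDiffOn_ite φ.1.open_source fun x hx => hV.smooth φ x hx I
  zero_off φ I x hx := if_neg hx
  trans φ ψ I x hx := by
    simp only [if_pos hx.1, if_pos hx.2]
    rw [hV.trans φ ψ x hx, dens_zero, one_mul]
    rfl

open Classical in
/-- A tractor field of weight `-1` annihilated by the contraction with `X` in the first index is
a form with values in tractors. -/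
theorem isT22Form_of_isTractor {F : CotractorComp n M 5} (hF : IsTractor (-1) F)
    (hy : ∀ φ : atlas (Model n) M, ∀ x ∈ φ.1.source, ∀ C,
      HasYoung22 fun I => F φ (Matrix.vecCons C I) x)
    (h0 : ∀ φ : atlas (Model n) M, ∀ x ∈ φ.1.source, ∀ I, F φ (Matrix.vecCons none I) x = 0) :
    IsT22Form (fun φ c I x => if x ∈ φ.1.source then F φ (Matrix.vecCons (some c) I) x else 0) where
  young φ c x := by
    by_cases hx : x ∈ φ.1.source
    · simpa only [if_pos hx] using hy φ x hx (some c)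
    · simpa only [if_neg hx] using hasYoung22_zero
  smooth φ c I := contMDiffOn_ite φ.1.open_source fun x hx => hF.smooth φ x hx _
  zero_off φ c I x hx := if_neg hx
  trans φ ψ c I x hx := by
    simp only [if_pos hx.1, if_pos hx.2]
    have hd : dens (-1) φ.1 ψ.1 x * dens 1 φ.1 ψ.1 x = 1 := by
      rw [← dens_add φ.2 ψ.2 hx.1 hx.2, neg_add_cancel, dens_zero]
    have e : tens (cotractorTrans φ.1 ψ.1 x) (fun J => F ψ (Matrix.vecCons none J) x) I = 0 := by
      simp only [h0 ψ x hx.2]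
      simp [tens]
    rw [hF.trans φ ψ x hx, tens_cons, Fintype.sum_option, e, mul_zero, zero_add, Finset.mul_sum]
    refine Finset.sum_congr rfl fun d _ => ?_
    simp only [cotractorTrans, tens, mul_assoc, ← Finset.mul_sum]
    rw [← mul_assoc, hd, one_mul]

theorem IsT22Form.sub {S S' : CotractorFormComp n M 4} (h : IsT22Form S) (h' : IsT22Form S') :
    IsT22Form (S - S') where
  young φ c x := by
    have := (h.young φ c x).add ((h'.young φ c x).smul (-1))
    change HasYoung22 fun I => S φ c I x - S' φ c I x
    simpa only [neg_one_mul, ← sub_eq_add_neg] using this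
  smooth φ c I := (h.smooth φ c I).sub (h'.smooth φ c I)
  zero_off φ c I x hx := by
    simp only [Pi.sub_apply, h.zero_off φ c I x hx, h'.zero_off φ c I x hx, sub_zero]
  trans φ ψ c I x hx := by
    simp only [Pi.sub_apply, h.trans φ ψ c I x hx, h'.trans φ ψ c I x hx, mul_sub,
      Finset.sum_sub_distrib]

/-- Young symmetries are preserved by differentiation. -/
theorem HasYoung22.thomasD (hφ : φ ∈ atlas (Model n) M) (hx : x ∈ φ.source) (w : ℝ)
    {V : (Fin 4 → TIdx n) → M → ℝ} (hV : ∀ y ∈ φ.source, ∀ J, Sm n (V J) y)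
    (hy : ∀ y ∈ φ.source, HasYoung22 fun I => V I y) (A : TIdx n) :
    HasYoung22 fun I => thomasD nab φ w V (Matrix.vecCons A I) x := by
  have e : (fun I => ProjTractor.thomasD nab φ w V (Matrix.vecCons A I) x) = fun I => 4 / 3 *
      youngP (fun J => ProjTractor.thomasD nab φ w V (Matrix.vecCons A J) x) I := by
    funext I
    rw [← thomasD_youngP nab hφ hx w (hV x hx),
      ← thomasD_smul nab hφ hx w _ (fun J => Sm.youngP (hV x hx) J)]
    refine thomasD_congr nab hx w (fun y hy' J => ?_) _
    rw [(hy y hy').youngP_eq]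
    ring
  rw [e]
  exact (hasYoung22_youngP _).smul _

theorem tractorDeriv_zero (c : Fin n) (V : (Fin 4 → TIdx n) → M → ℝ) (I : Fin 4 → TIdx n) :
    tractorDeriv nab φ 0 c V I x = thomasD nab φ 0 V (Matrix.vecCons (some c) I) x := by
  rw [tractorDeriv_eq, thomasD_some]
  ring

theorem isT22Form_tractorConn (hn : 2 ≤ n) {L : CotractorComp n M 4} (hL : IsT22 L) :
    IsT22Form (tractorConn nab L) := by
  have h := isT22Form_of_isTractor (hL.isTractor.thomasD nab hn (w' := -1) (by norm_num))
    (fun φ x hx C => HasYoung22.thomasD nab φ.2 hx 0 (hL.isTractor.smooth φ)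
      (fun y _ => hL.young φ y) C)
    (fun φ x hx I => by rw [thomasD_none, zero_mul])
  convert h using 1
  funext φ c I x
  simp only [tractorConn, tractorDeriv_zero]

theorem isT22Form_Qsharp (hn : 2 ≤ n) {L : CotractorComp n M 4} (hL : IsT22 L) :
    IsT22Form (Qsharp nab L) := by
  have h := isT22Form_of_isTractor (isTractor_chartQ nab hn hL.isTractor)
    (fun φ x hx C => hasYoung22_chartQ nab hn φ.2 hx (hL.young φ x) C)
    (fun φ x hx I => chartQ_none nab (hL.young φ x) _ _ _ _)
  convert h using 1
  funext φ c I x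
  simp only [Qsharp, Qalg_eq nab (hL.young φ x)]
  rfl

theorem ambQ_add (u u' v v' : TIdx n → TIdx n → TIdx n → TIdx n → TIdx n → ℝ)
    (C D E A B : TIdx n) : ambQ (fun X Y i j k => u X Y i j k + u' X Y i j k)
      (fun X Y Z i j => v X Y Z i j + v' X Y Z i j) C D E A B =
      ambQ u v C D E A B + ambQ u' v' C D E A B := by
  simp only [ambQ, sym₂]
  ring

theorem ambQ_smul (c : ℝ) (u v : TIdx n → TIdx n → TIdx n → TIdx n → TIdx n → ℝ)
    (C D E A B : TIdx n) : ambQ (fun X Y i j k => c * u X Y i j k)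
      (fun X Y Z i j => c * v X Y Z i j) C D E A B = c * ambQ u v C D E A B := by
  simp only [ambQ, sym₂]
  ring

theorem isT22EndForm_Qsharp (hn : 2 ≤ n) : IsT22EndForm (Qsharp nab) where
  maps L hL := isT22Form_Qsharp nab hn hL
  add L L' hL hL' := by
    funext φ c I x
    have h := (hL.young φ x).add (hL'.young φ x)
    simp only [Pi.add_apply, Qsharp]
    split_ifs with hx
    · rw [Qalg_eq nab h, Qalg_eq nab (hL.young φ x), Qalg_eq nab (hL'.young φ x), chartQ, chartQ,
        chartQ, ← ambQ_add]
      simp only [← sharp_add_right, tracU, tracV]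
      rfl
    · rw [add_zero]
  smul f L _ hL := by
    funext φ c I x
    have h := (hL.young φ x).smul (f x)
    simp only [Qsharp]
    split_ifs with hx
    · rw [Qalg_eq nab h, Qalg_eq nab (hL.young φ x), chartQ, chartQ, ← ambQ_smul]
      simp only [← sharp_smul_right, tracU, tracV]
      rfl
    · rw [mul_zero]

theorem isT22Connection_tractorConn (hn : 2 ≤ n) : IsT22Connection (tractorConn nab) where
  maps L hL := isT22Form_tractorConn nab hn hL
  add L L' hL hL' := by
    funext φ c I x
    simp only [Pi.add_apply, tractorConn]
    split_ifs with hx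
    · simp only [tractorDeriv_zero]
      exact thomasD_add nab φ.2 hx 0 (hL.isTractor.smooth φ x hx) (hL'.isTractor.smooth φ x hx) _
    · rw [add_zero]
  leibniz f L hf hL := by
    funext φ c I x
    simp only [tractorConn]
    split_ifs with hx
    · simp only [tractorDeriv_zero, thomasD_some]
      rw [pd_mul φ.2 hx hf.contMDiffAt (hL.isTractor.smooth φ x hx I), sharp_smul_right]
      ring
    · rw [hL.zero_off φ I x hx]
      ring

theorem isT22Connection_prolongConn (hn : 2 ≤ n) : IsT22Connection (prolongConn nab) where
  maps L hL := (isT22Form_tractorConn nab hn hL).sub (isT22Form_Qsharp nab hn hL)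
  add L L' hL hL' := by
    unfold prolongConn
    rw [(isT22Connection_tractorConn nab hn).add L L' hL hL',
      (isT22EndForm_Qsharp nab hn).add L L' hL hL']
    abel
  leibniz f L hf hL := by
    unfold prolongConn
    rw [(isT22Connection_tractorConn nab hn).leibniz f L hf hL,
      (isT22EndForm_Qsharp nab hn).smul f L hf hL]
    funext φ c I x
    simp only [Pi.sub_apply]
    ring

end sections

/-! ### Projective invariance -/

section invariance

variable {n r : ℕ} {M : Type*} [TopologicalSpace M] [ChartedSpace (Model n) M]
  [IsManifold (𝓡 n) ∞ M] [T2Space M] {nab nab' : AffineConnection n M}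
  {φ : OpenPartialHomeomorph M (Model n)} {x : M}

theorem ProjEquiv.thomasD_eq (h : ProjEquiv nab nab') (hn : 2 ≤ n) (hφ : φ ∈ atlas (Model n) M)
    (hx : x ∈ φ.source) (w : ℝ) (V : (Fin r → TIdx n) → M → ℝ) (I : Fin (r + 1) → TIdx n) :
    thomasD nab' φ w V I x = thomasD nab φ w V I x := by
  rw [← vecCons_eta I]
  cases I 0 with
  | none => rw [thomasD_none, thomasD_none]
  | some a => simp only [thomasD_some, h.tgam_eq hn hφ hx]

theorem ProjEquiv.kap_eq (h : ProjEquiv nab nab') (hn : 2 ≤ n) (hφ : φ ∈ atlas (Model n) M)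
    (hx : x ∈ φ.source) (a b : Fin n) (H G : TIdx n) :
    kap nab' φ a b H G x = kap nab φ a b H G x := by
  have e : ∀ a b A B, pd φ a (tgam nab' φ b A B) x = pd φ a (tgam nab φ b A B) x :=
    fun a b A B => pd_congr hx (eventually_source hx fun y hy => h.tgam_eq hn hφ hy b A B) a
  simp only [kap, e, h.tgam_eq hn hφ hx]

theorem ProjEquiv.ambW_eq (h : ProjEquiv nab nab') (hn : 2 ≤ n) (hφ : φ ∈ atlas (Model n) M)
    (hx : x ∈ φ.source) (A B H G : TIdx n) : ambW nab' φ A B H G x = ambW nab φ A B H G x := by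
  cases A <;> cases B <;> try rfl
  exact h.kap_eq hn hφ hx _ _ H G

theorem ProjEquiv.ambDW_eq (h : ProjEquiv nab nab') (hn : 2 ≤ n) (hφ : φ ∈ atlas (Model n) M)
    (hx : x ∈ φ.source) (A B C H G : TIdx n) :
    ambDW nab' φ A B C H G x = ambDW nab φ A B C H G x := by
  have e : ∀ a B C H G, pd φ a (ambW nab' φ B C H G) x = pd φ a (ambW nab φ B C H G) x :=
    fun a B C H G => pd_congr hx (eventually_source hx fun y hy => h.ambW_eq hn hφ hy B C H G) a
  cases A <;> simp only [ambDW, e, h.ambW_eq hn hφ hx, h.tgam_eq hn hφ hx]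

theorem ProjEquiv.tractorConn_eq (h : ProjEquiv nab nab') (hn : 2 ≤ n) (L : CotractorComp n M 4) :
    tractorConn nab L = tractorConn nab' L := by
  funext φ c I x
  simp only [tractorConn]
  split_ifs with hx
  · rw [tractorDeriv_zero, tractorDeriv_zero, h.thomasD_eq hn φ.2 hx]
  · rfl

theorem ProjEquiv.Qsharp_eq (h : ProjEquiv nab nab') (hn : 2 ≤ n) {L : CotractorComp n M 4}
    (hL : IsT22 L) : Qsharp nab L = Qsharp nab' L := by
  funext φ c I x
  simp only [Qsharp]
  split_ifs with hx
  · have e : ∀ l, tracU nab' φ.1 x l = tracU nab φ.1 x l := fun l => by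
      funext X Y i j k
      simp only [tracU, h.ambW_eq hn φ.2 hx]
    have e' : ∀ l, tracV nab' φ.1 x l = tracV nab φ.1 x l := fun l => by
      funext X Y i j k
      simp only [tracV, h.ambDW_eq hn φ.2 hx]
    rw [Qalg_eq nab (hL.young φ x), Qalg_eq nab' (hL.young φ x), chartQ, chartQ, e, e']
  · rfl

theorem ProjEquiv.splitting_eq (h : ProjEquiv nab nab') (hn : 2 ≤ n) (k : TensorComp n M 2) :
    splitting nab k = splitting nab' k := by
  funext φ I x
  simp only [splitting]
  split_ifs with hx
  · congr 1
    funext J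
    rw [h.thomasD_eq hn φ.2 hx]
    exact thomasD_congr nab hx 1 (fun y hy J => (h.thomasD_eq hn φ.2 hy 2 _ J).symm) J
  · rfl

/-- The Killing operator is the symmetrised Thomas derivative. -/
theorem covTwo_cyc (nab : AffineConnection n M) {k : (Fin 2 → Fin n) → M → ℝ}
    (hk : ∀ a b, k ![a, b] x = k ![b, a] x) (a b c : Fin n) :
    covTwo nab φ 4 k a b c x + covTwo nab φ 4 k b c a x + covTwo nab φ 4 k c a b x =
      thomasD nab φ 2 (Kt k) ![some a, some b, some c] x +
      thomasD nab φ 2 (Kt k) ![some b, some c, some a] x +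
      thomasD nab φ 2 (Kt k) ![some c, some a, some b] x := by
  have hK : ∀ b c, Kt k ![some b, some c] = k ![b, c] := fun b c => by
    funext y; simp [Kt, Zt]
  have hK0 : ∀ B y, Kt k ![none, B] y = 0 := fun B y => by simp [Kt, Zt]
  have hK0' : ∀ B y, Kt k ![B, none] y = 0 := fun B y => by simp [Kt, Zt]
  have key : ∀ a b c, covTwo nab φ 4 k a b c x =
      thomasD nab φ 2 (Kt k) ![some a, some b, some c] x +
        (2 * gam nab φ a x * k ![b, c] x - gam nab φ b x * k ![a, c] x
          - gam nab φ c x * k ![b, a] x) := by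
    intro a b c
    rw [thomasD_some, sharp_cons, sharp_cons, sharp_nil]
    simp only [hK, Fintype.sum_option, hK0, hK0', covTwo, tgam_some_some, Gam_eq_thomasPi, add_mul,
      Finset.sum_add_distrib, ite_mul, zero_mul, Finset.sum_ite_eq', Finset.mem_univ, if_true,
      mul_zero]
    ring
  rw [key, key, key, hk c b, hk c a, hk b a]
  ring

theorem ProjEquiv.killingOp_eq (h : ProjEquiv nab nab') (hn : 2 ≤ n) {k : TensorComp n M 2}
    (hk : IsSymTwoTensor 4 k) : killingOp nab k = killingOp nab' k := by
  funext φ I x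
  simp only [killingOp]
  split_ifs with hx
  · have hs : ∀ a b, k φ ![a, b] x = k φ ![b, a] x := fun a b => hk.symm φ a b x
    rw [covTwo_cyc _ hs, covTwo_cyc _ hs]
    simp only [h.thomasD_eq hn φ.2 hx]
  · rfl

end invariance

/-! ### The splitting operator -/

section splittingOperator

variable {n : ℕ} {M : Type*} [TopologicalSpace M] [ChartedSpace (Model n) M]
  [IsManifold (𝓡 n) ∞ M] [T2Space M] (nab : AffineConnection n M)
  {φ : OpenPartialHomeomorph M (Model n)} {x : M}

theorem Kt_some (k : (Fin 2 → Fin n) → M → ℝ) (b c : Fin n) :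
    Kt k ![some b, some c] = k ![b, c] := by
  funext y; simp [Kt, Zt]

theorem Kt_none_left (k : (Fin 2 → Fin n) → M → ℝ) (B : TIdx n) (y : M) :
    Kt k ![none, B] y = 0 := by simp [Kt, Zt]

theorem Kt_none_right (k : (Fin 2 → Fin n) → M → ℝ) (B : TIdx n) (y : M) :
    Kt k ![B, none] y = 0 := by simp [Kt, Zt]

theorem Sm.Kt {k : (Fin 2 → Fin n) → M → ℝ} (hk : ∀ J, Sm n (k J) x) (I : Fin 2 → TIdx n) :
    Sm n (Kt k I) x :=
  Sm.sum fun _ _ => Sm.sum fun _ _ => (Sm.const _).mul (hk _)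

theorem IsSymTwoTensor.isTractor {k : TensorComp n M 2} (hk : IsSymTwoTensor 4 k) :
    IsTractor 2 (fun φ => Kt (k φ)) where
  smooth φ x hx J := Sm.Kt (fun I => sm_of_contMDiffOn φ.1.open_source (hk.smooth φ I) hx) J
  trans φ ψ x hx I := by
    obtain ⟨A, B, rfl⟩ : ∃ A B, I = ![A, B] := ⟨I 0, I 1, by funext i; fin_cases i <;> rfl⟩
    have hd : dens 4 φ.1 ψ.1 x = dens 2 φ.1 ψ.1 x * (dens 1 φ.1 ψ.1 x * dens 1 φ.1 ψ.1 x) := by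
      rw [← dens_add φ.2 ψ.2 hx.1 hx.2, ← dens_add φ.2 ψ.2 hx.1 hx.2]
      norm_num
    rw [tens_cons]
    simp only [tens_cons]
    have e : ∀ C D, tens (cotractorTrans φ.1 ψ.1 x) (fun J : Fin 0 → TIdx n =>
        Kt (k ψ) (Matrix.vecCons C (Matrix.vecCons D J)) x) ![] = Kt (k ψ) ![C, D] x := by
      intro C D
      simp [tens]
      rfl
    simp only [e, Fintype.sum_option, Kt_none_left, Kt_none_right, mul_zero, zero_add, Kt_some,
      Finset.sum_const_zero]
    rcases A with _ | a
    · simp [Kt_none_left, cotractorTrans]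
    rcases B with _ | b
    · simp [Kt_none_right, cotractorTrans]
    rw [Kt_some, hk.trans φ ψ _ x hx, hd, ← (finTwoArrowEquiv (Fin n)).symm.sum_comp,
      Fintype.sum_prod_type]
    simp only [finTwoArrowEquiv_symm_apply, Fin.prod_univ_two, Matrix.cons_val_zero,
      Matrix.cons_val_one, cotractorTrans, Finset.mul_sum]
    exact Finset.sum_congr rfl fun _ _ => Finset.sum_congr rfl fun _ _ => by ring

theorem IsTractor.symAt {w : ℝ} {V : CotractorComp n M 4} (h : IsTractor w V) (i j : Fin 4) :
    IsTractor w (fun φ J x => symAt i j (fun K => V φ K x) J) :=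
  (h.add (h.perm (Equiv.swap i j).bijective)).div 2

theorem IsTractor.skewAt {w : ℝ} {V : CotractorComp n M 4} (h : IsTractor w V) (i j : Fin 4) :
    IsTractor w (fun φ J x => skewAt i j (fun K => V φ K x) J) :=
  (h.sub (h.perm (Equiv.swap i j).bijective)).div 2

theorem IsTractor.youngP {w : ℝ} {V : CotractorComp n M 4} (h : IsTractor w V) :
    IsTractor w (fun φ J x => youngP (fun K => V φ K x) J) :=
  (((h.skewAt 1 3).skewAt 0 2).symAt 2 3).symAt 0 1

theorem isT22_splitting (hn : 2 ≤ n) {k : TensorComp n M 2} (hk : IsSymTwoTensor 4 k) :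
    IsT22 (splitting nab k) :=
  isT22_of_isTractor (((hk.isTractor.thomasD nab hn (w' := 1) (by norm_num)).thomasD nab hn
    (w' := 0) (by norm_num)).youngP) fun φ x _ => hasYoung22_youngP _

theorem splitting_add (hn : 2 ≤ n) {k k' : TensorComp n M 2} (hk : IsSymTwoTensor 4 k)
    (hk' : IsSymTwoTensor 4 k') :
    splitting nab (k + k') = splitting nab k + splitting nab k' := by
  funext φ I x
  simp only [splitting, Pi.add_apply]
  split_ifs with hx
  · have e : ∀ J, thomasD nab φ.1 1 (thomasD nab φ.1 2 (Kt (k φ + k' φ))) J x =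
        thomasD nab φ.1 1 (thomasD nab φ.1 2 (Kt (k φ))) J x +
        thomasD nab φ.1 1 (thomasD nab φ.1 2 (Kt (k' φ))) J x := by
      intro J
      have hs := hk.isTractor.smooth φ
      have hs' := hk'.isTractor.smooth φ
      rw [← thomasD_add nab φ.2 hx 1 (fun J => Sm.thomasD nab hn φ.2 hx 2 (hs x hx) J)
        (fun J => Sm.thomasD nab hn φ.2 hx 2 (hs' x hx) J)]
      refine thomasD_congr nab hx 1 (fun y hy J => ?_) J
      rw [← thomasD_add nab φ.2 hy 2 (hs y hy) (hs' y hy)]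
      congr 1
      funext J z
      simp [Kt, mul_add, Finset.sum_add_distrib]
    simp only [e]
    rw [eta₄ I, youngP_cons, youngP_cons, youngP_cons]
    ring
  · rw [add_zero]

theorem splitting_smul (hn : 2 ≤ n) (c : ℝ) {k : TensorComp n M 2} (hk : IsSymTwoTensor 4 k) :
    splitting nab (c • k) = c • splitting nab k := by
  funext φ I x
  simp only [splitting, Pi.smul_apply, smul_eq_mul]
  split_ifs with hx
  · have e : ∀ J, thomasD nab φ.1 1 (thomasD nab φ.1 2 (Kt (c • k φ))) J x =
        c * thomasD nab φ.1 1 (thomasD nab φ.1 2 (Kt (k φ))) J x := by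
      intro J
      have hs := hk.isTractor.smooth φ
      rw [← thomasD_smul nab φ.2 hx 1 c (fun J => Sm.thomasD nab hn φ.2 hx 2 (hs x hx) J)]
      refine thomasD_congr nab hx 1 (fun y hy J => ?_) J
      rw [← thomasD_smul nab φ.2 hy 2 c (hs y hy)]
      congr 1
      funext J z
      simp only [Kt, Pi.smul_apply, smul_eq_mul, Finset.mul_sum]
      exact Finset.sum_congr rfl fun _ _ => Finset.sum_congr rfl fun _ _ => by ring
    simp only [e]
    rw [eta₄ I, youngP_cons, youngP_cons]
    ring
  · rw [mul_zero]

end splittingOperator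

/-! ### Contractions with the canonical tractor -/

section contractions

variable {n r : ℕ} {M : Type*} [TopologicalSpace M] [ChartedSpace (Model n) M]
  [IsManifold (𝓡 n) ∞ M] [T2Space M] (nab : AffineConnection n M)
  {φ : OpenPartialHomeomorph M (Model n)} {x : M}

/-- The commutation rule `𝔻_A (X^B V_{B…}) = X^B 𝔻_A V_{B…} + V_{A…}`. -/
theorem thomasD_contract {w w' : ℝ} (hw : w' = w + 1) (V : (Fin (r + 1) → TIdx n) → M → ℝ)
    (A : TIdx n) (I : Fin r → TIdx n) (x : M) :
    thomasD nab φ w' (fun J => V (Matrix.vecCons none J)) (Matrix.vecCons A I) x =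
      thomasD nab φ w V (Matrix.vecCons A (Matrix.vecCons none I)) x +
        V (Matrix.vecCons A I) x := by
  subst hw
  cases A with
  | none => rw [thomasD_none, thomasD_none]; ring
  | some a =>
    rw [thomasD_some, thomasD_some, sharp_cons]
    simp only [Fintype.sum_option, tgam_none_none, tgam_none_some, ite_mul, one_mul, zero_mul,
      Finset.sum_ite_eq, Finset.mem_univ, if_true]
    ring

/-- A linear relation between three permutations of a field is preserved by differentiation. -/
theorem thomasD_perm_relation (hφ : φ ∈ atlas (Model n) M) (hx : x ∈ φ.source) (w : ℝ)
    {V : (Fin r → TIdx n) → M → ℝ} (hV : ∀ J, Sm n (V J) x) (σ τ : Equiv.Perm (Fin r))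
    (h : ∀ y ∈ φ.source, ∀ J, V J y + V (J ∘ σ) y + V (J ∘ τ) y = 0) (A : TIdx n)
    (I : Fin r → TIdx n) :
    thomasD nab φ w V (Matrix.vecCons A I) x + thomasD nab φ w V (Matrix.vecCons A (I ∘ σ)) x +
      thomasD nab φ w V (Matrix.vecCons A (I ∘ τ)) x = 0 := by
  rw [← thomasD_perm, ← thomasD_perm, ← thomasD_add nab hφ hx w hV fun _ => hV _,
    ← thomasD_add nab hφ hx w (fun J => (hV J).add (hV _)) fun _ => hV _,
    thomasD_congr nab hx w (V' := fun _ _ => 0) h]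
  cases A with
  | none => rw [thomasD_none, mul_zero]
  | some a => rw [thomasD_some, pd_const φ a 0 x]; simp [sharp]

theorem ambDW_none_last (hn : 2 ≤ n) (hφ : φ ∈ atlas (Model n) M) (hx : x ∈ φ.source)
    (A B C H : TIdx n) : ambDW nab φ A B C H none x = - ambW nab φ B C H A x := by
  have h0 := ambW_none_last nab hn hφ hx
  cases A with
  | none => simp [ambDW, h0]
  | some a =>
    have e : pd φ a (ambW nab φ B C H none) x = 0 := by
      rw [pd_congr hx (eventually_source hx fun y hy => ambW_none_last nab hn hφ hy B C H) a]
      exact pd_const φ a 0 x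
    simp only [ambDW, e, h0, mul_zero, Finset.sum_const_zero, Fintype.sum_option,
      tgam_none_some, tgam_none_none]
    simp

/-- The differential of the algebraic Bianchi identity. -/
theorem ambDW_bianchi_last (hn : 2 ≤ n) (hφ : φ ∈ atlas (Model n) M) (hx : x ∈ φ.source)
    (E A B C H : TIdx n) : ambDW nab φ E A B H C x + ambDW nab φ E B C H A x +
      ambDW nab φ E C A H B x = 0 := by
  have hb := ambW_bianchi nab hn hφ hx
  cases E with
  | none => simp only [ambDW]; linear_combination -2 * hb A B C H
  | some a =>
    have e : pd φ a (ambW nab φ A B H C) x + pd φ a (ambW nab φ B C H A) x +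
        pd φ a (ambW nab φ C A H B) x = 0 := by
      have hs := fun A B C => Sm.ambW nab hn hφ hx A B H C
      rw [← pd_add hφ hx (hs _ _ _) (hs _ _ _), ← pd_add hφ hx ((hs _ _ _).add (hs _ _ _)) (hs _ _ _),
        pd_congr hx (eventually_source hx fun y hy => ambW_bianchi nab hn hφ hy A B C H) a]
      exact pd_const φ a 0 x
    have k : ∀ A B C, ∑ F, tgam nab φ a A F x * ambW nab φ F B H C x +
        ∑ F, tgam nab φ a A F x * ambW nab φ B C H F x +
        ∑ F, tgam nab φ a A F x * ambW nab φ C F H B x = 0 := by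
      intro A B C
      rw [← Finset.sum_add_distrib, ← Finset.sum_add_distrib]
      refine Finset.sum_eq_zero fun F _ => ?_
      linear_combination tgam nab φ a A F x * hb F B C H
    have k' : ∑ F, tgam nab φ a F H x * ambW nab φ A B F C x +
        ∑ F, tgam nab φ a F H x * ambW nab φ B C F A x +
        ∑ F, tgam nab φ a F H x * ambW nab φ C A F B x = 0 := by
      rw [← Finset.sum_add_distrib, ← Finset.sum_add_distrib]
      refine Finset.sum_eq_zero fun F _ => ?_
      linear_combination tgam nab φ a F H x * hb A B C F
    simp only [ambDW, Finset.sum_sub_distrib]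
    linear_combination e - k A B C - k B C A - k C A B + k'

end contractions

/-! ### The prolongation of a Killing tensor -/

section prolongation

variable {n : ℕ} {M : Type*} [TopologicalSpace M] [ChartedSpace (Model n) M]
  [IsManifold (𝓡 n) ∞ M] [T2Space M] (nab : AffineConnection n M)

/-- The tractor field `K_{AB} = Z_A^a Z_B^b k_{ab}` of a symmetric tensor, in a chart. -/
structure IsSymField (φ : OpenPartialHomeomorph M (Model n))
    (K : (Fin 2 → TIdx n) → M → ℝ) : Prop where
  smooth : ∀ x ∈ φ.source, ∀ J, Sm n (K J) x
  symm : ∀ x ∈ φ.source, ∀ A B, K ![A, B] x = K ![B, A] x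
  contract : ∀ x ∈ φ.source, ∀ B, K ![none, B] x = 0

/-- The Killing equation `𝔻_{(A} K_{BC)} = 0`, in a chart. -/
def KillingField (φ : OpenPartialHomeomorph M (Model n))
    (K : (Fin 2 → TIdx n) → M → ℝ) : Prop :=
  ∀ x ∈ φ.source, ∀ A B C, thomasD nab φ 2 K ![A, B, C] x + thomasD nab φ 2 K ![B, C, A] x +
    thomasD nab φ 2 K ![C, A, B] x = 0

theorem eta₂ (J : Fin 2 → TIdx n) : J = ![J 0, J 1] := by
  funext i; fin_cases i <;> rfl

theorem eta₃ (J : Fin 3 → TIdx n) : J = ![J 0, J 1, J 2] := by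
  funext i; fin_cases i <;> rfl

variable {φ : OpenPartialHomeomorph M (Model n)} {x : M} {K : (Fin 2 → TIdx n) → M → ℝ}

theorem IsSymField.D_symm (hK : IsSymField φ K) (hx : x ∈ φ.source) (A B C : TIdx n) :
    thomasD nab φ 2 K ![A, B, C] x = thomasD nab φ 2 K ![A, C, B] x := by
  have e : (![C, B] : Fin 2 → TIdx n) = ![B, C] ∘ Equiv.swap 0 1 := by
    funext i; fin_cases i <;> rfl
  rw [e, ← thomasD_perm]
  refine thomasD_congr nab hx 2 (fun y hy J => ?_) _
  rw [eta₂ J, hK.symm y hy]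
  congr 1
  funext i; fin_cases i <;> rfl

theorem IsSymField.D_none (A B : TIdx n) :
    thomasD nab φ 2 K ![none, A, B] x = 2 * K ![A, B] x := thomasD_none nab φ 2 K _ x

theorem IsSymField.D_mid_none (hK : IsSymField φ K) (hx : x ∈ φ.source) (A B : TIdx n) :
    thomasD nab φ 2 K ![A, none, B] x = - K ![A, B] x := by
  have h := thomasD_contract nab (φ := φ) (w := 2) rfl K A ![B] x
  rw [thomasD_congr nab hx (2 + 1) (V' := fun _ _ => 0) (fun y hy J => by
    rw [← hK.contract y hy (J 0)]; congr 1; funext i; fin_cases i <;> rfl)] at h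
  have h0 : thomasD nab φ (2 + 1) (fun _ _ => 0) (Matrix.vecCons A ![B]) x = 0 := by
    cases A with
    | none => rw [thomasD_none, mul_zero]
    | some a => rw [thomasD_some, pd_const φ a 0 x]; simp [sharp]
  rw [h0] at h
  linarith

theorem IsSymField.D_last_none (hK : IsSymField φ K) (hx : x ∈ φ.source) (A B : TIdx n) :
    thomasD nab φ 2 K ![A, B, none] x = - K ![A, B] x := by
  rw [hK.D_symm nab hx, hK.D_mid_none nab hx]

theorem IsSymField.smooth_D (hK : IsSymField φ K) (hn : 2 ≤ n) (hφ : φ ∈ atlas (Model n) M)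
    (hx : x ∈ φ.source) (J : Fin 3 → TIdx n) : Sm n (thomasD nab φ 2 K J) x :=
  Sm.thomasD nab hn hφ hx 2 (hK.smooth x hx) J

theorem IsSymField.smooth_DD (hK : IsSymField φ K) (hn : 2 ≤ n) (hφ : φ ∈ atlas (Model n) M)
    (hx : x ∈ φ.source) (J : Fin 4 → TIdx n) :
    Sm n (thomasD nab φ 1 (thomasD nab φ 2 K) J) x :=
  Sm.thomasD nab hn hφ hx 1 (fun J => hK.smooth_D nab hn hφ hx J) J

theorem IsSymField.DD_symm (hK : IsSymField φ K) (hx : x ∈ φ.source) (D E A B : TIdx n) :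
    thomasD nab φ 1 (thomasD nab φ 2 K) ![D, E, A, B] x =
      thomasD nab φ 1 (thomasD nab φ 2 K) ![D, E, B, A] x := by
  have e : (![E, B, A] : Fin 3 → TIdx n) = ![E, A, B] ∘ Equiv.swap 1 2 := by
    funext i; fin_cases i <;> rfl
  rw [e, ← thomasD_perm]
  refine thomasD_congr nab hx 1 (fun y hy J => ?_) _
  rw [eta₃ J, hK.D_symm nab hy]
  congr 1
  funext i; fin_cases i <;> rfl

theorem IsSymField.DDD_symm (hK : IsSymField φ K) (hx : x ∈ φ.source) (C D E A B : TIdx n) :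
    thomasD nab φ 0 (thomasD nab φ 1 (thomasD nab φ 2 K)) ![C, D, E, A, B] x =
      thomasD nab φ 0 (thomasD nab φ 1 (thomasD nab φ 2 K)) ![C, D, E, B, A] x := by
  have e : (![D, E, B, A] : Fin 4 → TIdx n) = ![D, E, A, B] ∘ Equiv.swap 2 3 := by
    funext i; fin_cases i <;> rfl
  rw [e, ← thomasD_perm]
  refine thomasD_congr nab hx 0 (fun y hy J => ?_) _
  rw [eta₄ J, hK.DD_symm nab hy]
  congr 1
  funext i; fin_cases i <;> rfl

theorem IsSymField.DD_none (D A B : TIdx n) :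
    thomasD nab φ 1 (thomasD nab φ 2 K) ![none, D, A, B] x = thomasD nab φ 2 K ![D, A, B] x :=
  (thomasD_none nab φ 1 _ _ x).trans (one_mul _)

theorem IsSymField.DD_snd_none (hK : IsSymField φ K) (hφ : φ ∈ atlas (Model n) M)
    (hx : x ∈ φ.source) (D A B : TIdx n) :
    thomasD nab φ 1 (thomasD nab φ 2 K) ![D, none, A, B] x = thomasD nab φ 2 K ![D, A, B] x := by
  have h := thomasD_contract nab (φ := φ) (w := 1) (w' := 2) (by norm_num) (thomasD nab φ 2 K) D
    ![A, B] x
  rw [thomasD_congr nab hx 2 (V' := fun J y => 2 * K J y) (fun y hy J => thomasD_none nab φ 2 K J y),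
    thomasD_smul nab hφ hx 2 2 (hK.smooth x hx)] at h
  linarith

theorem IsSymField.DD_thd_none (hK : IsSymField φ K) (hφ : φ ∈ atlas (Model n) M)
    (hx : x ∈ φ.source) (D E B : TIdx n) :
    thomasD nab φ 1 (thomasD nab φ 2 K) ![D, E, none, B] x =
      -thomasD nab φ 2 K ![D, E, B] x - thomasD nab φ 2 K ![E, D, B] x := by
  have h := thomasD_contract nab (φ := φ) (w := 1) (w' := 2) (by norm_num)
    (fun J : Fin 3 → TIdx n => thomasD nab φ 2 K (J ∘ Equiv.swap 0 1)) D ![E, B] x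
  rw [thomasD_congr nab hx 2 (V' := fun J y => (-1) * K J y) (fun y hy J => by
      rw [eta₂ J, neg_one_mul, ← hK.D_mid_none nab hy]
      congr 1; funext i; fin_cases i <;> rfl),
    thomasD_smul nab hφ hx 2 (-1) (hK.smooth x hx), thomasD_perm] at h
  have e₁ : (Matrix.vecCons none ![E, B] : Fin 3 → TIdx n) ∘ Equiv.swap 0 1 = ![E, none, B] := by
    funext i; fin_cases i <;> rfl
  have e₂ : (Matrix.vecCons D ![E, B] : Fin 3 → TIdx n) ∘ Equiv.swap 0 1 = ![E, D, B] := by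
    funext i; fin_cases i <;> rfl
  rw [e₁, e₂] at h
  linarith

theorem IsSymField.DD_fth_none (hK : IsSymField φ K) (hφ : φ ∈ atlas (Model n) M)
    (hx : x ∈ φ.source) (D E B : TIdx n) :
    thomasD nab φ 1 (thomasD nab φ 2 K) ![D, E, B, none] x =
      -thomasD nab φ 2 K ![D, E, B] x - thomasD nab φ 2 K ![E, D, B] x := by
  rw [hK.DD_symm nab hx, hK.DD_thd_none nab hφ hx]

/-- The leading slot of the splitting operator: `X^D X^E 𝓛(k)_{DEAB} = 3/2 K_{AB}`. -/
theorem IsSymField.youngP_none_none (hK : IsSymField φ K) (hφ : φ ∈ atlas (Model n) M)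
    (hx : x ∈ φ.source) (A B : TIdx n) :
    youngP (fun J => thomasD nab φ 1 (thomasD nab φ 2 K) J x) ![none, none, A, B] =
      3 / 2 * K ![A, B] x := by
  rw [youngP_cons]
  simp only [hK.DD_snd_none nab hφ hx, hK.DD_thd_none nab hφ hx,
    hK.DD_fth_none nab hφ hx, IsSymField.D_none, hK.D_mid_none nab hx, hK.D_last_none nab hx]
  linear_combination -(3 / 4) * hK.symm x hx A B

/-- The second slot of the splitting operator on a Killing tensor:
`X^E 𝓛(k)_{AEBC} = 3/4 𝔻_A K_{BC}`. -/
theorem IsSymField.youngP_snd_none (hK : IsSymField φ K) (hφ : φ ∈ atlas (Model n) M)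
    (hx : x ∈ φ.source) (hk : KillingField nab φ K) (A B C : TIdx n) :
    youngP (fun J => thomasD nab φ 1 (thomasD nab φ 2 K) J x) ![A, none, B, C] =
      3 / 4 * thomasD nab φ 2 K ![A, B, C] x := by
  rw [youngP_cons]
  simp only [IsSymField.DD_none, hK.DD_snd_none nab hφ hx, hK.DD_thd_none nab hφ hx,
    hK.DD_fth_none nab hφ hx]
  have h := hk x hx A B C
  have h1 := hK.D_symm nab hx A B C
  have h2 := hK.D_symm nab hx B A C
  have h3 := hK.D_symm nab hx C A B
  linarith

/-- The third derivatives of a Killing tensor are determined by its prolongation. -/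
theorem IsSymField.youngP_DDD (hK : IsSymField φ K) (hn : 2 ≤ n) (hφ : φ ∈ atlas (Model n) M)
    (hx : x ∈ φ.source) (hk : KillingField nab φ K) (C D E A B : TIdx n) :
    youngP (fun J => thomasD nab φ 0 (thomasD nab φ 1 (thomasD nab φ 2 K))
      (Matrix.vecCons C J) x) ![D, E, A, B] =
    chartQ nab φ x (youngP fun J => thomasD nab φ 1 (thomasD nab φ 2 K) J x) C D E A B := by
  set l := youngP fun J => thomasD nab φ 1 (thomasD nab φ 2 K) J x with hldef
  have hl : HasYoung22 l := hasYoung22_youngP _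
  have hl0 : ∀ A B, l ![none, none, A, B] = 3 / 2 * K ![A, B] x :=
    hK.youngP_none_none nab hφ hx
  have hl1 : ∀ A B C, l ![A, none, B, C] = 3 / 4 * thomasD nab φ 2 K ![A, B, C] x :=
    hK.youngP_snd_none nab hφ hx hk
  have hs := hK.D_symm nab hx
  have hc := hk x hx
  let Q : TIdx n → TIdx n → TIdx n → TIdx n → TIdx n → ℝ := fun A B C D E =>
    ∑ H, ambW nab φ A B H C x * thomasD nab φ 2 K ![D, H, E] x
  let S : TIdx n → TIdx n → TIdx n → TIdx n → TIdx n → ℝ := fun E A B C D =>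
    ∑ H, ambDW nab φ E A B H C x * K ![H, D] x
  -- the action on `𝔻K` in terms of `Q`
  have hQ : ∀ X Y i j k, sharp (fun H G => ambW nab φ X Y H G x)
      (fun J => thomasD nab φ 2 K J x) ![i, j, k] =
      Q X Y i j k + Q X Y i k j - Q X Y j i k - Q X Y k i j := by
    intro X Y i j k
    rw [sharp_cons, sharp_cons, sharp_cons, sharp_nil]
    simp only [Q, ← Finset.sum_add_distrib, ← Finset.sum_sub_distrib, ← Finset.sum_neg_distrib,
      add_zero]
    refine Finset.sum_congr rfl fun H _ => ?_
    linear_combination ambW nab φ X Y H i x * (hs j k H - hc H j k)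
      - ambW nab φ X Y H k x * hs i j H
  have hU : tracU nab φ x l = fun X Y i j k =>
      3 / 4 * (Q X Y i j k + Q X Y i k j - Q X Y j i k - Q X Y k i j) := by
    funext X Y i j k
    rw [← hQ, tracU, sharp_cons, sharp_cons, sharp_cons, sharp_cons, sharp_cons, sharp_cons,
      sharp_cons, sharp_nil, sharp_nil]
    simp only [ambW_none_last nab hn hφ hx, zero_mul, Finset.sum_const_zero, hl1, mul_neg, mul_add,
      Finset.mul_sum, mul_left_comm]
    ring
  have hV : tracV nab φ x l = fun X Y Z i j =>
      -3 / 2 * (S X Y Z i j + S X Y Z j i + Q Y Z X i j + Q Y Z X j i) := by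
    funext X Y Z i j
    have e0 : ∀ A B, l ![A, B, none, none] = 3 / 2 * K ![A, B] x := fun A B => by
      rw [hl.pair, hl0]
    have e1 : ∀ A B C, l ![B, C, A, none] = 3 / 4 * thomasD nab φ 2 K ![A, B, C] x :=
      fun A B C => by rw [hl.pair, hl1]
    have e2 : ∀ A B C, l ![B, C, none, A] = 3 / 4 * thomasD nab φ 2 K ![A, B, C] x :=
      fun A B C => by rw [hl.symm₂, e1]
    rw [tracV, sharp_cons, sharp_cons, sharp_cons, sharp_cons, sharp_nil]
    simp only [ambDW_none_last nab hn hφ hx, e0, e1, e2, Q, S, Finset.mul_sum, add_zero,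
      ← Finset.sum_add_distrib, ← Finset.sum_neg_distrib]
    refine Finset.sum_congr rfl fun H _ => ?_
    linear_combination (3 / 2 * ambW nab φ Y Z H X x) * (hc H i j - hs i j H)
      - 3 / 2 * ambDW nab φ X Y Z H j x * hK.symm x hx i H
  rw [chartQ, hU, hV]
  -- the once differentiated Killing equation, `𝔻_D` applied to the cyclic sum of `𝔻_E K_{AB}`
  have hcyc : ∀ y ∈ φ.source, ∀ J : Fin 4 → TIdx n, ∀ σ τ : Equiv.Perm (Fin 4),
      J ∘ σ = ![J 0, J 2, J 3, J 1] → J ∘ τ = ![J 0, J 3, J 1, J 2] →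
      thomasD nab φ 1 (thomasD nab φ 2 K) J y + thomasD nab φ 1 (thomasD nab φ 2 K) (J ∘ σ) y +
      thomasD nab φ 1 (thomasD nab φ 2 K) (J ∘ τ) y = 0 := by
    intro y hy J σ τ hσ hτ
    have h := thomasD_perm_relation nab hφ hy 1 (fun J => hK.smooth_D nab hn hφ hy J) (finRotate 3)
      (finRotate 3).symm (fun z hz J => by
        have e1 : J ∘ finRotate 3 = ![J 1, J 2, J 0] := by funext i; fin_cases i <;> rfl
        have e2 : J ∘ (finRotate 3).symm = ![J 2, J 0, J 1] := by funext i; fin_cases i <;> rfl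
        rw [e1, e2]
        nth_rw 1 [eta₃ J]
        exact hk z hz _ _ _) (J 0) ![J 1, J 2, J 3]
    have e1 : ![J 1, J 2, J 3] ∘ finRotate 3 = ![J 2, J 3, J 1] := by
      funext i; fin_cases i <;> rfl
    have e2 : ![J 1, J 2, J 3] ∘ (finRotate 3).symm = ![J 3, J 1, J 2] := by
      funext i; fin_cases i <;> rfl
    rw [e1, e2] at h
    rw [hσ, hτ]
    nth_rw 1 [eta₄ J]
    exact h
  have hb := ambW_bianchi nab hn hφ hx
  have e : (fun J => thomasD nab φ 0 (thomasD nab φ 1 (thomasD nab φ 2 K)) (Matrix.vecCons C J) x) =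
      fun J => thomasD nab φ 0 (thomasD nab φ 1 (thomasD nab φ 2 K))
        ![C, J 0, J 1, J 2, J 3] x := funext fun J => congrArg
          (fun J => thomasD nab φ 0 (thomasD nab φ 1 (thomasD nab φ 2 K)) (Matrix.vecCons C J) x)
          (eta₄ J)
  rw [e]
  exact youngP_eq_ambQ (Q := Q) (S := S) (T := fun C D E A B =>
      thomasD nab φ 0 (thomasD nab φ 1 (thomasD nab φ 2 K)) ![C, D, E, A, B] x)
    (fun C D E A B => hK.DDD_symm nab hx C D E A B)
    (fun C D E A B => by
      have h := thomasD_perm_relation nab hφ hx 0 (fun J => hK.smooth_DD nab hn hφ hx J)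
        (Equiv.swap 1 2 * Equiv.swap 2 3) (Equiv.swap 2 3 * Equiv.swap 1 2)
        (fun y hy J => hcyc y hy J _ _ (by funext i; fin_cases i <;> rfl)
          (by funext i; fin_cases i <;> rfl)) C ![D, E, A, B]
      have e1 : ![D, E, A, B] ∘ (Equiv.swap 1 2 * Equiv.swap 2 3 : Equiv.Perm (Fin 4)) =
          ![D, A, B, E] := by funext i; fin_cases i <;> rfl
      have e2 : ![D, E, A, B] ∘ (Equiv.swap 2 3 * Equiv.swap 1 2 : Equiv.Perm (Fin 4)) =
          ![D, B, E, A] := by funext i; fin_cases i <;> rfl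
      rw [e1, e2] at h
      exact h)
    (fun C D E A B => (thomasD_comm nab hn hφ hx (w := 1) (w' := 0) (by norm_num)
      (fun J => hK.smooth_D nab hn hφ hx J) C D ![E, A, B]).trans (hQ C D E A B))
    (fun C D E A B => by
      refine (thomasD_comm_inner nab hn hφ hx (w := 2) (w' := 1) (w'' := 0) (by norm_num)
        (by norm_num) hK.smooth C D E ![A, B]).trans ?_
      rw [sharp_cons, sharp_cons, sharp_cons, sharp_cons, sharp_nil, sharp_nil]
      simp only [Q, S, add_zero, ← Finset.sum_add_distrib, ← Finset.sum_neg_distrib]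
      refine Finset.sum_congr rfl fun H _ => ?_
      linear_combination (-ambDW nab φ C D E H B x) * hK.symm x hx A H
        - ambW nab φ D E H B x * hs C A H)
    (fun A B C D E => by
      simp only [Q, ← Finset.sum_add_distrib]
      refine Finset.sum_eq_zero fun H _ => ?_
      rw [ambW_anti nab φ A B]
      ring)
    (fun A B C D E => by
      simp only [Q, ← Finset.sum_add_distrib]
      refine Finset.sum_eq_zero fun H _ => ?_
      linear_combination thomasD nab φ 2 K ![D, H, E] x * hb A B C H)
    (fun E A B C D => by
      simp only [S, ← Finset.sum_add_distrib]
      refine Finset.sum_eq_zero fun H _ => ?_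
      rw [ambDW_anti nab E A B]
      ring)
    (fun E A B C D => by
      simp only [S, ← Finset.sum_add_distrib]
      refine Finset.sum_eq_zero fun H _ => ?_
      linear_combination K ![H, D] x * ambDW_bianchi_last nab hn hφ hx E A B C H)
    (fun E A B C D => by
      simp only [S, ← Finset.sum_add_distrib]
      refine Finset.sum_eq_zero fun H _ => ?_
      linear_combination K ![H, D] x * ambDW_bianchi nab hn hφ hx E A B H C)
    C D E A B

end prolongation

/-! ### Killing tensors and parallel sections -/

section killing

variable {n : ℕ} {M : Type*} [TopologicalSpace M] [ChartedSpace (Model n) M]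
  [IsManifold (𝓡 n) ∞ M] [T2Space M] (nab : AffineConnection n M)

theorem IsSymTwoTensor.isSymField {w : ℝ} {k : TensorComp n M 2} (hk : IsSymTwoTensor w k)
    (φ : atlas (Model n) M) : IsSymField φ.1 (Kt (k φ)) where
  smooth x hx J := Sm.Kt (fun I => sm_of_contMDiffOn φ.1.open_source (hk.smooth φ I) hx) J
  symm x _ A B := by
    cases A <;> cases B <;> simp only [Kt_none_left, Kt_none_right, Kt_some]
    exact hk.symm φ _ _ x
  contract x _ B := Kt_none_left _ B x

/-- The Killing equation is the tractor equation `𝔻_{(A} K_{BC)} = 0`: all components other than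
the one of the Killing operator vanish for every `k`. -/
theorem killingOp_eq_zero_iff {k : TensorComp n M 2} (hk : IsSymTwoTensor 4 k) :
    killingOp nab k = 0 ↔ ∀ φ : atlas (Model n) M, KillingField nab φ.1 (Kt (k φ)) := by
  constructor
  · intro h φ x hx A B C
    have hK := hk.isSymField φ
    rcases A with _ | a
    · rw [IsSymField.D_none, hK.D_mid_none nab hx, hK.D_last_none nab hx, hK.symm x hx C B]
      ring
    rcases B with _ | b
    · rw [IsSymField.D_none, hK.D_mid_none nab hx, hK.D_last_none nab hx, hK.symm x hx (some a) C]
      ring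
    rcases C with _ | c
    · rw [IsSymField.D_none, hK.D_mid_none nab hx, hK.D_last_none nab hx,
        hK.symm x hx (some a) (some b)]
      ring
    have h' := congrFun (congrFun (congrFun h φ) ![a, b, c]) x
    simp only [killingOp, if_pos hx, Pi.zero_apply, Matrix.cons_val] at h'
    rw [covTwo_cyc nab fun a b => hk.symm φ a b x] at h'
    linarith
  · intro h
    funext φ I x
    simp only [killingOp, Pi.zero_apply]
    split_ifs with hx
    · rw [covTwo_cyc nab fun a b => hk.symm φ a b x, h φ x hx, zero_div]
    · rfl

/-- The leading slot `X^D X^E 𝓛(k)_{DEAB} = 3/2 K_{AB}`. -/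
theorem splitting_none_none {w : ℝ} {k : TensorComp n M 2} (hk : IsSymTwoTensor w k)
    (φ : atlas (Model n) M) {x : M} (hx : x ∈ φ.1.source) (a b : Fin n) :
    splitting nab k φ ![none, none, some a, some b] x = 3 / 2 * k φ ![a, b] x := by
  simp only [splitting, if_pos hx]
  rw [(hk.isSymField φ).youngP_none_none nab φ.2 hx, Kt_some]

theorem splitting_injective {w : ℝ} {k k' : TensorComp n M 2} (hk : IsSymTwoTensor w k)
    (hk' : IsSymTwoTensor w k') (h : splitting nab k = splitting nab k') : k = k' := by
  funext φ I x
  by_cases hx : x ∈ φ.1.source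
  · have e : I = ![I 0, I 1] := by funext i; fin_cases i <;> rfl
    have h' := congrFun (congrFun (congrFun h φ) ![none, none, some (I 0), some (I 1)]) x
    rw [splitting_none_none nab hk φ hx, splitting_none_none nab hk' φ hx, ← e] at h'
    linarith
  · rw [hk.zero_off φ I x hx, hk'.zero_off φ I x hx]

/-- The prolongation of a Killing tensor is parallel. -/
theorem tractorConn_splitting (hn : 2 ≤ n) {k : TensorComp n M 2} (hk : IsKilling nab k) :
    tractorConn nab (splitting nab k) = Qsharp nab (splitting nab k) := by
  funext φ c I x
  simp only [tractorConn, Qsharp]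
  split_ifs with hx
  · have hK := hk.1.isSymField φ
    have e : (fun J => splitting nab k φ J x) =
        youngP fun J => thomasD nab φ.1 1 (thomasD nab φ.1 2 (Kt (k φ))) J x := by
      funext J
      simp only [splitting, if_pos hx]
    rw [tractorDeriv_zero, e, Qalg_eq nab (hasYoung22_youngP _),
      ← hK.youngP_DDD nab hn φ.2 hx ((killingOp_eq_zero_iff nab hk.1).1 hk.2 φ), ← eta₄ I,
      ← thomasD_youngP nab φ.2 hx 0 fun J => hK.smooth_DD nab hn φ.2 hx J]
    refine thomasD_congr nab hx 0 (fun y hy J => ?_) _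
    simp only [splitting, if_pos hy]
  · rfl

/-- The tensor `2/3 X^D X^E L_{DEab}` of which `L` is the prolongation. -/
def leadingSlot (L : CotractorComp n M 4) : TensorComp n M 2 := fun φ J x =>
  2 / 3 * L φ ![none, none, some (J 0), some (J 1)] x

theorem HasYoung22.none_none_none {l : (Fin 4 → TIdx n) → ℝ} (h : HasYoung22 l) (B : TIdx n) :
    l ![none, none, none, B] = 0 := by
  rw [h.pair, h.symm₁, h.none₃]

theorem Kt_leadingSlot {L : CotractorComp n M 4} (hL : IsT22 L) (φ : atlas (Model n) M)
    (J : Fin 2 → TIdx n) (x : M) : Kt (leadingSlot L φ) J x =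
      2 / 3 * L φ (Matrix.vecCons none (Matrix.vecCons none J)) x := by
  rw [eta₂ J]
  have h0 : ∀ B, L φ ![none, none, none, B] x = 0 := fun B => (hL.young φ x).none_none_none B
  have h1 : ∀ A, L φ ![none, none, A, none] x = 0 := fun A =>
    ((hL.young φ x).symm₂ none none A none).trans (h0 A)
  cases J 0 with
  | none => rw [Kt_none_left, h0, mul_zero]
  | some a => cases J 1 with
    | none => rw [Kt_none_right, h1, mul_zero]
    | some b => rw [Kt_some]; rfl

theorem isSymTwoTensor_leadingSlot {L : CotractorComp n M 4} (hL : IsT22 L) :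
    IsSymTwoTensor 4 (leadingSlot L) where
  symm φ a b x := congrArg _ ((hL.young φ x).symm₂ none none (some a) (some b))
  smooth φ I := contMDiffOn_const.mul (hL.smooth φ _)
  zero_off φ I x hx := by rw [leadingSlot, hL.zero_off φ _ x hx, mul_zero]
  trans φ ψ I x hx := by
    have hd : dens 4 φ.1 ψ.1 x = dens 2 φ.1 ψ.1 x * (dens 1 φ.1 ψ.1 x * dens 1 φ.1 ψ.1 x) := by
      rw [← dens_add φ.2 ψ.2 hx.1 hx.2, ← dens_add φ.2 ψ.2 hx.1 hx.2]
      norm_num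
    have h := ((hL.isTractor.plug (w' := 1) (by norm_num)).plug (w' := 2) (by norm_num)).trans
      φ ψ x hx ![some (I 0), some (I 1)]
    have h0 : ∀ B, L ψ ![none, none, none, B] x = 0 := fun B => (hL.young ψ x).none_none_none B
    have h1 : ∀ A, L ψ ![none, none, A, none] x = 0 := fun A =>
      ((hL.young ψ x).symm₂ none none A none).trans (h0 A)
    rw [tens_cons] at h
    simp only [tens_cons] at h
    have e : ∀ C D, tens (cotractorTrans φ.1 ψ.1 x) (fun J : Fin 0 → TIdx n =>
        L ψ (Matrix.vecCons none (Matrix.vecCons none (Matrix.vecCons C (Matrix.vecCons D J)))) x)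
          ![] = L ψ ![none, none, C, D] x := by
      intro C D
      simp [tens]
      rfl
    simp only [e, Fintype.sum_option, h0, h1, mul_zero, zero_add,
      Finset.sum_const_zero, cotractorTrans] at h
    simp only [leadingSlot]
    refine (congrArg (fun t => 2 / 3 * t) h).trans ?_
    rw [hd, ← (finTwoArrowEquiv (Fin n)).symm.sum_comp, Fintype.sum_prod_type]
    simp only [finTwoArrowEquiv_symm_apply, Fin.prod_univ_two, Matrix.cons_val_zero,
      Matrix.cons_val_one, Finset.mul_sum]
    exact Finset.sum_congr rfl fun _ _ => Finset.sum_congr rfl fun _ _ => by ring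

/-- A parallel section satisfies `𝔻_C L = Q_C♯L` in all tractor directions. -/
theorem thomasD_eq_chartQ {L : CotractorComp n M 4} (hL : IsT22 L)
    (h : tractorConn nab L = Qsharp nab L) (φ : atlas (Model n) M) {x : M} (hx : x ∈ φ.1.source)
    (C : TIdx n) (I : Fin 4 → TIdx n) : thomasD nab φ.1 0 (L φ) (Matrix.vecCons C I) x =
      chartQ nab φ.1 x (fun J => L φ J x) C (I 0) (I 1) (I 2) (I 3) := by
  cases C with
  | none => rw [thomasD_none, zero_mul, chartQ_none nab (hL.young φ x)]
  | some c =>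
    have h' := congrFun (congrFun (congrFun (congrFun h φ) c) I) x
    simp only [tractorConn, Qsharp, if_pos hx] at h'
    rw [← tractorDeriv_zero, h', Qalg_eq nab (hL.young φ x)]

/-- For a parallel section, `L_{DEAB}` contracted once with `X` is the derivative of its leading
slot. -/
theorem thomasD_leadingSlot {L : CotractorComp n M 4} (hL : IsT22 L)
    (h : tractorConn nab L = Qsharp nab L) (φ : atlas (Model n) M) {x : M} (hx : x ∈ φ.1.source)
    (I : Fin 3 → TIdx n) : thomasD nab φ.1 2 (Kt (leadingSlot L φ)) I x =
      4 / 3 * L φ (Matrix.vecCons none I) x := by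
  have hs := hL.isTractor.smooth φ x hx
  rw [eta₃ I, thomasD_congr nab hx 2 fun y _ J => Kt_leadingSlot hL φ J y,
    thomasD_smul nab φ.2 hx 2 _ fun J => hs _]
  have h1 := thomasD_contract nab (φ := φ.1) (w := 1) (w' := 2) (by norm_num)
    (fun J : Fin 3 → TIdx n => L φ (Matrix.vecCons none J)) (I 0) ![I 1, I 2] x
  have h2 := thomasD_contract nab (φ := φ.1) (w := 0) (w' := 1) (by norm_num) (L φ) (I 0)
    ![none, I 1, I 2] x
  rw [thomasD_eq_chartQ nab hL h φ hx] at h2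
  have h3 := chartQ_none_none nab (φ := φ.1) (x := x) (hL.young φ x) (I 0) (I 1) (I 2)
  have h4 := (hL.young φ x).symm₁ (I 0) none (I 1) (I 2)
  refine (congrArg (fun t => 2 / 3 * t) h1).trans ?_
  refine (congrArg (fun t => 2 / 3 * (t + _)) h2).trans ?_
  refine (congrArg (fun t => 2 / 3 * (t + _ + _)) h3).trans ?_
  refine (congrArg (fun t => 2 / 3 * (0 + t + _)) h4).trans ?_
  ring

theorem isKilling_leadingSlot {L : CotractorComp n M 4} (hL : IsT22 L)
    (h : tractorConn nab L = Qsharp nab L) : IsKilling nab (leadingSlot L) := by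
  have hk := isSymTwoTensor_leadingSlot hL
  refine ⟨hk, (killingOp_eq_zero_iff nab hk).2 fun φ x hx A B C => ?_⟩
  simp only [thomasD_leadingSlot nab hL h φ hx]
  have hy := hL.young φ x
  linear_combination 4 / 3 * (hy.bianchi A B C none + hy.pair none A B C + hy.pair none B C A
    + hy.pair none C A B + hy.symm₂ B C none A + hy.symm₂ C A none B + hy.symm₂ A B none C)

/-- A parallel section is the prolongation of its leading slot. -/
theorem splitting_leadingSlot {L : CotractorComp n M 4} (hn : 2 ≤ n) (hL : IsT22 L)
    (h : tractorConn nab L = Qsharp nab L) : splitting nab (leadingSlot L) = L := by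
  funext φ I x
  simp only [splitting]
  split_ifs with hx
  · have hy := hL.young φ x
    have hs := hL.isTractor.smooth φ x hx
    have e : (fun J => thomasD nab φ.1 1 (thomasD nab φ.1 2 (Kt (leadingSlot L φ))) J x) =
        fun J => 4 / 3 * (chartQ nab φ.1 x (fun J => L φ J x) (J 0) none (J 1) (J 2) (J 3) +
          L φ J x) := by
      funext J
      rw [thomasD_congr nab hx 1 fun y hy J => thomasD_leadingSlot nab hL h φ hy J,
        thomasD_smul nab φ.2 hx 1 _ fun J => hs _]
      have h1 := thomasD_contract nab (φ := φ.1) (w := 0) (w' := 1) (by norm_num) (L φ) (J 0)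
        (Fin.tail J) x
      rw [thomasD_eq_chartQ nab hL h φ hx, vecCons_eta] at h1
      rw [h1]
      rfl
    have h1 := youngP_chartQ nab hn φ.2 hx hy I
    have h2 := congrFun hy.youngP_eq I
    rw [e]
    rw [eta₄ I, youngP_cons] at h1 h2 ⊢
    simp only [Matrix.cons_val] at h1
    simp only [Matrix.cons_val]
    linear_combination 4 / 3 * (h1 + h2)
  · rw [hL.zero_off φ I x hx]

theorem bijOn_splitting (hn : 2 ≤ n) : Set.BijOn (splitting nab) {k | IsKilling nab k}
    {L | IsT22 L ∧ tractorConn nab L = Qsharp nab L} :=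
  ⟨fun _ hk => ⟨isT22_splitting nab hn hk.1, tractorConn_splitting nab hn hk⟩,
    fun _ hk _ hk' h => splitting_injective nab hk.1 hk'.1 h,
    fun _ hL => ⟨_, isKilling_leadingSlot nab hL.1 hL.2, splitting_leadingSlot nab hn hL.1 hL.2⟩⟩

end killing

end ProjTractor

end

theorem mainTheorem5 (n : ℕ) (hn : 2 ≤ n) (M : Type*) [TopologicalSpace M] [T2Space M]
    [SecondCountableTopology M] [ChartedSpace (ProjTractor.Model n) M]
    [IsManifold (𝓡 n) ∞ M] (p : ProjTractor.ProjectiveStructure n M) :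
    -- projective invariance of the Killing operator, of the splitting operator, of the tractor
    -- connection, of the right hand side `Q♯L`, hence of the connection `∇ - Q♯`
    (∀ nab ∈ p.connections, ∀ nab' ∈ p.connections,
      (∀ k, ProjTractor.IsSymTwoTensor 4 k →
        ProjTractor.killingOp nab k = ProjTractor.killingOp nab' k ∧
        ProjTractor.splitting nab k = ProjTractor.splitting nab' k) ∧
      (∀ L, ProjTractor.IsT22 L →
        ProjTractor.tractorConn nab L = ProjTractor.tractorConn nab' L ∧
        ProjTractor.Qsharp nab L = ProjTractor.Qsharp nab' L ∧
        ProjTractor.prolongConn nab L = ProjTractor.prolongConn nab' L)) ∧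
    ∀ nab ∈ p.connections,
      -- the splitting operator is a linear map from sections of `S²T*M(4)` to sections
      -- of `𝓣_(2,2)`
      (∀ k, ProjTractor.IsSymTwoTensor 4 k → ProjTractor.IsT22 (ProjTractor.splitting nab k)) ∧
      (∀ k k', ProjTractor.IsSymTwoTensor 4 k → ProjTractor.IsSymTwoTensor 4 k' →
        ProjTractor.splitting nab (k + k') =
          ProjTractor.splitting nab k + ProjTractor.splitting nab k') ∧
      (∀ (r : ℝ) (k), ProjTractor.IsSymTwoTensor 4 k →
        ProjTractor.splitting nab (r • k) = r • ProjTractor.splitting nab k) ∧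
      -- it restricts to a bijection from the Killing tensors to the solutions of `∇L = Q♯L`
      Set.BijOn (ProjTractor.splitting nab) {k | ProjTractor.IsKilling nab k}
        {L | ProjTractor.IsT22 L ∧ ProjTractor.tractorConn nab L = ProjTractor.Qsharp nab L} ∧
      -- these are the parallel sections of the connection `∇ - Q♯` on `𝓣_(2,2)`
      ProjTractor.IsT22Connection (ProjTractor.tractorConn nab) ∧
      ProjTractor.IsT22EndForm (ProjTractor.Qsharp nab) ∧
      ProjTractor.IsT22Connection (ProjTractor.prolongConn nab) ∧
      Set.BijOn (ProjTractor.splitting nab) {k | ProjTractor.IsKilling nab k}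
        {L | ProjTractor.IsT22 L ∧ ProjTractor.prolongConn nab L = 0} := by
  refine ⟨fun nab hnab nab' hnab' => ?_, fun nab _ => ?_⟩
  · have h := (p.isClass nab hnab nab').1 hnab'
    refine ⟨fun k hk => ⟨h.killingOp_eq hn hk, h.splitting_eq hn k⟩, fun L hL => ?_⟩
    have h1 := h.tractorConn_eq hn L
    have h2 := h.Qsharp_eq hn hL
    exact ⟨h1, h2, congrArg₂ (· - ·) h1 h2⟩
  · have hb := ProjTractor.bijOn_splitting nab hn
    refine ⟨fun k => ProjTractor.isT22_splitting nab hn,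
      fun k k' => ProjTractor.splitting_add nab hn,
      fun r k => ProjTractor.splitting_smul nab hn r, hb,
      ProjTractor.isT22Connection_tractorConn nab hn, ProjTractor.isT22EndForm_Qsharp nab hn,
      ProjTractor.isT22Connection_prolongConn nab hn, ?_⟩
    simpa only [ProjTractor.prolongConn, sub_eq_zero] using hb
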